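/- Let $\Omega=(0,1)$, $T>0$, $Q_T=\Omega\times(0,T)$. Let $H^1_{(0)}(\Omega)=\{z\in H^1(\Omega): z(0)=0\}$ with the norm $\|z\|_{H^1_{(0)}(\Omega)}=\|\partial_x z\|_{L^2(\Omega)}$, and let $H^{-1}_{(0)}(\Omega)$ be its dual space, with $L^2(\Omega)\subset H^{-1}_{(0)}(\Omega)$ through $\langle w,z\rangle=\int_\Omega wz\,dx$. Let $A\in L^\infty(Q_T)$, $B\in L^1(0,T;L^2(\Omega))$, $v\in L^2(0,T)$ and $(u_0,u_1)\in H^1_{(0)}(\Omega)\times L^2(\Omega)$, and consider $$\partial_{tt}y-\partial_{xx}y+Ay=B \text{ in } Q_T,\qquad y(0,\cdot)=0,\ \partial_x y(1,\cdot)=v \text{ in } (0,T),\qquad (y(\cdot,0),\partial_t y(\cdot,0))=(u_0,u_1) \text{ in } \Omega. \tag{1}$$ A weak solution of (1) is a function $y\in L^2(0,T;H^1_{(0)}(\Omega))\cap H^1(0,T;L^2(\Omega))\cap W^{2,1}(0,T;H^{-1}_{(0)}(\Omega))$ such that, for a.e. $t\in(0,T)$ and all $z\in H^1_{(0)}(\Omega)$,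 $$\langle\partial_{tt}y(\cdot,t),z\rangle_{H^{-1}_{(0)}(\Omega),H^1_{(0)}(\Omega)}-v(t)z(1)+\int_\Omega\partial_x y\,\partial_x z\,dx+\int_\Omega Ayz\,dx=\int_\Omega Bz\,dx,$$ and $y(\cdot,0)=u_0$, $\partial_t y(\cdot,0)=u_1$ (as values at $0$ of the continuous representatives of $y$ in $L^2(\Omega)$ and of $\partial_t y$ in $H^{-1}_{(0)}(\Omega)$). **Theorem.** Equation (1) has a unique weak solution $y$. It satisfies $y\in C^0([0,T];H^1_{(0)}(\Omega))\cap C^1([0,T];L^2(\Omega))$, and, if moreover $B\in L^2(0,T;L^2(\Omega))$, then $y\in H^2(0,T;H^{-1}_{(0)}(\Omega))$. There is a constant $C=C(T)>0$, depending only on $T$ (in particular not on $A$, $B$, $v$, $u_0$, $u_1$), such that for every $t\in[0,T]$ $$\|y(\cdot,t)\|_{H^1_{(0)}(\Omega)}+\|\partial_t y(\cdot,t)\|_{L^2(\Omega)}\le Ce^{C\sqrt{\|A\|_{L^\infty(Q_T)}}}\Big(\|(u_0,u_1)\|_{H^1_{(0)}(\Omega)\times L^2(\Omega)}+\|B\|_{L^1(0,t;L^2(\Omega))}+\|v\|_{L^2(0,t)}\Big).$$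 Moreover $y(1,\cdot)\in H^1(0,T)$, and for every $t\in[0,T]$ $$\|\partial_t y(1,\cdot)\|_{L^2(0,t)}\le Ce^{C\sqrt{\|A\|_{L^\infty(Q_T)}}}\Big(\|(u_0,u_1)\|_{H^1_{(0)}(\Omega)\times L^2(\Omega)}+\|B\|_{L^1(0,t;L^2(\Omega))}+\|v\|_{L^2(0,t)}\Big).$$ -/

import Mathlib

open MeasureTheory Set
open scoped ENNReal ContDiff

noncomputable section

namespace Wave1D

/-- Lebesgue measure on the open interval `(a, b)`. -/
abbrev leb (a b : ℝ) : Measure ℝ := volume.restrict (Ioo a b)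

/-- `g` is the weak (distributional) derivative of `f` on `(a, b)`. It is used for functions that
are integrable on `(a, b)` with values in a Banach space `E`. -/
def IsWeakDeriv {E : Type*} [NormedAddCommGroup E] [NormedSpace ℝ E] (a b : ℝ) (f g : ℝ → E) :
    Prop :=
  ∀ φ : ℝ → ℝ, ContDiff ℝ ∞ φ → HasCompactSupport φ → tsupport φ ⊆ Ioo a b →
    ∫ s, deriv φ s • f s ∂(leb a b) = -∫ s, φ s • g s ∂(leb a b)

/-- `f` has a representative that is continuous on `[a, b]` and takes the value `e` at `c`. -/
def HasValueAt {E : Type*} [TopologicalSpace E] (a b : ℝ) (f : ℝ → E) (c : ℝ) (e : E) : Prop :=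
  ∃ r : ℝ → E, ContinuousOn r (Icc a b) ∧ f =ᵐ[leb a b] r ∧ r c = e

/-- The norm of `f` in `L^p(a, b; E)`. -/
def lpNorm {E : Type*} [NormedAddCommGroup E] (p : ℝ≥0∞) (a b : ℝ) (f : ℝ → E) : ℝ :=
  (eLpNorm f p (leb a b)).toReal

/-- `L²(Ω)`, where `Ω = (0, 1)`. -/
abbrev L2 : Type := Lp ℝ 2 (leb 0 1)

lemma L2.integrable (f : L2) : Integrable (f : ℝ → ℝ) (leb 0 1) :=
  (Lp.memLp f).integrable (by norm_num)

lemma test_smul_integrable (f : L2) {φ : ℝ → ℝ} (hφ : Continuous φ) (hc : HasCompactSupport φ) :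
    Integrable (fun s => φ s • (f : ℝ → ℝ) s) (leb 0 1) := by
  obtain ⟨C, hC⟩ := hc.exists_bound_of_continuous hφ
  exact (L2.integrable f).bdd_mul hφ.aestronglyMeasurable (Filter.Eventually.of_forall hC)

/-- The graph of `∂ₓ` on `H¹_{(0)}(Ω)`: the pairs `(z, z')` in `L²(Ω) × L²(Ω)` such that `z'` is the
weak derivative of `z` and `z(0) = 0`. -/
def h1ZeroGraph : Submodule ℝ (L2 × L2) where
  carrier := {p | IsWeakDeriv 0 1 (p.1 : ℝ → ℝ) (p.2 : ℝ → ℝ) ∧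
    HasValueAt 0 1 (p.1 : ℝ → ℝ) 0 0}
  zero_mem' := by
    refine ⟨fun φ _ _ _ => ?_, fun _ => 0, continuousOn_const, Lp.coeFn_zero _ _ _, rfl⟩
    have h : ((0 : L2 × L2).1 : ℝ → ℝ) =ᵐ[leb 0 1] 0 := Lp.coeFn_zero _ _ _
    have h' : ((0 : L2 × L2).2 : ℝ → ℝ) =ᵐ[leb 0 1] 0 := Lp.coeFn_zero _ _ _
    rw [integral_eq_zero_of_ae, integral_eq_zero_of_ae, neg_zero]
    · filter_upwards [h'] with s hs
      simp only [hs, Pi.zero_apply, smul_zero]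
    · filter_upwards [h] with s hs
      simp only [hs, Pi.zero_apply, smul_zero]
  add_mem' := by
    rintro p q ⟨hp, r, hr, hpr, hr0⟩ ⟨hq, r', hr', hqr, hr0'⟩
    refine ⟨fun φ h1 h2 h3 => ?_, r + r', hr.add hr',
      (Lp.coeFn_add p.1 q.1).trans (hpr.add hqr), by simp [hr0, hr0']⟩
    have hd : Continuous (deriv φ) := h1.continuous_deriv (by simp)
    have e1 : ∫ s, deriv φ s • ((p + q).1 : ℝ → ℝ) s ∂(leb 0 1)
        = ∫ s, (deriv φ s • (p.1 : ℝ → ℝ) s + deriv φ s • (q.1 : ℝ → ℝ) s) ∂(leb 0 1) := by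
      refine integral_congr_ae ?_
      filter_upwards [Lp.coeFn_add p.1 q.1] with s hs
      rw [Prod.fst_add, hs, Pi.add_apply, smul_add]
    have e2 : ∫ s, φ s • ((p + q).2 : ℝ → ℝ) s ∂(leb 0 1)
        = ∫ s, (φ s • (p.2 : ℝ → ℝ) s + φ s • (q.2 : ℝ → ℝ) s) ∂(leb 0 1) := by
      refine integral_congr_ae ?_
      filter_upwards [Lp.coeFn_add p.2 q.2] with s hs
      rw [Prod.snd_add, hs, Pi.add_apply, smul_add]
    rw [e1, e2, integral_add (test_smul_integrable _ hd h2.deriv)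
      (test_smul_integrable _ hd h2.deriv), integral_add
      (test_smul_integrable _ h1.continuous h2) (test_smul_integrable _ h1.continuous h2),
      hp φ h1 h2 h3, hq φ h1 h2 h3]
    ring
  smul_mem' := by
    rintro c p ⟨hp, r, hr, hpr, hr0⟩
    refine ⟨fun φ h1 h2 h3 => ?_, c • r, hr.const_smul c,
      (Lp.coeFn_smul c p.1).trans (hpr.const_smul c), by simp [hr0]⟩
    have e1 : ∫ s, deriv φ s • ((c • p).1 : ℝ → ℝ) s ∂(leb 0 1)
        = ∫ s, c • (deriv φ s • (p.1 : ℝ → ℝ) s) ∂(leb 0 1) := by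
      refine integral_congr_ae ?_
      filter_upwards [Lp.coeFn_smul c p.1] with s hs
      rw [Prod.smul_fst, hs, Pi.smul_apply, smul_comm]
    have e2 : ∫ s, φ s • ((c • p).2 : ℝ → ℝ) s ∂(leb 0 1)
        = ∫ s, c • (φ s • (p.2 : ℝ → ℝ) s) ∂(leb 0 1) := by
      refine integral_congr_ae ?_
      filter_upwards [Lp.coeFn_smul c p.2] with s hs
      rw [Prod.smul_snd, hs, Pi.smul_apply, smul_comm]
    rw [e1, e2, integral_smul, integral_smul, hp φ h1 h2 h3, smul_neg]

/-- The Hilbert space `H¹_{(0)}(Ω) = {z ∈ H¹(Ω) : z(0) = 0}`. An element carries its weak derivative,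
which is determined by it. -/
def H1Zero : Type := h1ZeroGraph

namespace H1Zero

instance : AddCommGroup H1Zero := inferInstanceAs (AddCommGroup h1ZeroGraph)

instance : Module ℝ H1Zero := inferInstanceAs (Module ℝ h1ZeroGraph)

/-- The inclusion `H¹_{(0)}(Ω) → L²(Ω)`. -/
def toL2 : H1Zero →ₗ[ℝ] L2 := (LinearMap.fst ℝ L2 L2) ∘ₗ h1ZeroGraph.subtype

/-- The weak derivative `∂ₓ : H¹_{(0)}(Ω) → L²(Ω)`. -/
def dx : H1Zero →ₗ[ℝ] L2 := (LinearMap.snd ℝ L2 L2) ∘ₗ h1ZeroGraph.subtype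

/-- The representative of `z` that is continuous on `[0, 1]`; only its values on `[0, 1]` matter, and
these are determined by `z`. -/
def rep (z : H1Zero) : ℝ → ℝ := Classical.choose (show h1ZeroGraph from z).2.2

lemma isWeakDeriv (z : H1Zero) : IsWeakDeriv 0 1 (toL2 z : ℝ → ℝ) (dx z : ℝ → ℝ) :=
  (show h1ZeroGraph from z).2.1

lemma continuousOn_rep (z : H1Zero) : ContinuousOn z.rep (Icc 0 1) :=
  (Classical.choose_spec (show h1ZeroGraph from z).2.2).1

lemma toL2_ae_eq_rep (z : H1Zero) : (toL2 z : ℝ → ℝ) =ᵐ[leb 0 1] z.rep :=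
  (Classical.choose_spec (show h1ZeroGraph from z).2.2).2.1

lemma rep_zero (z : H1Zero) : z.rep 0 = 0 :=
  (Classical.choose_spec (show h1ZeroGraph from z).2.2).2.2

/-- `z(x) = ∫₀ˣ z'`. -/
lemma rep_eq_integral (z : H1Zero) {x : ℝ} (hx : x ∈ Icc (0 : ℝ) 1) :
    z.rep x = ∫ s in (0 : ℝ)..x, (dx z : ℝ → ℝ) s := by
  set g : ℝ → ℝ := (dx z : ℝ → ℝ) with hg
  have hgi : IntervalIntegrable g volume 0 1 := by
    rw [intervalIntegrable_iff_integrableOn_Ioo_of_le zero_le_one]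
    exact L2.integrable (dx z)
  set G : ℝ → ℝ := fun x => ∫ s in (0 : ℝ)..x, g s with hG
  have hGac : AbsolutelyContinuousOnInterval G 0 1 :=
    hgi.absolutelyContinuousOnInterval_intervalIntegral (by simp)
  have hGc : ContinuousOn G (Icc 0 1) := by
    simpa [uIcc_of_le (zero_le_one : (0 : ℝ) ≤ 1)] using hGac.continuousOn
  set h : ℝ → ℝ := fun x => z.rep x - G x with hh
  have hhc : ContinuousOn h (Icc 0 1) := (continuousOn_rep z).sub hGc
  have hhi : Integrable h (leb 0 1) :=
    (hhc.integrableOn_compact isCompact_Icc).mono_set Ioo_subset_Icc_self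
  have conv (F : ℝ → ℝ) : ∫ s in (0 : ℝ)..1, F s = ∫ s, F s ∂(leb 0 1) := by
    rw [intervalIntegral.integral_of_le zero_le_one, integral_Ioc_eq_integral_Ioo]
  have tint {F φ : ℝ → ℝ} (hF : Integrable F (leb 0 1)) (hφ : Continuous φ)
      (hc : HasCompactSupport φ) : Integrable (fun s => φ s * F s) (leb 0 1) := by
    obtain ⟨C, hC⟩ := hc.exists_bound_of_continuous hφ
    exact hF.bdd_mul hφ.aestronglyMeasurable (Filter.Eventually.of_forall hC)
  have key : ∀ φ : ℝ → ℝ, ContDiff ℝ ∞ φ → HasCompactSupport φ → tsupport φ ⊆ Ioo 0 1 →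
      ∫ s, deriv φ s * h s ∂(leb 0 1) = 0 := by
    intro φ h1 h2 h3
    have hd : Continuous (deriv φ) := h1.continuous_deriv (by simp)
    have φ0 : φ 0 = 0 := by
      by_contra hne
      exact absurd (h3 (subset_tsupport φ hne)).1 (lt_irrefl _)
    have φ1 : φ 1 = 0 := by
      by_contra hne
      exact absurd (h3 (subset_tsupport φ hne)).2 (lt_irrefl _)
    have hφac : AbsolutelyContinuousOnInterval φ 0 1 :=
      (h1.of_le (by simp)).contDiffOn.absolutelyContinuousOnInterval
    have ibp := hφac.integral_mul_deriv_eq_deriv_mul hGac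
    rw [φ0, φ1] at ibp
    have e : ∫ s in (0 : ℝ)..1, φ s * deriv G s = ∫ s in (0 : ℝ)..1, φ s * g s := by
      refine intervalIntegral.integral_congr_ae ?_
      filter_upwards [hgi.ae_hasDerivAt_integral] with s hs hs'
      rw [(hs (uIoc_subset_uIcc hs') 0 (by simp)).deriv]
    rw [e, conv, conv] at ibp
    have w := isWeakDeriv z φ h1 h2 h3
    have w' : ∫ s, deriv φ s • (toL2 z : ℝ → ℝ) s ∂(leb 0 1)
        = ∫ s, deriv φ s * z.rep s ∂(leb 0 1) := by
      refine integral_congr_ae ?_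
      filter_upwards [toL2_ae_eq_rep z] with s hs
      rw [hs, smul_eq_mul]
    rw [w'] at w
    simp only [smul_eq_mul] at w
    have hri : Integrable z.rep (leb 0 1) :=
      ((continuousOn_rep z).integrableOn_compact isCompact_Icc).mono_set Ioo_subset_Icc_self
    have hGi : Integrable G (leb 0 1) :=
      (hGc.integrableOn_compact isCompact_Icc).mono_set Ioo_subset_Icc_self
    simp only [hh, mul_sub]
    rw [integral_sub (tint hri hd h2.deriv) (tint hGi hd h2.deriv), w]
    linarith
  -- a fixed test function of integral one
  let ψb : ContDiffBump (1 / 2 : ℝ) := ⟨1 / 8, 1 / 4, by norm_num, by norm_num⟩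
  set ψ : ℝ → ℝ := ψb.normed volume with hψ
  have ψs : ContDiff ℝ ∞ ψ := ψb.contDiff_normed
  have ψc : HasCompactSupport ψ := ψb.hasCompactSupport_normed
  have ψt : tsupport ψ ⊆ Ioo 0 1 := by
    rw [hψ, ψb.tsupport_normed_eq, Real.closedBall_eq_Icc]
    intro s hs
    have h1 : (1 / 2 : ℝ) - 1 / 4 ≤ s := hs.1
    have h2 : s ≤ (1 / 2 : ℝ) + 1 / 4 := hs.2
    constructor <;> linarith
  have ψi : ∫ s, ψ s = 1 := ψb.integral_normed
  set K : ℝ := ∫ s, ψ s * h s ∂(leb 0 1) with hK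
  have hae : ∀ᵐ s, s ∈ Ioo (0 : ℝ) 1 → h s - K = 0 := by
    refine isOpen_Ioo.ae_eq_zero_of_integral_contDiff_smul_eq_zero ?_ ?_
    · exact IntegrableOn.locallyIntegrableOn (hhi.sub (integrable_const K))
    intro η ηs ηc ηt
    set c : ℝ := ∫ s, η s with hc
    set θ : ℝ → ℝ := fun s => η s - c * ψ s with hθ
    have θs : ContDiff ℝ ∞ θ := ηs.sub (contDiff_const.mul ψs)
    have θcont : Continuous θ := θs.continuous
    have θc : HasCompactSupport θ := ηc.sub (ψc.mul_left)
    have θt : tsupport θ ⊆ Ioo 0 1 := by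
      refine (tsupport_sub η (fun s => c * ψ s)).trans (union_subset ηt ?_)
      exact (tsupport_mul_subset_right (f := fun _ => c) (g := ψ)).trans ψt
    have suppint {F : ℝ → ℝ} (hF : tsupport F ⊆ Ioo 0 1) (k : ℝ → ℝ) :
        ∫ s, F s * k s = ∫ s, F s * k s ∂(leb 0 1) := by
      symm
      refine setIntegral_eq_integral_of_forall_compl_eq_zero fun s hs => ?_
      rw [image_eq_zero_of_notMem_tsupport (fun hh => hs (hF hh)), zero_mul]
    have θi : ∫ s, θ s = 0 := by
      rw [hθ, integral_sub (ηs.continuous.integrable_of_hasCompactSupport ηc)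
        ((ψs.continuous.integrable_of_hasCompactSupport ψc).const_mul c), integral_const_mul, ψi]
      simp [hc]
    -- the support of `θ` lies in some `[p, q]` inside `(0, 1)`
    obtain ⟨p, q, hp, hq, hpq⟩ : ∃ p q : ℝ, 0 < p ∧ q < 1 ∧ tsupport θ ⊆ Icc p q := by
      rcases (tsupport θ).eq_empty_or_nonempty with he | hne
      · exact ⟨1 / 2, 1 / 2, by norm_num, by norm_num, by rw [he]; exact empty_subset _⟩
      · obtain ⟨p, hp, hp'⟩ := IsCompact.exists_isLeast θc hne
        obtain ⟨q, hq, hq'⟩ := IsCompact.exists_isGreatest θc hne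
        exact ⟨p, q, (θt hp).1, (θt hq).2, fun s hs => ⟨hp' hs, hq' hs⟩⟩
    have θz {s : ℝ} (hs : s ∉ Icc p q) : θ s = 0 :=
      image_eq_zero_of_notMem_tsupport fun hh => hs (hpq hh)
    set φ : ℝ → ℝ := fun x => ∫ s in (0 : ℝ)..x, θ s with hφ
    have φd : ∀ x, HasDerivAt φ (θ x) x := fun x =>
      intervalIntegral.integral_hasDerivAt_right (θcont.intervalIntegrable _ _)
        θcont.aestronglyMeasurable.stronglyMeasurableAtFilter θcont.continuousAt
    have φd' : deriv φ = θ := funext fun x => (φd x).deriv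
    have φs : ContDiff ℝ ∞ φ := by
      rw [contDiff_infty_iff_deriv, φd']
      exact ⟨fun x => (φd x).differentiableAt, θs⟩
    have φz : ∀ x, x ∉ Icc p q → φ x = 0 := by
      intro x hx
      by_cases hxp : x < p
      · rw [hφ]
        refine intervalIntegral.integral_zero_ae (Filter.Eventually.of_forall fun s hs => θz ?_)
        intro hs'
        rcases mem_uIoc.mp hs with h | h
        · linarith [h.2, hs'.1]
        · linarith [h.2, hs'.1]
      · have hxq : q < x := by
          by_contra hc
          exact hx ⟨not_lt.mp hxp, not_lt.mp hc⟩
        by_cases hx0 : 0 ≤ x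
        · rw [hφ]
          simp only
          rw [intervalIntegral.integral_of_le hx0]
          refine Eq.trans ?_ θi
          refine setIntegral_eq_integral_of_forall_compl_eq_zero fun s hs => θz fun hs' => hs ?_
          exact ⟨hp.trans_le hs'.1, hs'.2.trans hxq.le⟩
        · exact absurd hp (by linarith [not_lt.mp hxp])
    have φt : tsupport φ ⊆ Icc p q := by
      refine closure_minimal (fun x hx => ?_) isClosed_Icc
      by_contra hn
      exact hx (φz x hn)
    have φc : HasCompactSupport φ := isCompact_Icc.of_isClosed_subset (isClosed_tsupport φ) φt
    have r1 := key φ φs φc (φt.trans fun s hs => ⟨hp.trans_le hs.1, hs.2.trans_lt hq⟩)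
    rw [φd'] at r1
    have r2 : ∫ s, θ s * h s ∂(leb 0 1) = (∫ s, η s * h s ∂(leb 0 1)) - c * K := by
      rw [hK, ← integral_const_mul, ← integral_sub (tint hhi ηs.continuous ηc)
        ((tint hhi ψs.continuous ψc).const_mul c)]
      refine integral_congr_ae (Filter.Eventually.of_forall fun s => ?_)
      simp only [hθ]
      ring
    have r3 : c = ∫ s, η s * 1 ∂(leb 0 1) := by
      rw [← suppint ηt (fun _ => 1)]
      simp [hc]
    simp only [smul_eq_mul]
    rw [suppint ηt (fun s => h s - K)]
    have r4 : ∫ s, η s * (h s - K) ∂(leb 0 1) = (∫ s, η s * h s ∂(leb 0 1)) - c * K := by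
      rw [r3, ← integral_mul_const, ← integral_sub (tint hhi ηs.continuous ηc)]
      · refine integral_congr_ae (Filter.Eventually.of_forall fun s => ?_)
        simp only
        ring
      · exact (tint (integrable_const (1 : ℝ)) ηs.continuous ηc).mul_const K
    rw [r4, ← r2, r1]
  have heq : EqOn h (fun _ => K) (Icc 0 1) := by
    refine Measure.eqOn_Icc_of_ae_eq volume zero_ne_one ?_ hhc continuousOn_const
    rw [Filter.EventuallyEq, ← restrict_Ioo_eq_restrict_Icc, ae_restrict_iff' measurableSet_Ioo]
    filter_upwards [hae] with s hs hs'
    exact sub_eq_zero.mp (hs hs')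
  have h0 : h 0 = 0 := by simp [hh, hG, rep_zero]
  have hK0 : K = 0 := by rw [← h0]; exact (heq (by simp)).symm
  have := heq hx
  simp only [hh, hK0] at this
  linarith

lemma norm_toL2_le (z : H1Zero) : ‖toL2 z‖ ≤ ‖dx z‖ := by
  have hb : ∀ᵐ x ∂(leb 0 1), ‖(toL2 z : ℝ → ℝ) x‖ ≤ ‖dx z‖ := by
    filter_upwards [toL2_ae_eq_rep z, ae_restrict_mem measurableSet_Ioo] with x hx hx'
    rw [hx, rep_eq_integral z (Ioo_subset_Icc_self hx'),
      intervalIntegral.integral_of_le hx'.1.le]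
    have hi := L2.integrable (dx z)
    calc ‖∫ s in Ioc 0 x, (dx z : ℝ → ℝ) s‖
        ≤ ∫ s in Ioc 0 x, ‖(dx z : ℝ → ℝ) s‖ := norm_integral_le_integral_norm _
      _ ≤ ∫ s, ‖(dx z : ℝ → ℝ) s‖ ∂(leb 0 1) :=
          setIntegral_mono_set hi.norm (Filter.Eventually.of_forall fun s => norm_nonneg _)
            (Filter.Eventually.of_forall fun s hs => ⟨hs.1, hs.2.trans_lt hx'.2⟩)
      _ = (eLpNorm (dx z : ℝ → ℝ) 1 (leb 0 1)).toReal := by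
          rw [integral_norm_eq_lintegral_enorm hi.1, eLpNorm_one_eq_lintegral_enorm]
      _ ≤ (eLpNorm (dx z : ℝ → ℝ) 2 (leb 0 1)).toReal := by
          have : IsProbabilityMeasure (leb 0 1) := ⟨by simp [leb]⟩
          exact ENNReal.toReal_mono (Lp.memLp (dx z)).2.ne
            (eLpNorm_le_eLpNorm_of_exponent_le (by norm_num) hi.1)
      _ = ‖dx z‖ := (Lp.norm_def _).symm
  have := Lp.norm_le_of_ae_bound (norm_nonneg (dx z)) hb
  simpa [measureUnivNNReal, leb] using this

lemma dx_injective : Function.Injective dx := by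
  rw [← LinearMap.ker_eq_bot, LinearMap.ker_eq_bot']
  intro z hz
  have h := norm_toL2_le z
  rw [hz, norm_zero, norm_le_zero_iff] at h
  exact Subtype.ext (Prod.ext h hz)

/-- The norm `‖z‖ = ‖∂ₓ z‖_{L²(Ω)}`. -/
instance : NormedAddCommGroup H1Zero := NormedAddCommGroup.induced H1Zero L2 dx dx_injective

/-- The inner product `⟨z, w⟩ = ∫ ∂ₓ z ∂ₓ w`. -/
instance : InnerProductSpace ℝ H1Zero where
  toNormedSpace := NormedSpace.induced ℝ H1Zero L2 dx
  inner z w := inner ℝ (dx z) (dx w)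
  norm_sq_eq_re_inner z := norm_sq_eq_re_inner (𝕜 := ℝ) (dx z)
  conj_inner_symm z w := inner_conj_symm (𝕜 := ℝ) (dx z) (dx w)
  add_left z w u := by rw [map_add, inner_add_left]
  smul_left z w c := by rw [map_smul, inner_smul_left]

lemma norm_eq (z : H1Zero) : ‖z‖ = ‖dx z‖ := rfl

end H1Zero

/-- `H^{-1}_{(0)}(Ω)`, the dual space of `H¹_{(0)}(Ω)`. -/
abbrev Hm1 : Type := StrongDual ℝ H1Zero

/-- The inclusion `L²(Ω) → H^{-1}_{(0)}(Ω)`, `w ↦ (z ↦ ∫ w z)`. -/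
def toHm1 (w : L2) : Hm1 :=
  LinearMap.mkContinuous
    { toFun := fun z => inner ℝ w (H1Zero.toL2 z)
      map_add' := fun z z' => by rw [map_add, inner_add_right]
      map_smul' := fun c z => by rw [map_smul, inner_smul_right]; rfl } ‖w‖
    fun z => (norm_inner_le_norm w (H1Zero.toL2 z)).trans
      (mul_le_mul_of_nonneg_left (H1Zero.norm_toL2_le z) (norm_nonneg w))

/-- The space-time cylinder `Q_T = Ω × (0, T)`, with points written `(x, t)`. -/
def cylinder (T : ℝ) : Set (ℝ × ℝ) := Ioo 0 1 ×ˢ Ioo 0 T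

/-- The norm of `A` in `L^∞(Q_T)`. -/
def supNorm (T : ℝ) (A : ℝ × ℝ → ℝ) : ℝ :=
  (eLpNorm A ∞ (volume.restrict (cylinder T))).toReal

/-- `y ∈ L²(0,T; H¹_{(0)}(Ω)) ∩ H¹(0,T; L²(Ω)) ∩ W^{2,q}(0,T; H^{-1}_{(0)}(Ω))` is a weak solution of
`∂ₜₜ y - ∂ₓₓ y + A y = B` in `Q_T`, `y(0,·) = 0`, `∂ₓ y(1,·) = v` in `(0,T)`,
`(y(·,0), ∂ₜ y(·,0)) = (u₀, u₁)` in `Ω`. Here `yt` and `ytt` are `∂ₜ y` and `∂ₜₜ y`. -/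
def IsWeakSolution (q : ℝ≥0∞) (T : ℝ) (A : ℝ × ℝ → ℝ) (B : ℝ → L2) (v : ℝ → ℝ)
    (u₀ : H1Zero) (u₁ : L2) (y : ℝ → H1Zero) : Prop :=
  ∃ (yt : ℝ → L2) (ytt : ℝ → Hm1),
    MemLp y 2 (leb 0 T) ∧ MemLp yt 2 (leb 0 T) ∧ MemLp ytt q (leb 0 T) ∧
    IsWeakDeriv 0 T (fun t => (y t).toL2) yt ∧
    IsWeakDeriv 0 T (fun t => toHm1 (yt t)) ytt ∧
    (∀ᵐ t ∂(leb 0 T), ∀ z : H1Zero,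
      ytt t z - v t * z.rep 1 + inner ℝ (y t).dx z.dx
        + ∫ x in Ioo (0 : ℝ) 1, A (x, t) * (y t).toL2 x * z.toL2 x
      = inner ℝ (B t) z.toL2) ∧
    HasValueAt 0 T (fun t => (y t).toL2) 0 u₀.toL2 ∧
    HasValueAt 0 T (fun t => toHm1 (yt t)) 0 (toHm1 u₁)

/-- The bound
`C e^{C √‖A‖_∞} (‖(u₀, u₁)‖_{H¹_{(0)} × L²} + ‖B‖_{L¹(0,t; L²)} + ‖v‖_{L²(0,t)})`. -/
def dataBound (C T : ℝ) (A : ℝ × ℝ → ℝ) (B : ℝ → L2) (v : ℝ → ℝ) (u₀ : H1Zero) (u₁ : L2)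
    (t : ℝ) : ℝ :=
  C * Real.exp (C * √(supNorm T A)) *
    (√(‖u₀‖ ^ 2 + ‖u₁‖ ^ 2) + lpNorm 1 0 t B + lpNorm 2 0 t v)

end Wave1D
end

open MeasureTheory Set
open scoped ENNReal ContDiff

noncomputable section

namespace Wave1D

/-! ### Weak derivatives and primitives of functions with values in a Banach space -/

section WeakDeriv

variable {E : Type*} [NormedAddCommGroup E] [NormedSpace ℝ E] {a b : ℝ}

/-! The solution is built from d'Alembert's formula. A single profile `h ∈ L²(ℝ)` encodes a free
wave: its slope at time `t` is `x ↦ (h(t + x) + h(t - x)) / 2` and its velocity is `x ↦ (h(t + x) -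
h(t - x)) / 2`. The condition at `x = 0` holds automatically, and time evolution is translation of
`h`. On `(-1, 1)` the profile is the even extension of `∂ₓ u₀` plus the odd extension of `u₁`. The
condition at `x = 1` reads `h(r + 1) + h(r - 1) = 2 v(r)`, a delay equation solved by the
alternating sum `bounce` of delays by `2j`; finitely many terms suffice on `(0, T)`. The weak form
of the equation for one profile is `inner_oddPart_sub`, an integration by parts in `x`.

A source `F` is treated by Duhamel's principle: at time `s` it releases the profile of a wave with
zero displacement and velocity `F(s)`. The sum of the initial profile and of all profiles released
before `t` is `history`, and `apply_history_eq` carries the identities for single profiles over to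
it. The potential is put on the right-hand side: `F = B - A y`, where `y` is the displacement
generated by `F`. This is a Volterra equation, solved by contraction in an exponentially weighted
norm (`exists_source_fixed_point`).

All bounds go through the norm of `history` on `(-∞, t + 1)`, which dominates the slope and the
velocity at time `t` and sees only the data before `t`. The potential enters only through
`‖y‖_{L²}`, which is one time integral of the velocity. Hence `‖y‖_{L²}` is bounded by data plus a
multiple of `‖A‖` times its own double time integral, and `le_exp_of_le_double_integral` gives
growth at a rate of order `√‖A‖` (`norm_past_history_le_exp`). The trace at `1` has derivative `(h(r
+ 1) - h(r - 1)) / 2 = v(r) - h(r - 1)`, hence the hidden regularity of `y(1, ·)` and its bound.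

Uniqueness is an energy argument on the equation integrated once in time
(`ae_eq_zero_of_integrated_equation`). After this integration the difference of two solutions is
itself an admissible test function, while its time derivative, only `L²` in space, would not be one
for the original equation. -/

lemma integral_interval_eq_leb (hab : a ≤ b) (F : ℝ → E) :
    ∫ s in a..b, F s = ∫ s, F s ∂(leb a b) := by
  rw [intervalIntegral.integral_of_le hab, integral_Ioc_eq_integral_Ioo]

lemma intervalIntegrable_of_leb {E : Type*} [NormedAddCommGroup E] {g : ℝ → E} (hg : Integrable g (leb a b)) {c d : ℝ}
    (hac : a ≤ c) (hcd : c ≤ d) (hdb : d ≤ b) : IntervalIntegrable g volume c d := by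
  rw [intervalIntegrable_iff_integrableOn_Ioo_of_le hcd]
  exact IntegrableOn.mono_set hg (Ioo_subset_Ioo hac hdb)

lemma continuousOn_primitive {g : ℝ → E} (hab : a ≤ b) (hg : Integrable g (leb a b)) :
    ContinuousOn (fun t => ∫ s in a..t, g s) (Icc a b) := by
  have := intervalIntegral.continuousOn_primitive_interval'
    (intervalIntegrable_of_leb hg le_rfl hab le_rfl) left_mem_uIcc
  rwa [uIcc_of_le hab] at this

lemma integrable_test_smul {F : ℝ → E} {φ : ℝ → ℝ} (hF : Integrable F (leb a b))
    (hφ : Continuous φ) (hc : HasCompactSupport φ) :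
    Integrable (fun s => φ s • F s) (leb a b) := by
  obtain ⟨C, hC⟩ := hc.exists_bound_of_continuous hφ
  exact hF.bdd_smul C hφ.aestronglyMeasurable (Filter.Eventually.of_forall hC)

lemma integrable_of_continuousOn {E : Type*} [NormedAddCommGroup E] {F : ℝ → E} (hF : ContinuousOn F (Icc a b)) :
    Integrable F (leb a b) :=
  (hF.integrableOn_compact isCompact_Icc).mono_set Ioo_subset_Icc_self

lemma IsWeakDeriv.congr {f f' g g' : ℝ → E} (h : IsWeakDeriv a b f g)
    (hf : f =ᵐ[leb a b] f') (hg : g =ᵐ[leb a b] g') : IsWeakDeriv a b f' g' := by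
  intro φ h1 h2 h3
  have e := h φ h1 h2 h3
  rw [integral_congr_ae (hf.mono fun s hs => by simp only [hs] :
      (fun s => deriv φ s • f s) =ᵐ[leb a b] fun s => deriv φ s • f' s),
    integral_congr_ae (hg.mono fun s hs => by simp only [hs] :
      (fun s => φ s • g s) =ᵐ[leb a b] fun s => φ s • g' s)] at e
  exact e

/-- Integration by parts for absolutely continuous functions; the boundary terms vanish because the
support of `φ` lies in the open interval. -/
lemma integral_deriv_mul_primitive (hab : a ≤ b) {g : ℝ → ℝ} (hg : Integrable g (leb a b))
    {φ : ℝ → ℝ} (h1 : ContDiff ℝ ∞ φ) (h3 : tsupport φ ⊆ Ioo a b) :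
    ∫ s, deriv φ s * (∫ r in a..s, g r) ∂(leb a b) = -∫ s, φ s * g s ∂(leb a b) := by
  have hgi := intervalIntegrable_of_leb hg le_rfl hab le_rfl
  have φa : φ a = 0 := by
    by_contra hne
    exact absurd (h3 (subset_tsupport φ hne)).1 (lt_irrefl _)
  have φb : φ b = 0 := by
    by_contra hne
    exact absurd (h3 (subset_tsupport φ hne)).2 (lt_irrefl _)
  have hGac : AbsolutelyContinuousOnInterval (fun x => ∫ s in a..x, g s) a b :=
    hgi.absolutelyContinuousOnInterval_intervalIntegral (by simp)
  have hφac : AbsolutelyContinuousOnInterval φ a b :=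
    (h1.of_le (by simp)).contDiffOn.absolutelyContinuousOnInterval
  have ibp := hφac.integral_mul_deriv_eq_deriv_mul hGac
  rw [φa, φb] at ibp
  have e : ∫ s in a..b, φ s * deriv (fun x => ∫ s in a..x, g s) s = ∫ s in a..b, φ s * g s := by
    refine intervalIntegral.integral_congr_ae ?_
    filter_upwards [hgi.ae_hasDerivAt_integral] with s hs hs'
    rw [(hs (uIoc_subset_uIcc hs') a (by simp)).deriv]
  rw [e] at ibp
  rw [← integral_interval_eq_leb hab, ← integral_interval_eq_leb hab]
  linarith

/-- Continuous functionals separate points and commute with both integrals, so the scalar case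
suffices. -/
lemma integral_deriv_smul_primitive [CompleteSpace E] (hab : a ≤ b) {g : ℝ → E}
    (hg : Integrable g (leb a b)) {φ : ℝ → ℝ} (h1 : ContDiff ℝ ∞ φ) (h2 : HasCompactSupport φ)
    (h3 : tsupport φ ⊆ Ioo a b) :
    ∫ s, deriv φ s • (∫ r in a..s, g r) ∂(leb a b) = -∫ s, φ s • g s ∂(leb a b) := by
  refine (SeparatingDual.eq_iff_forall_dual_eq (R := ℝ)).2 fun ℓ => ?_
  have hd : Continuous (deriv φ) := h1.continuous_deriv (by simp)
  rw [map_neg, ← ContinuousLinearMap.integral_comp_comm _ (integrable_test_smul hg h1.continuous h2),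
    ← ContinuousLinearMap.integral_comp_comm _
      (integrable_test_smul (integrable_of_continuousOn (continuousOn_primitive hab hg)) hd h2.deriv)]
  simp only [map_smul, smul_eq_mul]
  rw [← integral_deriv_mul_primitive hab (ℓ.integrable_comp hg) h1 h3]
  refine integral_congr_ae ?_
  filter_upwards [ae_restrict_mem measurableSet_Ioo] with s hs
  rw [← ContinuousLinearMap.intervalIntegral_comp_comm _
    (intervalIntegrable_of_leb hg le_rfl hs.1.le hs.2.le)]

/-- A primitive of an integrable function has that function as its weak derivative. -/
lemma isWeakDeriv_primitive [CompleteSpace E] (hab : a ≤ b) {g : ℝ → E}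
    (hg : Integrable g (leb a b)) (c : E) :
    IsWeakDeriv a b (fun t => c + ∫ s in a..t, g s) g := by
  intro φ h1 h2 h3
  have hd : Continuous (deriv φ) := h1.continuous_deriv (by simp)
  have hconst : ∫ s, deriv φ s • c ∂(leb a b) = 0 := by
    rw [integral_smul_const, ← integral_interval_eq_leb hab,
      intervalIntegral.integral_deriv_eq_sub (fun x _ => h1.differentiable (by simp) x)
        (hd.intervalIntegrable _ _)]
    have φa : φ a = 0 := by
      by_contra hne
      exact absurd (h3 (subset_tsupport φ hne)).1 (lt_irrefl _)
    have φb : φ b = 0 := by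
      by_contra hne
      exact absurd (h3 (subset_tsupport φ hne)).2 (lt_irrefl _)
    simp [φa, φb]
  simp only [smul_add]
  rw [integral_add (integrable_test_smul (integrable_const c) hd h2.deriv)
    (integrable_test_smul (integrable_of_continuousOn (continuousOn_primitive hab hg)) hd h2.deriv),
    hconst, zero_add, integral_deriv_smul_primitive hab hg h1 h2 h3]

/-- A test function of integral zero is the derivative of a test function. -/
lemma exists_primitive_test {θ : ℝ → ℝ} (hab : a < b) (θs : ContDiff ℝ ∞ θ)
    (θc : HasCompactSupport θ) (θt : tsupport θ ⊆ Ioo a b) (θi : ∫ s, θ s = 0) :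
    ∃ φ : ℝ → ℝ, ContDiff ℝ ∞ φ ∧ HasCompactSupport φ ∧ tsupport φ ⊆ Ioo a b ∧ deriv φ = θ := by
  have θcont : Continuous θ := θs.continuous
  obtain ⟨p, q, hp, hq, hpq⟩ : ∃ p q : ℝ, a < p ∧ q < b ∧ tsupport θ ⊆ Icc p q := by
    rcases (tsupport θ).eq_empty_or_nonempty with he | hne
    · exact ⟨(a + b) / 2, (a + b) / 2, by linarith, by linarith, by rw [he]; exact empty_subset _⟩
    · obtain ⟨p, hp, hp'⟩ := IsCompact.exists_isLeast θc hne
      obtain ⟨q, hq, hq'⟩ := IsCompact.exists_isGreatest θc hne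
      exact ⟨p, q, (θt hp).1, (θt hq).2, fun s hs => ⟨hp' hs, hq' hs⟩⟩
  have θz {s : ℝ} (hs : s ∉ Icc p q) : θ s = 0 :=
    image_eq_zero_of_notMem_tsupport fun hh => hs (hpq hh)
  set φ : ℝ → ℝ := fun x => ∫ s in a..x, θ s with hφ
  have φd : ∀ x, HasDerivAt φ (θ x) x := fun x =>
    intervalIntegral.integral_hasDerivAt_right (θcont.intervalIntegrable _ _)
      θcont.aestronglyMeasurable.stronglyMeasurableAtFilter θcont.continuousAt
  have φderiv : deriv φ = θ := funext fun x => (φd x).deriv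
  have φs : ContDiff ℝ ∞ φ := by
    rw [contDiff_infty_iff_deriv, φderiv]
    exact ⟨fun x => (φd x).differentiableAt, θs⟩
  have φz : ∀ x, x ∉ Icc p q → φ x = 0 := by
    intro x hx
    by_cases hxp : x < p
    · rw [hφ]
      refine intervalIntegral.integral_zero_ae (Filter.Eventually.of_forall fun s hs => θz ?_)
      intro hs'
      rcases mem_uIoc.mp hs with h | h
      · linarith [h.2, hs'.1]
      · linarith [h.2, hs'.1]
    · have hxq : q < x := by
        by_contra hc
        exact hx ⟨not_lt.mp hxp, not_lt.mp hc⟩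
      have hx0 : a ≤ x := hp.le.trans (not_lt.mp hxp)
      rw [hφ]
      simp only
      rw [intervalIntegral.integral_of_le hx0]
      refine Eq.trans ?_ θi
      refine setIntegral_eq_integral_of_forall_compl_eq_zero fun s hs => θz fun hs' => hs ?_
      exact ⟨hp.trans_le hs'.1, hs'.2.trans hxq.le⟩
  have φt : tsupport φ ⊆ Icc p q := by
    refine closure_minimal (fun x hx => ?_) isClosed_Icc
    by_contra hn
    exact hx (φz x hn)
  exact ⟨φ, φs, isCompact_Icc.of_isClosed_subset (isClosed_tsupport φ) φt,
    φt.trans fun s hs => ⟨hp.trans_le hs.1, hs.2.trans_lt hq⟩, φderiv⟩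

/-- An integrable function with vanishing weak derivative is almost everywhere constant. -/
lemma ae_eq_const_of_integral_deriv_smul [CompleteSpace E] (hab : a < b) {h : ℝ → E}
    (hhi : Integrable h (leb a b))
    (key : ∀ φ : ℝ → ℝ, ContDiff ℝ ∞ φ → HasCompactSupport φ → tsupport φ ⊆ Ioo a b →
      ∫ s, deriv φ s • h s ∂(leb a b) = 0) : ∃ K : E, h =ᵐ[leb a b] fun _ => K := by
  -- The du Bois-Reymond argument: `ψ` has integral one and `K` is the `ψ`-average of `h`. For a
  -- test function `η`, the function `η - (∫ η) ψ` has integral zero, hence is the derivative of a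
  -- test function, and `∫ η (h - K) = 0`.
  let ψb : ContDiffBump ((a + b) / 2 : ℝ) := ⟨(b - a) / 8, (b - a) / 4, by linarith, by linarith⟩
  set ψ : ℝ → ℝ := ψb.normed volume with hψ
  have ψs : ContDiff ℝ ∞ ψ := ψb.contDiff_normed
  have ψc : HasCompactSupport ψ := ψb.hasCompactSupport_normed
  have ψt : tsupport ψ ⊆ Ioo a b := by
    rw [hψ, ψb.tsupport_normed_eq, Real.closedBall_eq_Icc]
    intro s hs
    have h1 : (a + b) / 2 - (b - a) / 4 ≤ s := hs.1
    have h2 : s ≤ (a + b) / 2 + (b - a) / 4 := hs.2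
    constructor <;> linarith
  have ψi : ∫ s, ψ s = 1 := ψb.integral_normed
  refine ⟨∫ s, ψ s • h s ∂(leb a b), ?_⟩
  set K : E := ∫ s, ψ s • h s ∂(leb a b) with hK
  have hae : ∀ᵐ s, s ∈ Ioo a b → h s - K = 0 := by
    refine isOpen_Ioo.ae_eq_zero_of_integral_contDiff_smul_eq_zero ?_ ?_
    · exact IntegrableOn.locallyIntegrableOn (hhi.sub (integrable_const K))
    intro η ηs ηc ηt
    set c : ℝ := ∫ s, η s with hc
    set θ : ℝ → ℝ := fun s => η s - c * ψ s with hθ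
    have θs : ContDiff ℝ ∞ θ := ηs.sub (contDiff_const.mul ψs)
    have θc : HasCompactSupport θ := ηc.sub (ψc.mul_left)
    have θt : tsupport θ ⊆ Ioo a b := by
      refine (tsupport_sub η (fun s => c * ψ s)).trans (union_subset ηt ?_)
      exact (tsupport_mul_subset_right (f := fun _ => c) (g := ψ)).trans ψt
    have suppint (k : ℝ → E) : ∫ s, η s • k s = ∫ s, η s • k s ∂(leb a b) := by
      symm
      refine setIntegral_eq_integral_of_forall_compl_eq_zero fun s hs => ?_
      rw [image_eq_zero_of_notMem_tsupport (fun hh => hs (ηt hh)), zero_smul]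
    have θi : ∫ s, θ s = 0 := by
      rw [hθ, integral_sub (ηs.continuous.integrable_of_hasCompactSupport ηc)
        ((ψs.continuous.integrable_of_hasCompactSupport ψc).const_mul c), integral_const_mul, ψi]
      simp [hc]
    obtain ⟨φ, φs, φc, φt, φd⟩ := exists_primitive_test hab θs θc θt θi
    have r1 := key φ φs φc φt
    rw [φd] at r1
    have r2 : ∫ s, θ s • h s ∂(leb a b) = (∫ s, η s • h s ∂(leb a b)) - c • K := by
      rw [hK, ← integral_smul]
      refine Eq.trans ?_ (integral_sub (integrable_test_smul hhi ηs.continuous ηc)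
        ((integrable_test_smul hhi ψs.continuous ψc).smul c))
      refine integral_congr_ae (Filter.Eventually.of_forall fun s => ?_)
      simp only [hθ, sub_smul, mul_smul]
    simp only [smul_sub]
    rw [integral_sub, integral_smul_const, ← hc, suppint, ← r2, r1]
    · rw [← integrableOn_iff_integrable_of_support_subset (s := Ioo a b)]
      · exact integrable_test_smul hhi ηs.continuous ηc
      · intro s hs
        by_contra hn
        exact hs (by simp only [image_eq_zero_of_notMem_tsupport (fun hh => hn (ηt hh)), zero_smul])
    · exact (ηs.continuous.integrable_of_hasCompactSupport ηc).smul_const K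
  rw [Filter.EventuallyEq, ae_restrict_iff' measurableSet_Ioo]
  filter_upwards [hae] with s hs hmem
  exact sub_eq_zero.mp (hs hmem)

/-- A function with an integrable weak derivative and initial value `e` is almost everywhere equal to
the primitive of its weak derivative that starts at `e`. -/
lemma IsWeakDeriv.ae_eq_primitive [CompleteSpace E] (hab : a < b) {f g : ℝ → E}
    (hf : Integrable f (leb a b)) (hg : Integrable g (leb a b)) (hfg : IsWeakDeriv a b f g)
    {e : E} (he : HasValueAt a b f a e) :
    f =ᵐ[leb a b] fun t => e + ∫ s in a..t, g s := by
  have hGi := integrable_of_continuousOn (continuousOn_primitive hab.le hg)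
  obtain ⟨K, hK⟩ := ae_eq_const_of_integral_deriv_smul hab (hf.sub hGi) (by
    intro φ h1 h2 h3
    have hd : Continuous (deriv φ) := h1.continuous_deriv (by simp)
    simp only [Pi.sub_apply, smul_sub]
    rw [integral_sub (integrable_test_smul hf hd h2.deriv) (integrable_test_smul hGi hd h2.deriv),
      hfg φ h1 h2 h3, integral_deriv_smul_primitive hab.le hg h1 h2 h3, sub_self])
  have hfK : f =ᵐ[leb a b] fun t => K + ∫ s in a..t, g s := by
    filter_upwards [hK] with s hs
    rw [← hs]
    simp
  obtain ⟨r, hr, hfr, hre⟩ := he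
  -- Two continuous functions that agree almost everywhere agree on all of `[a, b]`; the value at
  -- `a` then identifies `K`.
  have heq : EqOn r (fun t => K + ∫ s in a..t, g s) (Icc a b) := by
    refine Measure.eqOn_Icc_of_ae_eq volume hab.ne ?_ hr
      (continuousOn_const.add (continuousOn_primitive hab.le hg))
    rw [← restrict_Ioo_eq_restrict_Icc]
    exact hfr.symm.trans hfK
  have hKe : K = e := by
    rw [← hre, heq (left_mem_Icc.2 hab.le)]
    simp
  rwa [hKe] at hfK

end WeakDeriv

/-! ### The Hilbert space of displacements, identified with `L²(Ω)` through the slope -/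

instance : IsProbabilityMeasure (leb 0 1) := ⟨by simp [leb]⟩

lemma inner_L2 (f g : L2) : inner ℝ f g = ∫ x, (f : ℝ → ℝ) x * (g : ℝ → ℝ) x ∂(leb 0 1) := by
  rw [L2.inner_def]
  refine integral_congr_ae (Filter.Eventually.of_forall fun x => ?_)
  simp [mul_comm]

namespace H1Zero

/-- The primitive vanishing at `0` is a preimage. A displacement can therefore be prescribed by its
slope alone, and completeness is inherited from `L²(Ω)`. -/
lemma dx_surjective : Function.Surjective dx := by
  intro g
  have hg : Integrable (g : ℝ → ℝ) (leb 0 1) := L2.integrable g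
  have hc := continuousOn_primitive zero_le_one hg
  obtain ⟨M, hM⟩ := isCompact_Icc.exists_bound_of_continuousOn hc
  have hm : MemLp (fun x => ∫ s in (0 : ℝ)..x, (g : ℝ → ℝ) s) 2 (leb 0 1) := by
    refine MemLp.of_bound (hc.mono Ioo_subset_Icc_self |>.aestronglyMeasurable measurableSet_Ioo) M ?_
    filter_upwards [ae_restrict_mem measurableSet_Ioo] with x hx
    exact hM x (Ioo_subset_Icc_self hx)
  refine ⟨(⟨(hm.toLp _, g), ?_, _, hc, hm.coeFn_toLp, by simp⟩ : h1ZeroGraph), rfl⟩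
  refine (isWeakDeriv_primitive zero_le_one hg 0).congr ?_ (Filter.EventuallyEq.refl _ _)
  filter_upwards [hm.coeFn_toLp] with x hx
  rw [hx, zero_add]

/-- The isometry `∂ₓ : H¹_{(0)}(Ω) → L²(Ω)`. -/
def dxEquiv : H1Zero ≃ₗᵢ[ℝ] L2 where
  toLinearEquiv := LinearEquiv.ofBijective dx ⟨dx_injective, dx_surjective⟩
  norm_map' _ := rfl

@[simp] lemma dx_dxEquiv_symm (g : L2) : dx (dxEquiv.symm g) = g := dxEquiv.apply_symm_apply g

instance : CompleteSpace H1Zero :=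
  (completeSpace_congr (e := dxEquiv.toEquiv) dxEquiv.isometry.isUniformEmbedding).2 inferInstance

/-- The inclusion `H¹_{(0)}(Ω) → L²(Ω)` as a continuous linear map. -/
def toL2L : H1Zero →L[ℝ] L2 :=
  LinearMap.mkContinuous toL2 1 fun z => by rw [one_mul]; exact norm_toL2_le z

@[simp] lemma toL2L_apply (z : H1Zero) : toL2L z = toL2 z := rfl

lemma inner_eq (y z : H1Zero) : inner ℝ y z = inner ℝ (dx y) (dx z) := rfl

lemma rep_one_eq (z : H1Zero) : z.rep 1 = ∫ s, (dx z : ℝ → ℝ) s ∂(leb 0 1) := by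
  rw [rep_eq_integral z (by simp), integral_interval_eq_leb zero_le_one]

/-- The evaluation `z ↦ z(1)`. -/
def evalOne : Hm1 :=
  LinearMap.mkContinuous
    { toFun := fun z => z.rep 1
      map_add' := fun z w => by
        rw [rep_one_eq, rep_one_eq, rep_one_eq,
          ← integral_add (L2.integrable _) (L2.integrable _), map_add]
        exact integral_congr_ae (Lp.coeFn_add _ _)
      map_smul' := fun c z => by
        rw [rep_one_eq, rep_one_eq, map_smul, RingHom.id_apply, smul_eq_mul, ← integral_const_mul]
        exact integral_congr_ae (Lp.coeFn_smul _ _) } 1 fun z => by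
    change ‖z.rep 1‖ ≤ 1 * ‖z‖
    rw [rep_one_eq, norm_eq, one_mul]
    calc ‖∫ s, (dx z : ℝ → ℝ) s ∂(leb 0 1)‖
        ≤ ∫ s, ‖(dx z : ℝ → ℝ) s‖ ∂(leb 0 1) := norm_integral_le_integral_norm _
      _ = (eLpNorm (dx z : ℝ → ℝ) 1 (leb 0 1)).toReal := by
          rw [integral_norm_eq_lintegral_enorm (L2.integrable _).1, eLpNorm_one_eq_lintegral_enorm]
      _ ≤ (eLpNorm (dx z : ℝ → ℝ) 2 (leb 0 1)).toReal :=
          ENNReal.toReal_mono (Lp.memLp (dx z)).2.ne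
            (eLpNorm_le_eLpNorm_of_exponent_le (by norm_num) (L2.integrable _).1)
      _ = ‖dx z‖ := (Lp.norm_def _).symm

@[simp] lemma evalOne_apply (z : H1Zero) : evalOne z = z.rep 1 := rfl

end H1Zero

@[simp] lemma toHm1_apply (w : L2) (z : H1Zero) : toHm1 w z = inner ℝ w z.toL2 := rfl

/-! ### Profiles on the line: translation, reflection, parity -/

/-- `L²(ℝ)`. -/
abbrev LineL2 : Type := Lp ℝ 2 (volume : Measure ℝ)

namespace LineL2

lemma intervalIntegrable (h : LineL2) (a b : ℝ) :
    IntervalIntegrable (h : ℝ → ℝ) volume a b := by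
  rw [intervalIntegrable_iff]
  exact (((Lp.memLp h).locallyIntegrable (by norm_num)).integrableOn_isCompact
    (isCompact_uIcc (a := a) (b := b))).mono_set uIoc_subset_uIcc

/-- The translation `h ↦ h(· + t)`. -/
def shift (t : ℝ) : LineL2 →ₗᵢ[ℝ] LineL2 :=
  Lp.compMeasurePreservingₗᵢ ℝ (fun x => x + t) (measurePreserving_add_right volume t)

/-- The reflection `h ↦ h(-·)`. -/
def reflect : LineL2 →ₗᵢ[ℝ] LineL2 :=
  Lp.compMeasurePreservingₗᵢ ℝ Neg.neg (Measure.measurePreserving_neg volume)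

lemma shift_ae (t : ℝ) (h : LineL2) : shift t h =ᵐ[volume] fun x => (h : ℝ → ℝ) (x + t) :=
  Lp.coeFn_compMeasurePreserving h (measurePreserving_add_right volume t)

lemma reflect_ae (h : LineL2) : reflect h =ᵐ[volume] fun x => (h : ℝ → ℝ) (-x) :=
  Lp.coeFn_compMeasurePreserving h (Measure.measurePreserving_neg volume)

lemma ae_comp_add {p : ℝ → Prop} (hp : ∀ᵐ x, p x) (t : ℝ) : ∀ᵐ x, p (x + t) :=
  (measurePreserving_add_right volume t).quasiMeasurePreserving.ae hp

lemma ae_comp_neg {p : ℝ → Prop} (hp : ∀ᵐ x, p x) : ∀ᵐ x, p (-x) :=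
  (Measure.measurePreserving_neg (volume : Measure ℝ)).quasiMeasurePreserving.ae hp

lemma shift_shift (s t : ℝ) (h : LineL2) : shift s (shift t h) = shift (s + t) h := by
  refine Lp.ext ?_
  filter_upwards [shift_ae s (shift t h), shift_ae (s + t) h, ae_comp_add (shift_ae t h) s]
    with x h1 h2 h3
  rw [h1, h2, h3, add_assoc]

@[simp] lemma shift_zero (h : LineL2) : shift 0 h = h := by
  refine Lp.ext ?_
  filter_upwards [shift_ae 0 h] with x h1
  rw [h1, add_zero]

@[simp] lemma reflect_reflect (h : LineL2) : reflect (reflect h) = h := by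
  refine Lp.ext ?_
  filter_upwards [reflect_ae (reflect h), ae_comp_neg (reflect_ae h)] with x h1 h2
  rw [h1, h2, neg_neg]

/-- Translation depends on `t` continuously only in the strong sense, not in operator norm; joint
continuity in `(t, h)` is what measurability of the Duhamel integrand and continuity of the solution
in time require. -/
lemma continuous_shift : Continuous fun p : ℝ × LineL2 => shift p.1 p.2 := by
  let g : ℝ × LineL2 → C(ℝ, ℝ) := fun p => ⟨fun x => x + p.1, by fun_prop⟩
  have hg : Continuous g := by
    refine ContinuousMap.continuous_of_continuous_uncurry _ ?_
    change Continuous fun q : (ℝ × LineL2) × ℝ => q.2 + q.1.1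
    fun_prop
  exact continuous_snd.compMeasurePreservingLp hg
    (fun p => measurePreserving_add_right volume p.1) (by norm_num)

/-- Restriction to `Ω`. -/
def restr : LineL2 →L[ℝ] L2 := LpToLpRestrictCLM ℝ ℝ ℝ volume 2 (Ioo 0 1)

lemma restr_ae (h : LineL2) : restr h =ᵐ[leb 0 1] h := LpToLpRestrictCLM_coeFn ℝ (Ioo 0 1) h

/-- Extension by zero, as a function. -/
def zeroExtendFun (a b : ℝ) (f : Lp ℝ 2 (leb a b)) : LineL2 :=
  ((memLp_indicator_iff_restrict measurableSet_Ioo).2 (Lp.memLp f)).toLp ((Ioo a b).indicator f)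

lemma zeroExtendFun_ae {a b : ℝ} (f : Lp ℝ 2 (leb a b)) :
    zeroExtendFun a b f =ᵐ[volume] (Ioo a b).indicator f := MemLp.coeFn_toLp _

/-- Extension by zero. -/
def zeroExtend (a b : ℝ) : Lp ℝ 2 (leb a b) →ₗᵢ[ℝ] LineL2 where
  toFun := zeroExtendFun a b
  map_add' f g := by
    have e := Lp.coeFn_add f g
    rw [Filter.EventuallyEq, ae_restrict_iff' measurableSet_Ioo] at e
    refine Lp.ext ?_
    filter_upwards [e, zeroExtendFun_ae f, zeroExtendFun_ae g, zeroExtendFun_ae (f + g),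
      Lp.coeFn_add (zeroExtendFun a b f) (zeroExtendFun a b g)] with x hx h1 h2 h3 h4
    rw [h3, h4, Pi.add_apply, h1, h2]
    by_cases hm : x ∈ Ioo a b
    · rw [indicator_of_mem hm, indicator_of_mem hm, indicator_of_mem hm, hx hm, Pi.add_apply]
    · rw [indicator_of_notMem hm, indicator_of_notMem hm, indicator_of_notMem hm, add_zero]
  map_smul' c f := by
    have e := Lp.coeFn_smul c f
    rw [Filter.EventuallyEq, ae_restrict_iff' measurableSet_Ioo] at e
    refine Lp.ext ?_
    filter_upwards [e, zeroExtendFun_ae f, zeroExtendFun_ae (c • f),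
      Lp.coeFn_smul c (zeroExtendFun a b f)] with x hx h1 h3 h4
    rw [h3, RingHom.id_apply, h4, Pi.smul_apply, h1]
    by_cases hm : x ∈ Ioo a b
    · rw [indicator_of_mem hm, indicator_of_mem hm, hx hm, Pi.smul_apply]
    · rw [indicator_of_notMem hm, indicator_of_notMem hm, smul_zero]
  norm_map' f := by
    change ‖zeroExtendFun a b f‖ = _
    rw [zeroExtendFun, Lp.norm_toLp, eLpNorm_indicator_eq_eLpNorm_restrict measurableSet_Ioo,
      Lp.norm_def]

lemma zeroExtend_ae {a b : ℝ} (f : Lp ℝ 2 (leb a b)) :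
    zeroExtend a b f =ᵐ[volume] (Ioo a b).indicator f := zeroExtendFun_ae f

lemma restr_zeroExtend (f : L2) : restr (zeroExtend 0 1 f) = f := by
  refine Lp.ext ((restr_ae _).trans ?_)
  filter_upwards [ae_restrict_of_ae (zeroExtend_ae f), ae_restrict_mem measurableSet_Ioo] with x h1 h2
  rw [h1, indicator_of_mem h2]

lemma restr_reflect_zeroExtend (f : L2) : restr (reflect (zeroExtend 0 1 f)) = 0 := by
  refine Lp.ext ((restr_ae _).trans (Filter.EventuallyEq.trans ?_ (Lp.coeFn_zero _ _ _).symm))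
  filter_upwards [ae_restrict_of_ae (ae_comp_neg (zeroExtend_ae f)),
    ae_restrict_of_ae (reflect_ae (zeroExtend 0 1 f)), ae_restrict_mem measurableSet_Ioo] with x h1 h2 h3
  rw [h2, h1, indicator_of_notMem, Pi.zero_apply]
  intro h
  linarith [h.1, h3.1]

/-- The even part on `Ω`: `x ↦ (h(x) + h(-x)) / 2`. -/
def evenPart : LineL2 →L[ℝ] L2 :=
  (1 / 2 : ℝ) • (restr ∘L (ContinuousLinearMap.id ℝ LineL2 + reflect.toContinuousLinearMap))

/-- The odd part on `Ω`: `x ↦ (h(x) - h(-x)) / 2`. -/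
def oddPart : LineL2 →L[ℝ] L2 :=
  (1 / 2 : ℝ) • (restr ∘L (ContinuousLinearMap.id ℝ LineL2 - reflect.toContinuousLinearMap))

lemma evenPart_apply (h : LineL2) : evenPart h = (1 / 2 : ℝ) • (restr h + restr (reflect h)) := by
  simp [evenPart]

lemma oddPart_apply (h : LineL2) : oddPart h = (1 / 2 : ℝ) • (restr h - restr (reflect h)) := by
  simp [oddPart]

lemma evenPart_shift_ae (t : ℝ) (h : LineL2) : evenPart (shift t h) =ᵐ[leb 0 1]
    fun x => ((h : ℝ → ℝ) (x + t) + (h : ℝ → ℝ) (-x + t)) / 2 := by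
  rw [evenPart_apply]
  filter_upwards [Lp.coeFn_smul (1 / 2 : ℝ) (restr (shift t h) + restr (reflect (shift t h))),
    Lp.coeFn_add (restr (shift t h)) (restr (reflect (shift t h))), restr_ae (shift t h),
    restr_ae (reflect (shift t h)), ae_restrict_of_ae (shift_ae t h),
    ae_restrict_of_ae (reflect_ae (shift t h)), ae_restrict_of_ae (ae_comp_neg (shift_ae t h))]
    with x h1 h2 h3 h4 h5 h6 h7
  rw [h1, Pi.smul_apply, h2, Pi.add_apply, h3, h4, h5, h6, h7, smul_eq_mul]
  ring

lemma oddPart_shift_ae (t : ℝ) (h : LineL2) : oddPart (shift t h) =ᵐ[leb 0 1]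
    fun x => ((h : ℝ → ℝ) (x + t) - (h : ℝ → ℝ) (-x + t)) / 2 := by
  rw [oddPart_apply]
  filter_upwards [Lp.coeFn_smul (1 / 2 : ℝ) (restr (shift t h) - restr (reflect (shift t h))),
    Lp.coeFn_sub (restr (shift t h)) (restr (reflect (shift t h))), restr_ae (shift t h),
    restr_ae (reflect (shift t h)), ae_restrict_of_ae (shift_ae t h),
    ae_restrict_of_ae (reflect_ae (shift t h)), ae_restrict_of_ae (ae_comp_neg (shift_ae t h))]
    with x h1 h2 h3 h4 h5 h6 h7
  rw [h1, Pi.smul_apply, h2, Pi.sub_apply, h3, h4, h5, h6, h7, smul_eq_mul]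
  ring

/-- The odd extension of a function on `Ω`. -/
def oddExt : L2 →L[ℝ] LineL2 :=
  (ContinuousLinearMap.id ℝ LineL2 - reflect.toContinuousLinearMap) ∘L
    (zeroExtend 0 1).toContinuousLinearMap

/-- The even extension of a function on `Ω`. -/
def evenExt : L2 →L[ℝ] LineL2 :=
  (ContinuousLinearMap.id ℝ LineL2 + reflect.toContinuousLinearMap) ∘L
    (zeroExtend 0 1).toContinuousLinearMap

lemma oddExt_apply (g : L2) : oddExt g = zeroExtend 0 1 g - reflect (zeroExtend 0 1 g) := rfl

lemma evenExt_apply (g : L2) : evenExt g = zeroExtend 0 1 g + reflect (zeroExtend 0 1 g) := rfl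

-- Together with `evenPart_oddExt`: the odd extension of `g` is the profile of a wave with zero
-- displacement and velocity `g`.
@[simp] lemma oddPart_oddExt (g : L2) : oddPart (oddExt g) = g := by
  rw [oddPart_apply, oddExt_apply]
  simp only [map_sub, reflect_reflect, restr_zeroExtend, restr_reflect_zeroExtend]
  rw [sub_zero, zero_sub, sub_neg_eq_add, ← two_smul ℝ g, smul_smul]
  norm_num

@[simp] lemma evenPart_oddExt (g : L2) : evenPart (oddExt g) = 0 := by
  rw [evenPart_apply, oddExt_apply]
  simp only [map_sub, reflect_reflect, restr_zeroExtend, restr_reflect_zeroExtend]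
  simp

-- Together with `oddPart_evenExt`: the even extension of `g` is the profile of a wave with slope
-- `g` and zero velocity.
@[simp] lemma evenPart_evenExt (g : L2) : evenPart (evenExt g) = g := by
  rw [evenPart_apply, evenExt_apply]
  simp only [map_add, reflect_reflect, restr_zeroExtend, restr_reflect_zeroExtend]
  rw [add_zero, zero_add, ← two_smul ℝ g, smul_smul]
  norm_num

@[simp] lemma oddPart_evenExt (g : L2) : oddPart (evenExt g) = 0 := by
  rw [oddPart_apply, evenExt_apply]
  simp only [map_add, reflect_reflect, restr_zeroExtend, restr_reflect_zeroExtend]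
  simp

lemma norm_oddExt_le (g : L2) : ‖oddExt g‖ ≤ 2 * ‖g‖ := by
  rw [oddExt_apply]
  refine (norm_sub_le _ _).trans ?_
  simp only [LinearIsometry.norm_map]
  linarith

lemma norm_evenExt_le (g : L2) : ‖evenExt g‖ ≤ 2 * ‖g‖ := by
  rw [evenExt_apply]
  refine (norm_add_le _ _).trans ?_
  simp only [LinearIsometry.norm_map]
  linarith

lemma zeroExtend_ae_eq_zero (g : L2) :
    ∀ᵐ x, x ∉ Ioo (-1 : ℝ) 1 → (zeroExtend 0 1 g : ℝ → ℝ) x = 0 ∧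
      (reflect (zeroExtend 0 1 g) : ℝ → ℝ) x = 0 := by
  filter_upwards [zeroExtend_ae g, reflect_ae (zeroExtend 0 1 g), ae_comp_neg (zeroExtend_ae g)] with x h1 h2 h3 hx
  rw [h1, h2, h3, indicator_of_notMem, indicator_of_notMem]
  · simp
  · exact fun h => hx ⟨by linarith [h.2], by linarith [h.1]⟩
  · exact fun h => hx ⟨by linarith [h.1], by linarith [h.2]⟩

lemma oddExt_ae_eq_zero (g : L2) : ∀ᵐ x, x ∉ Ioo (-1 : ℝ) 1 → (oddExt g : ℝ → ℝ) x = 0 := by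
  rw [oddExt_apply]
  filter_upwards [zeroExtend_ae_eq_zero g,
    Lp.coeFn_sub (zeroExtend 0 1 g) (reflect (zeroExtend 0 1 g))] with x h1 h2 hx
  rw [h2, Pi.sub_apply, (h1 hx).1, (h1 hx).2, sub_zero]

lemma evenExt_ae_eq_zero (g : L2) : ∀ᵐ x, x ∉ Ioo (-1 : ℝ) 1 → (evenExt g : ℝ → ℝ) x = 0 := by
  rw [evenExt_apply]
  filter_upwards [zeroExtend_ae_eq_zero g,
    Lp.coeFn_add (zeroExtend 0 1 g) (reflect (zeroExtend 0 1 g))] with x h1 h2 hx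
  rw [h2, Pi.add_apply, (h1 hx).1, (h1 hx).2, add_zero]

end LineL2

/-- Integration by parts for primitives of integrable functions. -/
lemma integral_mul_primitive_add {a b : ℝ} {f g : ℝ → ℝ}
    (hf : IntervalIntegrable f volume a b) (hg : IntervalIntegrable g volume a b) (c d : ℝ) :
    ∫ x in a..b, (f x * (d + ∫ s in a..x, g s) + (c + ∫ s in a..x, f s) * g x)
      = (c + ∫ s in a..b, f s) * (d + ∫ s in a..b, g s) - c * d := by
  have ac {f : ℝ → ℝ} (hf : IntervalIntegrable f volume a b) (c : ℝ) :
      AbsolutelyContinuousOnInterval (fun x => c + ∫ s in a..x, f s) a b := by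
    refine AbsolutelyContinuousOnInterval.add ?_
      (hf.absolutelyContinuousOnInterval_intervalIntegral (by simp))
    exact contDiff_const.contDiffOn.absolutelyContinuousOnInterval
  have h := (ac hf c).integral_deriv_mul_eq_sub (ac hg d)
  simp only [intervalIntegral.integral_same, add_zero] at h
  rw [← h]
  refine intervalIntegral.integral_congr_ae ?_
  filter_upwards [hf.ae_hasDerivAt_integral, hg.ae_hasDerivAt_integral] with s h1 h2 hs
  rw [((h1 (uIoc_subset_uIcc hs) a (by simp)).const_add c).deriv,
    ((h2 (uIoc_subset_uIcc hs) a (by simp)).const_add d).deriv]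

/-! ### d'Alembert's formula and the weak form of the free wave equation -/

namespace LineL2

/-- Translates of a function in `L²(ℝ)` along lines `x ↦ c x + r`, `|c| ≤ 1`, times a function in
`L²(Ω)`, are integrable on strips. -/
lemma integrable_strip (h : LineL2) (w : L2) {c : ℝ} (hc : |c| ≤ 1) {s t : ℝ} (hst : s ≤ t) :
    Integrable (Function.uncurry fun x r => (h : ℝ → ℝ) (c * x + r) * (w : ℝ → ℝ) x)
      ((leb 0 1).prod (volume.restrict (Ioc s t))) := by
  have hm : StronglyMeasurable
      (Function.uncurry fun x r => (h : ℝ → ℝ) (c * x + r) * (w : ℝ → ℝ) x) := by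
    refine StronglyMeasurable.mul ?_ ?_
    · exact (Lp.stronglyMeasurable h).comp_measurable
        ((measurable_fst.const_mul c).add measurable_snd)
    · exact (Lp.stronglyMeasurable w).comp_measurable measurable_fst
  have hsec (x : ℝ) : IntervalIntegrable (fun r => (h : ℝ → ℝ) (c * x + r)) volume s t := by
    have := (h.intervalIntegrable (c * x + s) (c * x + t)).comp_add_left (c * x)
    simpa using this
  rw [integrable_prod_iff hm.aestronglyMeasurable]
  constructor
  · refine Filter.Eventually.of_forall fun x => ?_
    have := (hsec x).mul_const ((w : ℝ → ℝ) x)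
    rwa [intervalIntegrable_iff_integrableOn_Ioc_of_le hst] at this
  -- For `|c| ≤ 1` and `x ∈ (0, 1)` the window `c x + [s, t]` stays in `[s - 1, t + 1]`, which gives
  -- a bound independent of `x`.
  · refine Integrable.mono' ((L2.integrable w).norm.const_mul
      (∫ r in (s - 1)..(t + 1), ‖(h : ℝ → ℝ) r‖)) ?_ ?_
    · exact hm.norm.integral_prod_right'.aestronglyMeasurable
    · filter_upwards [ae_restrict_mem measurableSet_Ioo] with x hx
      rw [Real.norm_of_nonneg (integral_nonneg fun _ => norm_nonneg _)]
      simp only [Function.uncurry, norm_mul]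
      rw [integral_mul_const]
      refine mul_le_mul_of_nonneg_right ?_ (norm_nonneg _)
      rw [← intervalIntegral.integral_of_le hst,
        intervalIntegral.integral_comp_add_left (fun r => ‖(h : ℝ → ℝ) r‖)]
      have hcx : |c * x| ≤ 1 := by
        rw [abs_mul, abs_of_pos hx.1]
        exact mul_le_one₀ hc hx.1.le hx.2.le
      refine intervalIntegral.integral_mono_interval ?_ (by linarith) ?_
        (Filter.Eventually.of_forall fun _ => norm_nonneg _) (h.intervalIntegrable _ _).norm
      · linarith [neg_abs_le (c * x)]
      · linarith [le_abs_self (c * x)]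

/-- Fubini and a translation of variable. With `c = ±1` it rewrites the time integral of a pairing
with a travelling wave as a pairing with an increment of a primitive of `h`. -/
lemma integral_strip_swap (h : LineL2) (w : L2) {c : ℝ} (hc : |c| ≤ 1) {s t : ℝ} (hst : s ≤ t) :
    ∫ r in s..t, ∫ x, (h : ℝ → ℝ) (c * x + r) * (w : ℝ → ℝ) x ∂(leb 0 1)
      = ∫ x, (∫ r in (c * x + s)..(c * x + t), (h : ℝ → ℝ) r) * (w : ℝ → ℝ) x ∂(leb 0 1) := by
  rw [intervalIntegral.integral_of_le hst, ← integral_integral_swap (integrable_strip h w hc hst)]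
  refine integral_congr_ae (Filter.Eventually.of_forall fun x => ?_)
  simp only
  rw [integral_mul_const, ← intervalIntegral.integral_of_le hst,
    intervalIntegral.integral_comp_add_left (fun r => (h : ℝ → ℝ) r)]

lemma integrable_section (h : LineL2) (w : L2) {c : ℝ} (hc : |c| = 1) (r : ℝ) :
    Integrable (fun x => (h : ℝ → ℝ) (c * x + r) * (w : ℝ → ℝ) x) (leb 0 1) := by
  have e : MemLp (fun x => (h : ℝ → ℝ) (c * x + r)) 2 (leb 0 1) := by
    rcases eq_or_eq_neg_of_abs_eq hc with rfl | rfl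
    · refine MemLp.ae_eq ?_ ((Lp.memLp (shift r h)).restrict _)
      filter_upwards [ae_restrict_of_ae (shift_ae r h)] with x hx
      rw [hx, one_mul]
    · refine MemLp.ae_eq ?_ ((Lp.memLp (reflect (shift r h))).restrict _)
      filter_upwards [ae_restrict_of_ae (reflect_ae (shift r h)),
        ae_restrict_of_ae (ae_comp_neg (shift_ae r h))] with x hx hx'
      rw [hx, hx', neg_one_mul]
  exact e.integrable_mul (Lp.memLp w)

lemma integrable_strip_left (h : LineL2) (w : L2) {c : ℝ} (hc : |c| ≤ 1) {s t : ℝ} (hst : s ≤ t) :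
    Integrable (fun x => (∫ r in (c * x + s)..(c * x + t), (h : ℝ → ℝ) r) * (w : ℝ → ℝ) x)
      (leb 0 1) := by
  refine (integrable_strip h w hc hst).integral_prod_left.congr
    (Filter.Eventually.of_forall fun x => ?_)
  simp only [Function.uncurry]
  rw [integral_mul_const, ← intervalIntegral.integral_of_le hst,
    intervalIntegral.integral_comp_add_left (fun r => (h : ℝ → ℝ) r)]

lemma intervalIntegrable_strip_right (h : LineL2) (w : L2) {c : ℝ} (hc : |c| ≤ 1) {s t : ℝ}
    (hst : s ≤ t) :
    IntervalIntegrable (fun r => ∫ x, (h : ℝ → ℝ) (c * x + r) * (w : ℝ → ℝ) x ∂(leb 0 1))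
      volume s t := by
  rw [intervalIntegrable_iff_integrableOn_Ioc_of_le hst]
  exact (integrable_strip h w hc hst).integral_prod_right

lemma inner_evenPart_shift (t : ℝ) (h : LineL2) (w : L2) :
    inner ℝ (evenPart (shift t h)) w
      = ((∫ x, (h : ℝ → ℝ) (1 * x + t) * (w : ℝ → ℝ) x ∂(leb 0 1))
        + ∫ x, (h : ℝ → ℝ) (-1 * x + t) * (w : ℝ → ℝ) x ∂(leb 0 1)) / 2 := by
  rw [inner_L2, ← integral_add (integrable_section h w (by simp) t)
    (integrable_section h w (by simp) t), ← integral_div]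
  refine integral_congr_ae ?_
  filter_upwards [evenPart_shift_ae t h] with x hx
  rw [hx]
  ring_nf

lemma inner_oddPart_shift (t : ℝ) (h : LineL2) (w : L2) :
    inner ℝ (oddPart (shift t h)) w
      = ((∫ x, (h : ℝ → ℝ) (1 * x + t) * (w : ℝ → ℝ) x ∂(leb 0 1))
        - ∫ x, (h : ℝ → ℝ) (-1 * x + t) * (w : ℝ → ℝ) x ∂(leb 0 1)) / 2 := by
  rw [inner_L2, ← integral_sub (integrable_section h w (by simp) t)
    (integrable_section h w (by simp) t), ← integral_div]
  refine integral_congr_ae ?_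
  filter_upwards [oddPart_shift_ae t h] with x hx
  rw [hx]
  ring_nf

/-- The displacement at time `t` of the wave with profile `h`: its space derivative is
`x ↦ (h(t + x) + h(t - x)) / 2`. -/
def wave (h : LineL2) : H1Zero := H1Zero.dxEquiv.symm (evenPart h)

@[simp] lemma dx_wave (h : LineL2) : (wave h).dx = evenPart h := H1Zero.dx_dxEquiv_symm _

/-- d'Alembert's formula: integrating the slope from `x = 0`, the two travelling parts contribute
the adjacent intervals `[t, t + x]` and `[t - x, t]`. -/
lemma rep_wave_shift (t : ℝ) (h : LineL2) {x : ℝ} (hx : x ∈ Icc (0 : ℝ) 1) :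
    (wave (shift t h)).rep x = (∫ r in (-x + t)..(x + t), (h : ℝ → ℝ) r) / 2 := by
  rw [H1Zero.rep_eq_integral _ hx, dx_wave]
  have e : ∫ s in (0 : ℝ)..x, (evenPart (shift t h) : ℝ → ℝ) s
      = ∫ s in (0 : ℝ)..x, ((h : ℝ → ℝ) (s + t) + (h : ℝ → ℝ) (t - s)) / 2 := by
    refine intervalIntegral.integral_congr_ae ?_
    have := evenPart_shift_ae t h
    rw [Filter.EventuallyEq, ae_restrict_iff' measurableSet_Ioo] at this
    have h1 : ∀ᵐ s : ℝ, s ≠ 1 := by simp [ae_iff, measure_singleton]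
    filter_upwards [this, h1] with s hs hs1 hs'
    rw [uIoc_of_le hx.1] at hs'
    rw [hs ⟨hs'.1, lt_of_le_of_ne (hs'.2.trans hx.2) hs1⟩, neg_add_eq_sub]
  have i1 : IntervalIntegrable (fun s => (h : ℝ → ℝ) (s + t)) volume 0 x := by
    simpa using (h.intervalIntegrable (0 + t) (x + t)).comp_add_right t
  have i2 : IntervalIntegrable (fun s => (h : ℝ → ℝ) (t - s)) volume 0 x := by
    simpa using (h.intervalIntegrable (t - 0) (t - x)).comp_sub_left t
  rw [e, intervalIntegral.integral_div, intervalIntegral.integral_add i1 i2,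
    intervalIntegral.integral_comp_add_right (fun s => (h : ℝ → ℝ) s),
    intervalIntegral.integral_comp_sub_left (fun s => (h : ℝ → ℝ) s), add_comm,
    zero_add, sub_zero, intervalIntegral.integral_add_adjacent_intervals
      (h.intervalIntegrable _ _) (h.intervalIntegrable _ _), neg_add_eq_sub]

/-- The time derivative of the free wave. -/
lemma inner_wave_sub (h : LineL2) (w : L2) {s t : ℝ} (hst : s ≤ t) :
    inner ℝ (wave (shift t h)).toL2 w - inner ℝ (wave (shift s h)).toL2 w
      = ∫ r in s..t, inner ℝ (oddPart (shift r h)) w := by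
  have e1 (t : ℝ) : inner ℝ (wave (shift t h)).toL2 w
      = ∫ x, (wave (shift t h)).rep x * (w : ℝ → ℝ) x ∂(leb 0 1) := by
    rw [inner_L2]
    refine integral_congr_ae ?_
    filter_upwards [(wave (shift t h)).toL2_ae_eq_rep] with x hx
    rw [hx]
  have i (t : ℝ) : Integrable (fun x => (wave (shift t h)).rep x * (w : ℝ → ℝ) x) (leb 0 1) := by
    refine ((Lp.memLp (wave (shift t h)).toL2).integrable_mul (Lp.memLp w)).congr ?_
    filter_upwards [(wave (shift t h)).toL2_ae_eq_rep] with x hx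
    rw [Pi.mul_apply, hx]
  simp_rw [inner_oddPart_shift]
  rw [intervalIntegral.integral_div, intervalIntegral.integral_sub
    (intervalIntegrable_strip_right h w (by simp) hst)
    (intervalIntegrable_strip_right h w (by simp) hst), integral_strip_swap h w (by simp) hst,
    integral_strip_swap h w (by simp) hst,
    ← integral_sub (integrable_strip_left h w (by simp) hst)
      (integrable_strip_left h w (by simp) hst), ← integral_div, e1, e1, ← integral_sub (i t) (i s)]
  refine integral_congr_ae ?_
  filter_upwards [ae_restrict_mem measurableSet_Ioo] with x hx
  rw [rep_wave_shift t h (Ioo_subset_Icc_self hx), rep_wave_shift s h (Ioo_subset_Icc_self hx)]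
  simp only [one_mul, neg_one_mul]
  -- Moving the window: `∫_{t-x}^{t+x} h - ∫_{s-x}^{s+x} h = ∫_{s+x}^{t+x} h - ∫_{s-x}^{t-x} h`.
  have a1 := intervalIntegral.integral_interval_sub_interval_comm
    (h.intervalIntegrable (-x + t) (x + t)) (h.intervalIntegrable (-x + s) (x + s))
    (h.intervalIntegrable (-x + t) (-x + s))
  rw [intervalIntegral.integral_symm (-x + s) (-x + t),
    intervalIntegral.integral_symm (x + s) (x + t)] at a1
  rw [← sub_mul]
  linear_combination ((w : ℝ → ℝ) x / 2) * a1

/-- The weak form of the wave equation for the free wave, with the boundary term at `1`. -/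
lemma inner_oddPart_sub (h : LineL2) (z : H1Zero) {s t : ℝ} (hst : s ≤ t) :
    inner ℝ (oddPart (shift t h)) z.toL2 - inner ℝ (oddPart (shift s h)) z.toL2
      = (∫ r in s..t, ((h : ℝ → ℝ) (r + 1) + (h : ℝ → ℝ) (r - 1)) / 2) * z.rep 1
        - ∫ r in s..t, inner ℝ (evenPart (shift r h)) z.dx := by
  have i1 (t : ℝ) : IntervalIntegrable (fun s => (h : ℝ → ℝ) (s + t)) volume 0 1 := by
    simpa using (h.intervalIntegrable (0 + t) (1 + t)).comp_add_right t
  have i2 (t : ℝ) : IntervalIntegrable (fun s => (h : ℝ → ℝ) (-s + t)) volume 0 1 := by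
    have : IntervalIntegrable (fun s => (h : ℝ → ℝ) (t - s)) volume 0 1 := by
      simpa using (h.intervalIntegrable (t - 0) (t - 1)).comp_sub_left t
    simpa only [neg_add_eq_sub] using this
  have iz : IntervalIntegrable (z.dx : ℝ → ℝ) volume 0 1 := by
    rw [intervalIntegrable_iff_integrableOn_Ioo_of_le zero_le_one]
    exact L2.integrable z.dx
  -- `H(t, x) = ∫₀^{t+x} h + ∫₀^{t-x} h`, up to an additive constant depending on `t`
  have prim (t x : ℝ) (hx : x ∈ Icc (0 : ℝ) 1) :
      ∫ ξ in (0 : ℝ)..x, ((h : ℝ → ℝ) (ξ + t) - (h : ℝ → ℝ) (-ξ + t))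
        = (∫ r in (0 : ℝ)..(x + t), (h : ℝ → ℝ) r) + (∫ r in (0 : ℝ)..(-x + t), (h : ℝ → ℝ) r)
          - 2 * ∫ r in (0 : ℝ)..t, (h : ℝ → ℝ) r := by
    have hs : uIcc 0 x ⊆ uIcc (0 : ℝ) 1 := by
      rw [uIcc_of_le hx.1, uIcc_of_le zero_le_one]; exact Icc_subset_Icc_right hx.2
    rw [intervalIntegral.integral_sub ((i1 t).mono_set hs) ((i2 t).mono_set hs),
      intervalIntegral.integral_comp_add_right (fun s => (h : ℝ → ℝ) s)]
    simp_rw [neg_add_eq_sub]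
    rw [intervalIntegral.integral_comp_sub_left (fun s => (h : ℝ → ℝ) s), zero_add, sub_zero,
      intervalIntegral.integral_interval_sub_left (h.intervalIntegrable 0 (x + t))
        (h.intervalIntegrable 0 t) |>.symm,
      intervalIntegral.integral_interval_sub_left (h.intervalIntegrable 0 t)
        (h.intervalIntegrable 0 (t - x)) |>.symm]
    ring
  set K : ℝ → ℝ → ℝ := fun t x =>
    (∫ r in (0 : ℝ)..(x + t), (h : ℝ → ℝ) r) + ∫ r in (0 : ℝ)..(-x + t), (h : ℝ → ℝ) r with hK
  have cK (t : ℝ) : Continuous (K t) := by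
    have c0 := intervalIntegral.continuous_primitive (fun a b => h.intervalIntegrable a b) 0
    exact (c0.comp (continuous_id.add continuous_const)).add
      (c0.comp (continuous_neg.add continuous_const))
  have iK' (t : ℝ) : IntervalIntegrable (fun x => K t x * (z.dx : ℝ → ℝ) x) volume 0 1 :=
    iz.continuousOn_mul (cK t).continuousOn
  have iK (t : ℝ) : Integrable (fun x => K t x * (z.dx : ℝ → ℝ) x) (leb 0 1) := by
    have := iK' t
    rwa [intervalIntegrable_iff_integrableOn_Ioo_of_le zero_le_one] at this
  -- `K t` is an antiderivative in `x` of twice the velocity. Integration by parts against `z`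
  -- leaves a boundary term at `1` only, since `z(0) = 0`.
  have ibp (t : ℝ) : inner ℝ (oddPart (shift t h)) z.toL2
      = K t 1 / 2 * z.rep 1 - (∫ x, K t x * (z.dx : ℝ → ℝ) x ∂(leb 0 1)) / 2 := by
    -- The additive constant is `K t 0`, so that the first primitive is `K t` itself.
    have p := integral_mul_primitive_add ((i1 t).sub (i2 t)) iz
      (2 * ∫ r in (0 : ℝ)..t, (h : ℝ → ℝ) r) 0
    rw [prim t 1 (by simp), integral_interval_eq_leb zero_le_one] at p
    have j1 := integrable_section h z.toL2 (c := 1) (by simp) t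
    have j2 := integrable_section h z.toL2 (c := -1) (by simp) t
    have e : ∫ x, (((h : ℝ → ℝ) (1 * x + t) * (z.toL2 : ℝ → ℝ) x
          - (h : ℝ → ℝ) (-1 * x + t) * (z.toL2 : ℝ → ℝ) x) + K t x * (z.dx : ℝ → ℝ) x) ∂(leb 0 1)
        = K t 1 * z.rep 1 := by
      rw [z.rep_eq_integral (x := 1) (by simp)]
      have hc : K t 1 * ∫ s in (0 : ℝ)..1, (z.dx : ℝ → ℝ) s
          = (2 * ∫ r in (0 : ℝ)..t, (h : ℝ → ℝ) r) * 0 + ((2 * ∫ r in (0 : ℝ)..t, (h : ℝ → ℝ) r)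
            + (K t 1 - 2 * ∫ r in (0 : ℝ)..t, (h : ℝ → ℝ) r))
            * (0 + ∫ s in (0 : ℝ)..1, (z.dx : ℝ → ℝ) s) - (2 * ∫ r in (0 : ℝ)..t, (h : ℝ → ℝ) r) * 0 := by
        ring
      rw [hc, mul_zero, zero_add, hK]
      refine Eq.trans (integral_congr_ae ?_) (p.trans (by ring))
      filter_upwards [ae_restrict_mem measurableSet_Ioo, z.toL2_ae_eq_rep] with x hx hzx
      rw [prim t x (Ioo_subset_Icc_self hx), hzx, z.rep_eq_integral (Ioo_subset_Icc_self hx)]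
      simp only [one_mul, neg_one_mul]
      ring
    have j12 : Integrable (fun x => (h : ℝ → ℝ) (1 * x + t) * (z.toL2 : ℝ → ℝ) x
        - (h : ℝ → ℝ) (-1 * x + t) * (z.toL2 : ℝ → ℝ) x) (leb 0 1) := j1.sub j2
    rw [integral_add j12 (iK t), integral_sub j1 j2] at e
    rw [inner_oddPart_shift]
    linarith
  have hsub (a : ℝ) : (∫ r in (0 : ℝ)..(a + t), (h : ℝ → ℝ) r) - ∫ r in (0 : ℝ)..(a + s), (h : ℝ → ℝ) r
      = ∫ r in (a + s)..(a + t), (h : ℝ → ℝ) r :=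
    intervalIntegral.integral_interval_sub_left (h.intervalIntegrable _ _) (h.intervalIntegrable _ _)
  -- The slope at `x = 1`, integrated over time, is the increment of the boundary term.
  have k1 : ∫ r in s..t, ((h : ℝ → ℝ) (r + 1) + (h : ℝ → ℝ) (r - 1)) / 2 = (K t 1 - K s 1) / 2 := by
    have m1 : IntervalIntegrable (fun r => (h : ℝ → ℝ) (r + 1)) volume s t := by
      simpa using (h.intervalIntegrable (s + 1) (t + 1)).comp_add_right 1
    have m2 : IntervalIntegrable (fun r => (h : ℝ → ℝ) (r - 1)) volume s t := by
      simpa using (h.intervalIntegrable (s - 1) (t - 1)).comp_sub_right 1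
    rw [intervalIntegral.integral_div, intervalIntegral.integral_add m1 m2,
      intervalIntegral.integral_comp_add_right (fun s => (h : ℝ → ℝ) s),
      intervalIntegral.integral_comp_sub_right (fun s => (h : ℝ → ℝ) s)]
    simp only [hK]
    rw [add_sub_add_comm, hsub, hsub, add_comm s 1, add_comm t 1, neg_add_eq_sub, neg_add_eq_sub]
  rw [k1]
  simp_rw [inner_evenPart_shift]
  rw [intervalIntegral.integral_div, intervalIntegral.integral_add
    (intervalIntegrable_strip_right h z.dx (by simp) hst)
    (intervalIntegrable_strip_right h z.dx (by simp) hst), integral_strip_swap h z.dx (by simp) hst,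
    integral_strip_swap h z.dx (by simp) hst,
    ← integral_add (integrable_strip_left h z.dx (by simp) hst)
      (integrable_strip_left h z.dx (by simp) hst), ibp, ibp]
  have k2 : ∫ x, ((∫ r in (1 * x + s)..(1 * x + t), (h : ℝ → ℝ) r) * (z.dx : ℝ → ℝ) x
        + (∫ r in (-1 * x + s)..(-1 * x + t), (h : ℝ → ℝ) r) * (z.dx : ℝ → ℝ) x) ∂(leb 0 1)
      = (∫ x, K t x * (z.dx : ℝ → ℝ) x ∂(leb 0 1)) - ∫ x, K s x * (z.dx : ℝ → ℝ) x ∂(leb 0 1) := by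
    rw [← integral_sub (iK t) (iK s)]
    refine integral_congr_ae (Filter.Eventually.of_forall fun x => ?_)
    simp only [hK]
    rw [← hsub, ← hsub]
    simp only [one_mul, neg_one_mul]
    ring
  rw [k2]
  ring

/-- The trace at `1` of the free wave. -/
lemma rep_one_wave_sub (h : LineL2) (s t : ℝ) :
    (wave (shift t h)).rep 1 - (wave (shift s h)).rep 1
      = ∫ r in s..t, ((h : ℝ → ℝ) (r + 1) - (h : ℝ → ℝ) (r - 1)) / 2 := by
  have m1 : IntervalIntegrable (fun r => (h : ℝ → ℝ) (r + 1)) volume s t := by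
    simpa using (h.intervalIntegrable (s + 1) (t + 1)).comp_add_right 1
  have m2 : IntervalIntegrable (fun r => (h : ℝ → ℝ) (r - 1)) volume s t := by
    simpa using (h.intervalIntegrable (s - 1) (t - 1)).comp_sub_right 1
  rw [rep_wave_shift t h (by simp), rep_wave_shift s h (by simp), intervalIntegral.integral_div,
    intervalIntegral.integral_sub m1 m2,
    intervalIntegral.integral_comp_add_right (fun s => (h : ℝ → ℝ) s),
    intervalIntegral.integral_comp_sub_right (fun s => (h : ℝ → ℝ) s)]
  have a1 := intervalIntegral.integral_interval_sub_interval_comm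
    (h.intervalIntegrable (t - 1) (t + 1)) (h.intervalIntegrable (s - 1) (s + 1))
    (h.intervalIntegrable (t - 1) (s - 1))
  rw [intervalIntegral.integral_symm (s - 1) (t - 1),
    intervalIntegral.integral_symm (s + 1) (t + 1)] at a1
  rw [neg_add_eq_sub, neg_add_eq_sub, add_comm 1 t, add_comm 1 s]
  linarith

end LineL2

/-! ### Finite speed of propagation, reflections at the ends, profiles of the data -/

namespace LineL2

/-- Restriction to `(-∞, a)`. -/
def past (a : ℝ) : LineL2 →L[ℝ] Lp ℝ 2 (volume.restrict (Iio a)) :=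
  LpToLpRestrictCLM ℝ ℝ ℝ volume 2 (Iio a)

lemma past_ae (a : ℝ) (h : LineL2) : past a h =ᵐ[volume.restrict (Iio a)] h :=
  LpToLpRestrictCLM_coeFn ℝ (Iio a) h

lemma norm_past (a : ℝ) (h : LineL2) :
    ‖past a h‖ = (eLpNorm (h : ℝ → ℝ) 2 (volume.restrict (Iio a))).toReal := by
  rw [Lp.norm_def, eLpNorm_congr_ae (past_ae a h)]

lemma eLpNorm_restrict_ne_top (h : LineL2) (s : Set ℝ) :
    eLpNorm (h : ℝ → ℝ) 2 (volume.restrict s) ≠ ⊤ :=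
  ((Lp.memLp h).restrict s).2.ne

lemma norm_past_le (a : ℝ) (h : LineL2) : ‖past a h‖ ≤ ‖h‖ := norm_Lp_toLp_restrict_le (Iio a) h

lemma norm_past_mono {a b : ℝ} (hab : a ≤ b) (h : LineL2) : ‖past a h‖ ≤ ‖past b h‖ := by
  rw [norm_past, norm_past]
  exact ENNReal.toReal_mono (eLpNorm_restrict_ne_top h _)
    (eLpNorm_mono_measure _ (Measure.restrict_mono (Iio_subset_Iio hab) le_rfl))

lemma past_eq_zero_iff {a : ℝ} {h : LineL2} :
    past a h = 0 ↔ ∀ᵐ x, x < a → (h : ℝ → ℝ) x = 0 := by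
  rw [Lp.eq_zero_iff_ae_eq_zero]
  constructor
  · intro hh
    exact (ae_restrict_iff' measurableSet_Iio).1 ((past_ae a h).symm.trans hh)
  · intro hh
    exact (past_ae a h).trans ((ae_restrict_iff' measurableSet_Iio).2 hh)

lemma norm_past_shift (a t : ℝ) (h : LineL2) : ‖past a (shift t h)‖ = ‖past (a + t) h‖ := by
  rw [norm_past, norm_past, eLpNorm_congr_ae (ae_restrict_of_ae (shift_ae t h))]
  have hp := (measurePreserving_add_right (volume : Measure ℝ) t).restrict_preimage
    (measurableSet_Iio (a := a + t))
  have hs : (fun x => x + t) ⁻¹' Iio (a + t) = Iio a := by ext x; simp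
  rw [hs] at hp
  rw [← eLpNorm_comp_measurePreserving ((Lp.memLp h).1.restrict) hp]
  rfl

lemma norm_restr_le (h : LineL2) : ‖restr h‖ ≤ ‖past 1 h‖ := by
  rw [norm_past, Lp.norm_def, eLpNorm_congr_ae (restr_ae h)]
  exact ENNReal.toReal_mono (eLpNorm_restrict_ne_top h _)
    (eLpNorm_mono_measure _ (Measure.restrict_mono (fun x hx => hx.2) le_rfl))

lemma norm_restr_reflect_le (h : LineL2) : ‖restr (reflect h)‖ ≤ ‖past 1 h‖ := by
  rw [norm_past, Lp.norm_def, eLpNorm_congr_ae (restr_ae _),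
    eLpNorm_congr_ae (ae_restrict_of_ae (reflect_ae h))]
  have hp := (Measure.measurePreserving_neg (volume : Measure ℝ)).restrict_preimage
    (measurableSet_Ioo (a := (-1 : ℝ)) (b := 0))
  have hs : Neg.neg ⁻¹' Ioo (-1 : ℝ) 0 = Ioo 0 1 := by
    ext x; simp
  rw [hs] at hp
  have e := eLpNorm_comp_measurePreserving (p := 2) ((Lp.memLp h).1.restrict) hp
  refine ENNReal.toReal_mono (eLpNorm_restrict_ne_top h _) (e.le.trans ?_)
  exact eLpNorm_mono_measure _ (Measure.restrict_mono (fun x hx => hx.2.trans one_pos) le_rfl)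

/-- At time `t` the points of `Ω` read `h` only at `t ± x` with `0 < x < 1`, hence before `t + 1`.
This bound and the one for `oddPart` control the whole energy at time `t`. -/
lemma norm_evenPart_shift_le (t : ℝ) (h : LineL2) : ‖evenPart (shift t h)‖ ≤ ‖past (t + 1) h‖ := by
  rw [evenPart_apply, norm_smul, add_comm t 1, ← norm_past_shift]
  have := norm_add_le (restr (shift t h)) (restr (reflect (shift t h)))
  rw [Real.norm_of_nonneg (by norm_num)]
  linarith [norm_restr_le (shift t h), norm_restr_reflect_le (shift t h)]

lemma norm_oddPart_shift_le (t : ℝ) (h : LineL2) : ‖oddPart (shift t h)‖ ≤ ‖past (t + 1) h‖ := by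
  rw [oddPart_apply, norm_smul, add_comm t 1, ← norm_past_shift]
  have := norm_sub_le (restr (shift t h)) (restr (reflect (shift t h)))
  rw [Real.norm_of_nonneg (by norm_num)]
  linarith [norm_restr_le (shift t h), norm_restr_reflect_le (shift t h)]

lemma norm_wave (h : LineL2) : ‖wave h‖ = ‖evenPart h‖ := by rw [H1Zero.norm_eq, dx_wave]

lemma evenPart_eq_zero_of_past {h : LineL2} (hh : past 1 h = 0) : evenPart h = 0 := by
  have := norm_evenPart_shift_le 0 h
  rw [zero_add, shift_zero, hh, norm_zero] at this
  exact norm_le_zero_iff.1 this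

lemma oddPart_eq_zero_of_past {h : LineL2} (hh : past 1 h = 0) : oddPart h = 0 := by
  have := norm_oddPart_shift_le 0 h
  rw [zero_add, shift_zero, hh, norm_zero] at this
  exact norm_le_zero_iff.1 this

/-- The profile obtained from `k` by `N` reflections at the two ends of `Ω`. -/
def bounce (N : ℕ) : LineL2 →L[ℝ] LineL2 :=
  ∑ j ∈ Finset.range (N + 1), (-1 : ℝ) ^ j • (shift (-(2 * j))).toContinuousLinearMap

lemma bounce_apply (N : ℕ) (k : LineL2) :
    bounce N k = ∑ j ∈ Finset.range (N + 1), (-1 : ℝ) ^ j • shift (-(2 * j)) k := by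
  simp [bounce]

/-- The alternating sum telescopes: `bounce` is the Neumann series of the inverse of `1 + shift
(-2)` truncated after `N + 1` terms, and the remainder is `k` delayed by `2(N + 1)`. -/
lemma bounce_add_shift (N : ℕ) (k : LineL2) :
    bounce N k + shift (-2) (bounce N k) = k + (-1 : ℝ) ^ N • shift (-(2 * (N + 1 : ℝ))) k := by
  induction N with
  | zero => simp [bounce_apply]
  | succ N ih =>
    have e : bounce (N + 1) k = bounce N k + (-1 : ℝ) ^ (N + 1) • shift (-(2 * (N + 1 : ℝ))) k := by
      rw [bounce_apply, bounce_apply, Finset.sum_range_succ _ (N + 1)]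
      push_cast
      rfl
    rw [e, map_add, add_add_add_comm, ih, map_smul, shift_shift,
      show (-2 : ℝ) + -(2 * (N + 1)) = -(2 * ((N + 1 : ℕ) + 1 : ℝ)) by push_cast; ring, pow_succ]
    module

/-- Delays read only earlier values, so each of the `N + 1` terms is bounded by the past of `k`.
This causality makes the final bounds depend on the data before `t` only. -/
lemma norm_past_bounce_le (N : ℕ) (a : ℝ) (k : LineL2) :
    ‖past a (bounce N k)‖ ≤ (N + 1) * ‖past a k‖ := by
  rw [bounce_apply, map_sum]
  refine (norm_sum_le _ _).trans ?_
  have : ∀ j ∈ Finset.range (N + 1), ‖past a ((-1 : ℝ) ^ j • shift (-(2 * j)) k)‖ ≤ ‖past a k‖ := by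
    intro j _
    rw [map_smul, norm_smul, norm_pow, norm_neg, norm_one, one_pow, one_mul, norm_past_shift]
    refine norm_past_mono ?_ k
    have : (0 : ℝ) ≤ j := Nat.cast_nonneg j
    linarith
  refine (Finset.sum_le_card_nsmul _ _ _ this).trans ?_
  simp

lemma norm_bounce_le (N : ℕ) (k : LineL2) : ‖bounce N k‖ ≤ (N + 1) * ‖k‖ := by
  rw [bounce_apply]
  refine (norm_sum_le _ _).trans ?_
  have : ∀ j ∈ Finset.range (N + 1), ‖(-1 : ℝ) ^ j • shift (-(2 * j)) k‖ ≤ ‖k‖ := by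
    intro j _
    rw [norm_smul, norm_pow, norm_neg, norm_one, one_pow, one_mul, LinearIsometry.norm_map]
  refine (Finset.sum_le_card_nsmul _ _ _ this).trans ?_
  simp

lemma past_bounce_eq_zero {a : ℝ} {k : LineL2} (N : ℕ) (hk : past a k = 0) :
    past a (bounce N k) = 0 := by
  have := norm_past_bounce_le N a k
  rw [hk, norm_zero, mul_zero] at this
  exact norm_le_zero_iff.1 this

lemma past_shift_eq_zero {a b t : ℝ} {k : LineL2} (hk : past a k = 0) (hb : b + t ≤ a) :
    past b (shift t k) = 0 := by
  have := norm_past_mono hb k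
  rw [hk, norm_zero, ← norm_past_shift] at this
  exact norm_le_zero_iff.1 this

/-- The reflected profile agrees with the original one before the first reflection. -/
lemma past_bounce_sub_eq_zero {k : LineL2} (N : ℕ) (hk : past (-1) k = 0) :
    past 1 (bounce N k - k) = 0 := by
  have h := bounce_add_shift N k
  -- Both terms on the right are delayed by at least `2`, and the profile starts at `-1`, so they
  -- start at `1` or later.
  have e : bounce N k - k = (-1 : ℝ) ^ N • shift (-(2 * (N + 1 : ℝ))) k
      - shift (-2) (bounce N k) := by
    rw [eq_sub_iff_add_eq, sub_add_eq_add_sub, h]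
    abel
  have hN : (0 : ℝ) ≤ N := Nat.cast_nonneg N
  rw [e, map_sub, map_smul, past_shift_eq_zero hk (by linarith),
    past_shift_eq_zero (past_bounce_eq_zero N hk) (by norm_num), smul_zero, sub_zero]

lemma evenPart_bounce {k : LineL2} (N : ℕ) (hk : past (-1) k = 0) :
    evenPart (bounce N k) = evenPart k := by
  rw [← sub_eq_zero, ← map_sub]
  exact evenPart_eq_zero_of_past (past_bounce_sub_eq_zero N hk)

lemma oddPart_bounce {k : LineL2} (N : ℕ) (hk : past (-1) k = 0) :
    oddPart (bounce N k) = oddPart k := by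
  rw [← sub_eq_zero, ← map_sub]
  exact oddPart_eq_zero_of_past (past_bounce_sub_eq_zero N hk)

/-- The boundary condition satisfied by the reflected profile. -/
lemma bounce_boundary_ae {k : LineL2} (N : ℕ) (hk : past (-1) k = 0) :
    ∀ᵐ r : ℝ, r < 2 * N → (bounce N k : ℝ → ℝ) (r + 1) + (bounce N k : ℝ → ℝ) (r - 1)
      = (k : ℝ → ℝ) (r + 1) := by
  have h := bounce_add_shift N k
  -- The remainder of the truncated series starts at `2N + 1`. Evaluation at `r + 1` gives the range
  -- `r < 2N`, which contains `(0, T)` once `T ≤ 2N`.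
  have h0 : past (2 * N + 1) (shift (-(2 * (N + 1 : ℝ))) k) = 0 :=
    past_shift_eq_zero hk (by linarith)
  rw [past_eq_zero_iff] at h0
  have : ∀ᵐ x : ℝ, x < 2 * N + 1 → (bounce N k : ℝ → ℝ) x + (bounce N k : ℝ → ℝ) (x + -2)
      = (k : ℝ → ℝ) x := by
    have e1 := Lp.coeFn_add (bounce N k) (shift (-2) (bounce N k))
    rw [h] at e1
    filter_upwards [h0, e1, shift_ae (-2) (bounce N k),
      Lp.coeFn_add k ((-1 : ℝ) ^ N • shift (-(2 * (N + 1 : ℝ))) k),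
      Lp.coeFn_smul ((-1 : ℝ) ^ N) (shift (-(2 * (N + 1 : ℝ))) k)] with x h1 h2 h3 h4 h5 hx
    rw [h4, Pi.add_apply, h5, Pi.smul_apply, h1 hx, smul_zero, add_zero, Pi.add_apply, h3] at h2
    exact h2.symm
  filter_upwards [ae_comp_add this 1] with r hr hr'
  rw [← hr (by linarith)]
  ring_nf

lemma past_oddExt (g : L2) : past (-1) (oddExt g) = 0 := by
  rw [past_eq_zero_iff]
  filter_upwards [oddExt_ae_eq_zero g] with x hx h
  exact hx fun h' => by linarith [h'.1]

lemma past_evenExt (g : L2) : past (-1) (evenExt g) = 0 := by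
  rw [past_eq_zero_iff]
  filter_upwards [evenExt_ae_eq_zero g] with x hx h
  exact hx fun h' => by linarith [h'.1]

/-- The profile of the free wave with initial velocity `g`. -/
def impulse (N : ℕ) : L2 →L[ℝ] LineL2 := bounce N ∘L oddExt

lemma impulse_apply (N : ℕ) (g : L2) : impulse N g = bounce N (oddExt g) := rfl

lemma norm_impulse_le (N : ℕ) (g : L2) : ‖impulse N g‖ ≤ 2 * (N + 1) * ‖g‖ := by
  rw [impulse_apply]
  refine (norm_bounce_le N _).trans ?_
  have := mul_le_mul_of_nonneg_left (norm_oddExt_le g) (by positivity : (0 : ℝ) ≤ N + 1)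
  linarith

@[simp] lemma evenPart_impulse (N : ℕ) (g : L2) : evenPart (impulse N g) = 0 := by
  rw [impulse_apply, evenPart_bounce N (past_oddExt g), evenPart_oddExt]

@[simp] lemma oddPart_impulse (N : ℕ) (g : L2) : oddPart (impulse N g) = g := by
  rw [impulse_apply, oddPart_bounce N (past_oddExt g), oddPart_oddExt]

lemma past_impulse (N : ℕ) (g : L2) : past (-1) (impulse N g) = 0 :=
  past_bounce_eq_zero N (past_oddExt g)

/-- The odd extension vanishes beyond `1`, so the delay equation has no input for `r > 0`: the
condition at `x = 1` is homogeneous. -/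
lemma impulse_boundary_ae (N : ℕ) (g : L2) :
    ∀ᵐ r : ℝ, 0 < r → r < 2 * N →
      (impulse N g : ℝ → ℝ) (r + 1) + (impulse N g : ℝ → ℝ) (r - 1) = 0 := by
  filter_upwards [bounce_boundary_ae N (past_oddExt g), ae_comp_add (oddExt_ae_eq_zero g) 1]
    with r h1 h2 h3 h4
  rw [impulse_apply, h1 h4, h2 fun h => by linarith [h.2]]

/-- The profile of the wave with initial data `(u₀, u₁)` and boundary data `V`. -/
def profile (N : ℕ) (u₀ : H1Zero) (u₁ : L2) (V : LineL2) : LineL2 :=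
  bounce N (oddExt u₁ + evenExt u₀.dx + (2 : ℝ) • shift (-1) V)

section profile

variable {N : ℕ} {u₀ : H1Zero} {u₁ : L2} {V : LineL2}

lemma past_profile_arg (hV : past 0 V = 0) :
    past (-1) (oddExt u₁ + evenExt u₀.dx + (2 : ℝ) • shift (-1) V) = 0 := by
  rw [map_add, map_add, past_oddExt, past_evenExt, map_smul,
    past_shift_eq_zero hV (by norm_num), smul_zero, add_zero, add_zero]

/-- The boundary datum starts at time `0`, so its contribution to the profile starts at `1` and
leaves the initial displacement untouched. -/
lemma wave_profile (hV : past 0 V = 0) : wave (profile N u₀ u₁ V) = u₀ := by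
  apply H1Zero.dx_injective
  rw [dx_wave, profile, evenPart_bounce N (past_profile_arg hV), map_add, map_add, map_smul,
    evenPart_oddExt, evenPart_evenExt, evenPart_eq_zero_of_past (past_shift_eq_zero hV (by norm_num)),
    smul_zero, add_zero, zero_add]

lemma oddPart_profile (hV : past 0 V = 0) : oddPart (profile N u₀ u₁ V) = u₁ := by
  rw [profile, oddPart_bounce N (past_profile_arg hV), map_add, map_add, map_smul,
    oddPart_oddExt, oddPart_evenExt, oddPart_eq_zero_of_past (past_shift_eq_zero hV (by norm_num)),
    smul_zero, add_zero, add_zero]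

/-- At `r + 1` with `r > 0` the extensions of the initial data vanish and only the term `2 V(r)`
remains; this is why `V` enters `profile` delayed by one and doubled. -/
lemma profile_boundary_ae (hV : past 0 V = 0) :
    ∀ᵐ r : ℝ, 0 < r → r < 2 * N → (profile N u₀ u₁ V : ℝ → ℝ) (r + 1)
      + (profile N u₀ u₁ V : ℝ → ℝ) (r - 1) = 2 * (V : ℝ → ℝ) r := by
  filter_upwards [bounce_boundary_ae N (past_profile_arg (u₀ := u₀) (u₁ := u₁) hV),
    ae_comp_add (oddExt_ae_eq_zero u₁) 1, ae_comp_add (evenExt_ae_eq_zero u₀.dx) 1,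
    ae_comp_add (shift_ae (-1) V) 1,
    ae_comp_add (Lp.coeFn_add (oddExt u₁ + evenExt u₀.dx) ((2 : ℝ) • shift (-1) V)) 1,
    ae_comp_add (Lp.coeFn_add (oddExt u₁) (evenExt u₀.dx)) 1,
    ae_comp_add (Lp.coeFn_smul (2 : ℝ) (shift (-1) V)) 1]
    with r h1 h2 h3 h4 h5 h6 h7 hr hr'
  have hn : r + 1 ∉ Ioo (-1 : ℝ) 1 := fun h => by linarith [h.2]
  rw [profile, h1 hr', h5, Pi.add_apply, h6, Pi.add_apply, h2 hn, h3 hn, h7, Pi.smul_apply, h4]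
  simp

/-- Because of the delay by one, the profile before `a + 1` involves `V` only before `a`. -/
lemma norm_past_profile_le (a : ℝ) : ‖past (a + 1) (profile N u₀ u₁ V)‖
    ≤ 2 * (N + 1) * (‖u₀‖ + ‖u₁‖ + ‖past a V‖) := by
  refine (norm_past_bounce_le N _ _).trans ?_
  have h1 : ‖past (a + 1) (oddExt u₁)‖ ≤ 2 * ‖u₁‖ := (norm_past_le _ _).trans (norm_oddExt_le _)
  have h2 : ‖past (a + 1) (evenExt u₀.dx)‖ ≤ 2 * ‖u₀‖ :=
    (norm_past_le _ _).trans (norm_evenExt_le _)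
  have h3 : ‖past (a + 1) ((2 : ℝ) • shift (-1) V)‖ = 2 * ‖past a V‖ := by
    rw [map_smul, norm_smul, norm_past_shift, add_neg_cancel_right]
    simp
  have h4 : ‖past (a + 1) (oddExt u₁ + evenExt u₀.dx + (2 : ℝ) • shift (-1) V)‖
      ≤ 2 * (‖u₀‖ + ‖u₁‖ + ‖past a V‖) := by
    rw [map_add, map_add]
    refine (norm_add₃_le).trans ?_
    linarith
  have := mul_le_mul_of_nonneg_left h4 (by positivity : (0 : ℝ) ≤ N + 1)
  linarith

end profile

end LineL2

/-! ### Duhamel's formula for waves with a source -/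

/-- Fubini's theorem on a triangle, for a strongly continuous family of functionals. -/
lemma integral_triangle_swap {X : Type*} [NormedAddCommGroup X] [NormedSpace ℝ X] [CompleteSpace X]
    {κ : ℝ → X} (hκ : Integrable κ) {m : ℝ → X →L[ℝ] ℝ}
    (hm : Continuous fun p : ℝ × X => m p.1 p.2) {C : ℝ} (hC : ∀ r, ‖m r‖ ≤ C) {t : ℝ}
    (ht : 0 ≤ t) :
    IntervalIntegrable (fun s => ∫ r in s..t, m r (κ s)) volume 0 t ∧
    ∫ s in (0 : ℝ)..t, ∫ r in s..t, m r (κ s) = ∫ r in (0 : ℝ)..t, m r (∫ s in (0 : ℝ)..r, κ s) := by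
  set G : ℝ → ℝ → ℝ := fun s r => {p : ℝ × ℝ | p.1 < p.2}.indicator (fun p => m p.2 (κ p.1)) (s, r)
    with hG
  have hmeas : AEStronglyMeasurable (fun p : ℝ × ℝ => m p.2 (κ p.1))
      ((volume.restrict (Ioc 0 t)).prod (volume.restrict (Ioc 0 t))) := by
    have hκ' : AEStronglyMeasurable (fun p : ℝ × ℝ => κ p.1)
        ((volume.restrict (Ioc 0 t)).prod (volume.restrict (Ioc 0 t))) :=
      hκ.1.restrict.comp_fst
    exact hm.comp_aestronglyMeasurable (measurable_snd.aestronglyMeasurable.prodMk hκ')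
  have hdom : Integrable (fun p : ℝ × ℝ => C * ‖κ p.1‖)
      ((volume.restrict (Ioc 0 t)).prod (volume.restrict (Ioc 0 t))) :=
    ((hκ.restrict (s := Ioc 0 t)).norm.comp_fst _).const_mul C
  have hGi : Integrable (Function.uncurry G)
      ((volume.restrict (Ioc 0 t)).prod (volume.restrict (Ioc 0 t))) := by
    refine Integrable.indicator ?_ (measurableSet_lt measurable_fst measurable_snd)
    refine hdom.mono' hmeas (Filter.Eventually.of_forall fun p => ?_)
    exact ((m p.2).le_opNorm _).trans (mul_le_mul_of_nonneg_right (hC _) (norm_nonneg _))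
  have e1 : ∀ s ∈ Ioc 0 t, ∫ r in Ioc 0 t, G s r = ∫ r in s..t, m r (κ s) := by
    intro s hs
    have : (fun r => G s r) = (Ioi s).indicator fun r => m r (κ s) := by
      ext r
      simp [hG, indicator]
    rw [this, setIntegral_indicator measurableSet_Ioi, intervalIntegral.integral_of_le hs.2]
    congr 2
    ext r
    simp only [mem_inter_iff, mem_Ioc, mem_Ioi]
    exact ⟨fun h => ⟨h.2, h.1.2⟩, fun h => ⟨⟨hs.1.trans h.1, h.2⟩, h.1⟩⟩
  have e2 : ∀ r ∈ Ioc 0 t, ∫ s in Ioc 0 t, G s r = m r (∫ s in (0 : ℝ)..r, κ s) := by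
    intro r hr
    have : (fun s => G s r) = (Iio r).indicator fun s => m r (κ s) := by
      ext s
      simp [hG, indicator]
    rw [this, setIntegral_indicator measurableSet_Iio,
      ← ContinuousLinearMap.intervalIntegral_comp_comm _ hκ.intervalIntegrable,
      intervalIntegral.integral_of_le hr.1.le, integral_Ioc_eq_integral_Ioo]
    congr 2
    ext s
    simp only [mem_inter_iff, mem_Ioc, mem_Iio, mem_Ioo]
    exact ⟨fun h => ⟨h.1.1, h.2⟩, fun h => ⟨⟨h.1, h.2.le.trans hr.2⟩, h.2⟩⟩
  constructor
  · rw [intervalIntegrable_iff_integrableOn_Ioc_of_le ht]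
    refine hGi.integral_prod_left.congr ?_
    filter_upwards [ae_restrict_mem measurableSet_Ioc] with s hs
    exact e1 s hs
  · rw [intervalIntegral.integral_of_le ht, intervalIntegral.integral_of_le ht,
      ← setIntegral_congr_fun measurableSet_Ioc e1, ← setIntegral_congr_fun measurableSet_Ioc e2]
    exact integral_integral_swap hGi

namespace LineL2

/-- The profile released at time `s` by the source `F`. -/
def source (N : ℕ) (F : ℝ → L2) (s : ℝ) : LineL2 := shift (-s) (impulse N (F s))

/-- The profile accumulated up to time `t`. -/
def history (N : ℕ) (h₀ : LineL2) (F : ℝ → L2) (t : ℝ) : LineL2 :=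
  h₀ + ∫ s in (0 : ℝ)..t, source N F s

section Duhamel

variable {N : ℕ} {h₀ : LineL2} {F : ℝ → L2}

lemma norm_source_le (s : ℝ) : ‖source N F s‖ ≤ 2 * (N + 1) * ‖F s‖ := by
  rw [source, LinearIsometry.norm_map]
  exact norm_impulse_le N (F s)

lemma aestronglyMeasurable_source {μ : Measure ℝ} (hF : AEStronglyMeasurable F μ) :
    AEStronglyMeasurable (source N F) μ := by
  have h1 : AEStronglyMeasurable (fun s => impulse N (F s)) μ :=
    (impulse N).continuous.comp_aestronglyMeasurable hF
  have h2 : AEStronglyMeasurable (fun s : ℝ => -s) μ := continuous_neg.aestronglyMeasurable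
  have h3 := continuous_shift.comp_aestronglyMeasurable (h2.prodMk h1)
  exact h3

lemma integrable_source (hF : Integrable F) : Integrable (source N F) :=
  (hF.norm.const_mul (2 * (N + 1 : ℝ))).mono' (aestronglyMeasurable_source hF.1)
    (Filter.Eventually.of_forall fun s => norm_source_le s)

lemma continuous_history (hF : Integrable F) : Continuous (history N h₀ F) :=
  continuous_const.add (intervalIntegral.continuous_primitive
    (fun _ _ => (integrable_source hF).intervalIntegrable) 0)

@[simp] lemma history_zero : history N h₀ F 0 = h₀ := by simp [history]

lemma continuous_shift_history (hF : Integrable F) :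
    Continuous fun t => shift t (history N h₀ F t) :=
  continuous_shift.comp (continuous_id.prodMk (continuous_history hF))

lemma norm_past_history_le (hF : Integrable F) {t : ℝ} (ht : 0 ≤ t) (a : ℝ) :
    ‖past a (history N h₀ F t)‖ ≤ ‖past a h₀‖ + 2 * (N + 1) * ∫ s in (0 : ℝ)..t, ‖F s‖ := by
  rw [history, map_add]
  refine (norm_add_le _ _).trans (add_le_add_right ?_ _)
  refine (norm_past_le _ _).trans ((intervalIntegral.norm_integral_le_integral_norm ht).trans ?_)
  rw [← intervalIntegral.integral_const_mul]
  exact intervalIntegral.integral_mono_on ht (integrable_source hF).norm.intervalIntegrable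
    (hF.norm.const_mul _).intervalIntegrable fun s _ => norm_source_le s

@[simp] lemma shift_source (s : ℝ) : shift s (source N F s) = impulse N (F s) := by
  rw [source, shift_shift, add_neg_cancel, shift_zero]

/-- Impulses start at `-1`; translation to the release time `s` moves this to `s - 1`. -/
lemma past_source (s : ℝ) : past (s - 1) (source N F s) = 0 :=
  past_shift_eq_zero (past_impulse N (F s)) (by linarith)

lemma source_boundary_ae (s : ℝ) : ∀ᵐ r : ℝ, s < r → r < s + 2 * N →
    (source N F s : ℝ → ℝ) (r + 1) + (source N F s : ℝ → ℝ) (r - 1) = 0 := by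
  filter_upwards [ae_comp_add (impulse_boundary_ae N (F s)) (-s),
    ae_comp_add (shift_ae (-s) (impulse N (F s))) 1,
    ae_comp_add (shift_ae (-s) (impulse N (F s))) (-1)] with r h1 h2 h3 h4 h5
  have := h1 (by linarith) (by linarith)
  rw [source, h2, sub_eq_add_neg r 1, h3]
  refine Eq.trans ?_ this
  ring_nf

/-- Duhamel's formula in weak form. -/
lemma apply_history_eq (hF : Integrable F) {ℓ : LineL2 →L[ℝ] ℝ} {m : ℝ → LineL2 →L[ℝ] ℝ}
    (hm : Continuous fun p : ℝ × LineL2 => m p.1 p.2) {C : ℝ} (hC : ∀ r, ‖m r‖ ≤ C) {t : ℝ}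
    (ht : 0 ≤ t) {c : ℝ → ℝ} (hc : IntervalIntegrable c volume 0 t)
    (h : ∀ s ∈ Ioc 0 t, ℓ (source N F s) = c s + ∫ r in s..t, m r (source N F s)) :
    ℓ (history N h₀ F t) = ℓ h₀ + (∫ s in (0 : ℝ)..t, c s)
      + ∫ r in (0 : ℝ)..t, (m r (history N h₀ F r) - m r h₀) := by
  -- On the triangle `s < r < t`, integrating over the release time `s` first produces at each `r`
  -- the profiles released up to `r`, that is, the history minus `h₀`.
  obtain ⟨i, e⟩ := integral_triangle_swap (integrable_source (N := N) hF) hm hC ht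
  rw [history, map_add,
    ← ContinuousLinearMap.intervalIntegral_comp_comm _ (integrable_source hF).intervalIntegrable,
    intervalIntegral.integral_congr_ae (g := fun s => c s + ∫ r in s..t, m r (source N F s)),
    intervalIntegral.integral_add hc i, e, add_assoc]
  · simp only [history, map_add, add_sub_cancel_left]
  · refine Filter.Eventually.of_forall fun s hs => h s ?_
    rwa [uIoc_of_le ht] at hs

/-- The displacement at time `t`. -/
def displacement (N : ℕ) (h₀ : LineL2) (F : ℝ → L2) (t : ℝ) : H1Zero :=
  wave (shift t (history N h₀ F t))

/-- The velocity at time `t`. -/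
def velocity (N : ℕ) (h₀ : LineL2) (F : ℝ → L2) (t : ℝ) : L2 :=
  oddPart (shift t (history N h₀ F t))

/-- `wave` as a continuous linear map. -/
def waveL : LineL2 →L[ℝ] H1Zero :=
  H1Zero.dxEquiv.symm.toContinuousLinearEquiv.toContinuousLinearMap ∘L evenPart

@[simp] lemma waveL_apply (h : LineL2) : waveL h = wave h := rfl

lemma continuous_displacement (hF : Integrable F) : Continuous (displacement N h₀ F) :=
  waveL.continuous.comp (continuous_shift_history hF)

lemma continuous_velocity (hF : Integrable F) : Continuous (velocity N h₀ F) :=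
  oddPart.continuous.comp (continuous_shift_history hF)

lemma norm_displacement_le (t : ℝ) :
    ‖displacement N h₀ F t‖ ≤ ‖past (t + 1) (history N h₀ F t)‖ := by
  rw [displacement, norm_wave]
  exact norm_evenPart_shift_le _ _

lemma norm_velocity_le (t : ℝ) : ‖velocity N h₀ F t‖ ≤ ‖past (t + 1) (history N h₀ F t)‖ :=
  norm_oddPart_shift_le _ _

/-- `h ↦ ⟨P (h(· + r)), w⟩`. -/
def testShift (P : LineL2 →L[ℝ] L2) (w : L2) (r : ℝ) : LineL2 →L[ℝ] ℝ :=
  innerSL ℝ w ∘L P ∘L (shift r).toContinuousLinearMap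

lemma testShift_apply (P : LineL2 →L[ℝ] L2) (w : L2) (r : ℝ) (h : LineL2) :
    testShift P w r h = inner ℝ (P (shift r h)) w := by
  rw [real_inner_comm]; rfl

lemma continuous_testShift (P : LineL2 →L[ℝ] L2) (w : L2) :
    Continuous fun p : ℝ × LineL2 => testShift P w p.1 p.2 :=
  (innerSL ℝ w ∘L P).continuous.comp continuous_shift

lemma norm_testShift_le (P : LineL2 →L[ℝ] L2) (w : L2) (r : ℝ) :
    ‖testShift P w r‖ ≤ ‖innerSL ℝ w ∘L P‖ := by
  refine ContinuousLinearMap.opNorm_le_bound _ (norm_nonneg _) fun h => ?_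
  refine ((innerSL ℝ w ∘L P).le_opNorm (shift r h)).trans ?_
  rw [LinearIsometry.norm_map]

lemma intervalIntegrable_testShift (P : LineL2 →L[ℝ] L2) (w : L2) {k : ℝ → LineL2}
    (hk : Continuous k) (a b : ℝ) :
    IntervalIntegrable (fun r => testShift P w r (k r)) volume a b :=
  ((continuous_testShift P w).comp (continuous_id.prodMk hk)).intervalIntegrable _ _

/-- Duhamel's formula with the velocity as rate of change. A profile has zero displacement when it
is released, hence `c = 0`. -/
lemma inner_displacement (hF : Integrable F) (w : L2) {t : ℝ} (ht : 0 ≤ t) :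
    inner ℝ (displacement N h₀ F t).toL2 w
      = inner ℝ (wave h₀).toL2 w + ∫ r in (0 : ℝ)..t, inner ℝ (velocity N h₀ F r) w := by
  have h := apply_history_eq (h₀ := h₀) hF
    (ℓ := testShift (H1Zero.toL2L ∘L waveL) w t) (continuous_testShift oddPart w)
    (norm_testShift_le oddPart w) ht (c := fun _ => 0) (by simp) (by
      intro s hs
      have := inner_wave_sub (source N F s) w hs.2
      rw [shift_source, show wave (impulse N (F s)) = 0 by
        apply H1Zero.dx_injective; rw [dx_wave, evenPart_impulse, map_zero]] at this
      simp only [map_zero, inner_zero_left, sub_zero] at this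
      simp only [testShift_apply, zero_add]
      exact this)
  have h' := inner_wave_sub h₀ w ht
  rw [intervalIntegral.integral_sub
    (intervalIntegrable_testShift _ _ (continuous_history hF) _ _)
    (intervalIntegrable_testShift _ _ continuous_const _ _)] at h
  simp only [testShift_apply, intervalIntegral.integral_zero, add_zero] at h
  rw [shift_zero] at h'
  simp only [displacement, velocity]
  change inner ℝ (wave (shift t (history N h₀ F t))).toL2 w = inner ℝ (wave (shift t h₀)).toL2 w + _ at h
  linarith

/-- The derivative of the displacement is the velocity. -/
lemma toL2_displacement (hF : Integrable F) {t : ℝ} (ht : 0 ≤ t) :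
    (displacement N h₀ F t).toL2 = (wave h₀).toL2 + ∫ r in (0 : ℝ)..t, velocity N h₀ F r := by
  refine ext_inner_right ℝ fun w => ?_
  rw [inner_displacement hF w ht, inner_add_left, real_inner_comm w (∫ r in (0 : ℝ)..t, _),
    ← innerSL_apply_apply ℝ w, ← ContinuousLinearMap.intervalIntegral_comp_comm _
      ((continuous_velocity hF).intervalIntegrable _ _)]
  simp only [innerSL_apply_apply, real_inner_comm]

/-- Duhamel's formula again: a profile released at `s` has velocity `F(s)` at that time, which gives
the force term. Released profiles satisfy the homogeneous condition at `1`, so the boundary term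
comes from `h₀` alone. -/
lemma inner_velocity (hF : Integrable F) (z : H1Zero) {t : ℝ} (ht : 0 ≤ t) (htN : t ≤ 2 * N)
    {V : ℝ → ℝ} (hV : ∀ᵐ r : ℝ, 0 < r → r < 2 * N →
      (h₀ : ℝ → ℝ) (r + 1) + (h₀ : ℝ → ℝ) (r - 1) = 2 * V r) :
    inner ℝ (velocity N h₀ F t) z.toL2
      = inner ℝ (oddPart h₀) z.toL2 + (∫ r in (0 : ℝ)..t, V r) * z.rep 1
        - (∫ r in (0 : ℝ)..t, inner ℝ (displacement N h₀ F r).dx z.dx)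
        + ∫ r in (0 : ℝ)..t, inner ℝ (F r) z.toL2 := by
  have hc : Integrable (fun r => inner ℝ (F r) z.toL2) := hF.inner_const _
  have h := apply_history_eq (h₀ := h₀) hF
    (ℓ := testShift oddPart z.toL2 t) (continuous_testShift (-evenPart) z.dx)
    (norm_testShift_le (-evenPart) z.dx) ht (c := fun r => inner ℝ (F r) z.toL2)
    hc.intervalIntegrable (by
      intro s hs
      have := inner_oddPart_sub (source N F s) z hs.2
      have hb : ∫ r in s..t, ((source N F s : ℝ → ℝ) (r + 1) + (source N F s : ℝ → ℝ) (r - 1)) / 2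
          = 0 := by
        refine intervalIntegral.integral_zero_ae ?_
        have h1 : ∀ᵐ r : ℝ, r ≠ t := by simp [ae_iff, measure_singleton]
        filter_upwards [source_boundary_ae (N := N) (F := F) s, h1] with r hr hr1 hr'
        rw [uIoc_of_le hs.2] at hr'
        rw [hr hr'.1 (lt_of_lt_of_le (lt_of_le_of_ne hr'.2 hr1) (by linarith [hs.1])), zero_div]
      rw [shift_source, oddPart_impulse, hb, zero_mul] at this
      simp only [testShift_apply, neg_apply, inner_neg_left,
        intervalIntegral.integral_neg]
      linarith)
  have h' := inner_oddPart_sub h₀ z ht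
  have hb : ∫ r in (0 : ℝ)..t, ((h₀ : ℝ → ℝ) (r + 1) + (h₀ : ℝ → ℝ) (r - 1)) / 2
      = ∫ r in (0 : ℝ)..t, V r := by
    refine intervalIntegral.integral_congr_ae ?_
    have h1 : ∀ᵐ r : ℝ, r ≠ t := by simp [ae_iff, measure_singleton]
    filter_upwards [hV, h1] with r hr hr1 hr'
    rw [uIoc_of_le ht] at hr'
    rw [hr hr'.1 (lt_of_lt_of_le (lt_of_le_of_ne hr'.2 hr1) htN)]
    ring
  rw [hb, shift_zero] at h'
  rw [intervalIntegral.integral_sub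
    (intervalIntegrable_testShift _ _ (continuous_history hF) _ _)
    (intervalIntegrable_testShift _ _ continuous_const _ _)] at h
  simp only [testShift_apply, neg_apply, inner_neg_left,
    intervalIntegral.integral_neg] at h
  simp only [displacement, velocity, dx_wave]
  linarith

/-- Integration of `h(· - 1)` over `(0, t)`. -/
def delayedIntegral (t : ℝ) : LineL2 →L[ℝ] ℝ :=
  innerSL ℝ (indicatorConstLp 2 (measurableSet_Ioc (a := 0) (b := t)) (by simp) (1 : ℝ)) ∘L
    (shift (-1)).toContinuousLinearMap

/-- The history is a Bochner integral in `L²(ℝ)`; the integral of its values is expressed through a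
continuous functional so that it commutes with that integral. -/
lemma delayedIntegral_apply {t : ℝ} (ht : 0 ≤ t) (h : LineL2) :
    delayedIntegral t h = ∫ r in (0 : ℝ)..t, (h : ℝ → ℝ) (r - 1) := by
  change inner ℝ (indicatorConstLp 2 _ _ (1 : ℝ)) (shift (-1) h) = _
  rw [L2.inner_indicatorConstLp_one, intervalIntegral.integral_of_le ht]
  refine integral_congr_ae ?_
  filter_upwards [ae_restrict_of_ae (shift_ae (-1) h)] with r hr
  rw [hr, sub_eq_add_neg]

lemma delayedIntegral_eq_zero {t : ℝ} (ht : 0 ≤ t) {h : LineL2} (hh : past (t - 1) h = 0) :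
    delayedIntegral t h = 0 := by
  rw [delayedIntegral_apply ht]
  refine intervalIntegral.integral_zero_ae ?_
  have h1 : ∀ᵐ r : ℝ, r ≠ t := by simp [ae_iff, measure_singleton]
  filter_upwards [ae_comp_add (past_eq_zero_iff.1 hh) (-1), h1] with r hr hr1 hr'
  rw [uIoc_of_le ht] at hr'
  exact hr (by linarith [lt_of_le_of_ne hr'.2 hr1])

/-- Profiles released after time `t` vanish on `(-∞, t - 1)`. -/
lemma past_history_sub (hF : Integrable F) {t T : ℝ} (htT : t ≤ T) :
    past (t - 1) (history N h₀ F T - history N h₀ F t) = 0 := by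
  rw [history, history, add_sub_add_left_eq_sub,
    intervalIntegral.integral_interval_sub_left (integrable_source hF).intervalIntegrable
      (integrable_source hF).intervalIntegrable,
    ← ContinuousLinearMap.intervalIntegral_comp_comm _ (integrable_source hF).intervalIntegrable]
  refine intervalIntegral.integral_zero_ae (Filter.Eventually.of_forall fun s hs => ?_)
  rw [uIoc_of_le htT] at hs
  have := norm_past_mono (by linarith [hs.1] : t - 1 ≤ s - 1) (source N F s)
  rw [past_source, norm_zero] at this
  exact norm_le_zero_iff.1 this

/-- The trace at `1` of the displacement. -/
lemma rep_one_displacement (hF : Integrable F) {t T : ℝ} (ht : 0 ≤ t) (htT : t ≤ T)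
    (htN : t ≤ 2 * N) {V : ℝ → ℝ} (hV : ∀ᵐ r : ℝ, 0 < r → r < 2 * N →
      (h₀ : ℝ → ℝ) (r + 1) + (h₀ : ℝ → ℝ) (r - 1) = 2 * V r) :
    (displacement N h₀ F t).rep 1 = (wave h₀).rep 1
      + ∫ r in (0 : ℝ)..t, (V r - (history N h₀ F T : ℝ → ℝ) (r - 1)) := by
  have m2 (h : LineL2) (s t : ℝ) : IntervalIntegrable (fun r => (h : ℝ → ℝ) (r - 1)) volume s t := by
    simpa using (h.intervalIntegrable (s - 1) (t - 1)).comp_sub_right 1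
  have m1 (h : LineL2) (s t : ℝ) : IntervalIntegrable (fun r => (h : ℝ → ℝ) (r + 1)) volume s t := by
    simpa using (h.intervalIntegrable (s + 1) (t + 1)).comp_add_right 1
  set ℓ : LineL2 →L[ℝ] ℝ := H1Zero.evalOne ∘L waveL ∘L (shift t).toContinuousLinearMap with hℓ
  have hℓa (h : LineL2) : ℓ h = (wave (shift t h)).rep 1 := rfl
  have h1 : ∀ᵐ r : ℝ, r ≠ t := by simp [ae_iff, measure_singleton]
  -- After release, the trace changes at rate `(h(r + 1) - h(r - 1)) / 2`, which equals `-h(r - 1)`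
  -- by the homogeneous boundary condition; before release, `h(r - 1)` vanishes.
  have hs : ∀ s ∈ Ioc 0 t, ℓ (source N F s) = -delayedIntegral t (source N F s) := by
    intro s hs
    have a := rep_one_wave_sub (source N F s) s t
    rw [shift_source, show wave (impulse N (F s)) = 0 by
        apply H1Zero.dx_injective; rw [dx_wave, evenPart_impulse, map_zero]] at a
    rw [← H1Zero.evalOne_apply 0, map_zero, sub_zero] at a
    rw [hℓa, a, delayedIntegral_apply ht,
      ← intervalIntegral.integral_add_adjacent_intervals (m2 _ 0 s) (m2 _ s t)]
    have z : ∫ r in (0 : ℝ)..s, (source N F s : ℝ → ℝ) (r - 1) = 0 := by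
      rw [← delayedIntegral_apply hs.1.le]
      exact delayedIntegral_eq_zero hs.1.le (past_source s)
    rw [z, zero_add, ← intervalIntegral.integral_neg]
    refine intervalIntegral.integral_congr_ae ?_
    filter_upwards [source_boundary_ae (N := N) (F := F) s, h1] with r hr hr1 hr'
    rw [uIoc_of_le hs.2] at hr'
    have := hr hr'.1 (lt_of_lt_of_le (lt_of_le_of_ne hr'.2 hr1) (by linarith [hs.1]))
    linarith
  have hintegral : ℓ (∫ s in (0 : ℝ)..t, source N F s)
      = -delayedIntegral t (∫ s in (0 : ℝ)..t, source N F s) := by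
    rw [← ContinuousLinearMap.intervalIntegral_comp_comm _ (integrable_source hF).intervalIntegrable,
      ← ContinuousLinearMap.intervalIntegral_comp_comm _ (integrable_source hF).intervalIntegrable,
      ← intervalIntegral.integral_neg]
    refine intervalIntegral.integral_congr_ae (Filter.Eventually.of_forall fun s hs' => hs s ?_)
    rwa [uIoc_of_le ht] at hs'
  -- Profiles released after `t` do not reach `(-∞, t - 1)`. The history at the final time `T` can
  -- thus replace the one at `t`, and the same integrand serves for all `t`.
  have hT : delayedIntegral t (history N h₀ F T) = delayedIntegral t (history N h₀ F t) := by
    rw [← sub_eq_zero, ← map_sub]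
    exact delayedIntegral_eq_zero ht (past_history_sub hF htT)
  have hVe : ∀ᵐ r : ℝ, r ∈ uIoc 0 t →
      V r = ((h₀ : ℝ → ℝ) (r + 1) + (h₀ : ℝ → ℝ) (r - 1)) / 2 := by
    filter_upwards [hV, h1] with r hr hr1 hr'
    rw [uIoc_of_le ht] at hr'
    linarith [hr hr'.1 (lt_of_lt_of_le (lt_of_le_of_ne hr'.2 hr1) htN)]
  have e : ∫ r in (0 : ℝ)..t, (V r - (history N h₀ F T : ℝ → ℝ) (r - 1))
      = (∫ r in (0 : ℝ)..t, ((h₀ : ℝ → ℝ) (r + 1) + (h₀ : ℝ → ℝ) (r - 1)) / 2)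
        - delayedIntegral t (history N h₀ F T) := by
    rw [delayedIntegral_apply ht, ← intervalIntegral.integral_sub
      (((m1 _ _ _).add (m2 _ _ _)).div_const 2) (m2 _ _ _)]
    refine intervalIntegral.integral_congr_ae ?_
    filter_upwards [hVe] with r hr hr'
    rw [hr hr']
  have a := rep_one_wave_sub h₀ 0 t
  rw [shift_zero] at a
  have b : ∫ r in (0 : ℝ)..t, ((h₀ : ℝ → ℝ) (r + 1) - (h₀ : ℝ → ℝ) (r - 1)) / 2
      = (∫ r in (0 : ℝ)..t, ((h₀ : ℝ → ℝ) (r + 1) + (h₀ : ℝ → ℝ) (r - 1)) / 2)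
        - delayedIntegral t h₀ := by
    rw [delayedIntegral_apply ht, ← intervalIntegral.integral_sub
      (((m1 _ _ _).add (m2 _ _ _)).div_const 2) (m2 _ _ _)]
    refine intervalIntegral.integral_congr fun r _ => ?_
    ring
  rw [e, hT, displacement, ← hℓa, history, map_add, map_add, hintegral, hℓa]
  linarith

end Duhamel

end LineL2

/-! ### The potential as a measurable family of multiplication operators -/

/-- By the Lindelöf property every open set is a countable union of balls. It reduces measurability
of an `L²`-valued function of time to that of scalar parameter integrals. -/
lemma measurable_of_measurable_dist {α X : Type*} [MeasurableSpace α] [PseudoMetricSpace X]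
    [SecondCountableTopology X] [MeasurableSpace X] [BorelSpace X] {f : α → X}
    (h : ∀ x, Measurable fun a => dist (f a) x) : Measurable f := by
  refine measurable_of_isOpen fun U hU => ?_
  choose! ε hε hεU using fun x (hx : x ∈ U) => Metric.isOpen_iff.1 hU x hx
  obtain ⟨S, hS, hSU⟩ := TopologicalSpace.isOpen_iUnion_countable
    (fun x : U => Metric.ball (x : X) (ε x)) fun _ => Metric.isOpen_ball
  have e : U = ⋃ x ∈ S, Metric.ball (x : X) (ε x) := by
    rw [hSU]
    refine subset_antisymm (fun x hx => ?_)
      (iUnion_subset fun x => hεU x x.2)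
    exact mem_iUnion.2 ⟨(⟨x, hx⟩ : U), Metric.mem_ball_self (hε x hx)⟩
  rw [e, preimage_iUnion₂]
  refine MeasurableSet.biUnion hS fun x _ => ?_
  exact measurableSet_lt (h x) measurable_const

/-- Multiplication by the potential, at each time. -/
lemma exists_potential_operator {T : ℝ} {A : ℝ × ℝ → ℝ}
    (hA : MemLp A ⊤ (volume.restrict (cylinder T))) :
    ∃ M : ℝ → L2 →L[ℝ] L2, (∀ t u, ‖M t u‖ ≤ supNorm T A * ‖u‖) ∧
      (∀ y : ℝ → L2, AEStronglyMeasurable y (leb 0 T) →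
        AEStronglyMeasurable (fun t => M t (y t)) (leb 0 T)) ∧
      ∀ᵐ t ∂(leb 0 T), ∀ u z : L2,
        ∫ x in Ioo (0 : ℝ) 1, A (x, t) * (u : ℝ → ℝ) x * (z : ℝ → ℝ) x = inner ℝ (M t u) z := by
  set a : ℝ := supNorm T A with ha
  have ha0 : 0 ≤ a := ENNReal.toReal_nonneg
  obtain ⟨A', hA'm, hA'⟩ := hA.1
  -- A Borel representative truncated at `±a` is bounded everywhere, so the operator is defined and
  -- bounded by `a` at every time, not only almost every time.
  set Ab : ℝ × ℝ → ℝ := fun p => max (-a) (min a (A' p)) with hAb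
  have hAbm : StronglyMeasurable Ab :=
    stronglyMeasurable_const.sup (stronglyMeasurable_const.inf hA'm)
  have hAbb (p : ℝ × ℝ) : ‖Ab p‖ ≤ a := by
    rw [Real.norm_eq_abs, abs_le]
    exact ⟨le_max_left _ _, max_le (by linarith) (min_le_left _ _)⟩
  have hae : A =ᵐ[volume.restrict (cylinder T)] Ab := by
    have hb : ∀ᵐ p ∂(volume.restrict (cylinder T)), ‖A p‖ ≤ a := by
      have := ae_le_eLpNormEssSup (f := A) (μ := volume.restrict (cylinder T))
      filter_upwards [this] with p hp
      rw [← eLpNorm_exponent_top] at hp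
      have := ENNReal.toReal_mono hA.2.ne hp
      rwa [toReal_enorm] at this
    filter_upwards [hA', hb] with p h1 h2
    rw [hAb]
    simp only
    rw [← h1]
    rw [Real.norm_eq_abs, abs_le] at h2
    rw [min_eq_right h2.2, max_eq_right h2.1]
  have hsec (t : ℝ) : StronglyMeasurable fun x => Ab (x, t) :=
    hAbm.comp_measurable measurable_prodMk_right
  have hmem (t : ℝ) (u : L2) : MemLp (fun x => Ab (x, t) * (u : ℝ → ℝ) x) 2 (leb 0 1) := by
    refine (Lp.memLp u).of_le_mul (c := a)
      ((hsec t).mul (Lp.stronglyMeasurable u)).aestronglyMeasurable ?_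
    refine Filter.Eventually.of_forall fun x => ?_
    rw [norm_mul]
    exact mul_le_mul_of_nonneg_right (hAbb _) (norm_nonneg _)
  let L (t : ℝ) : L2 →ₗ[ℝ] L2 :=
    { toFun := fun u => (hmem t u).toLp _
      map_add' := fun u w => by
        refine Lp.ext ?_
        filter_upwards [(hmem t (u + w)).coeFn_toLp, (hmem t u).coeFn_toLp, (hmem t w).coeFn_toLp,
          Lp.coeFn_add u w, Lp.coeFn_add ((hmem t u).toLp _) ((hmem t w).toLp _)]
          with x h1 h2 h3 h4 h5
        rw [h1, h5, h4, Pi.add_apply, Pi.add_apply, h2, h3, mul_add]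
      map_smul' := fun c u => by
        refine Lp.ext ?_
        filter_upwards [(hmem t (c • u)).coeFn_toLp, (hmem t u).coeFn_toLp,
          Lp.coeFn_smul c u, Lp.coeFn_smul c ((hmem t u).toLp _)] with x h1 h2 h4 h5
        rw [h1, RingHom.id_apply, h5, h4, Pi.smul_apply, Pi.smul_apply, h2, smul_eq_mul, smul_eq_mul]
        ring }
  have hL (t : ℝ) (u : L2) : ‖L t u‖ ≤ a * ‖u‖ := by
    refine Lp.norm_le_mul_norm_of_ae_le_mul ?_
    filter_upwards [(hmem t u).coeFn_toLp] with x hx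
    change ‖((hmem t u).toLp _ : ℝ → ℝ) x‖ ≤ _
    rw [hx, norm_mul]
    exact mul_le_mul_of_nonneg_right (hAbb _) (norm_nonneg _)
  have hLae (t : ℝ) (u : L2) : (L t u : ℝ → ℝ) =ᵐ[leb 0 1] fun x => Ab (x, t) * (u : ℝ → ℝ) x :=
    (hmem t u).coeFn_toLp
  let M (t : ℝ) : L2 →L[ℝ] L2 := LinearMap.mkContinuous (L t) a (hL t)
  have hML (t : ℝ) (u : L2) : M t u = L t u := rfl
  refine ⟨M, hL, ?_, ?_⟩
  · have : Fact ((2 : ℝ≥0∞) ≠ ⊤) := ⟨by norm_num⟩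
    borelize L2
    have hMm (u : L2) : StronglyMeasurable fun t => M t u := by
      refine (measurable_of_measurable_dist fun w => ?_).stronglyMeasurable
      have e (t : ℝ) : dist (M t u) w
          = √(∫ x, (Ab (x, t) * (u : ℝ → ℝ) x - (w : ℝ → ℝ) x) ^ 2 ∂(leb 0 1)) := by
        rw [dist_eq_norm, ← Real.sqrt_sq (norm_nonneg _), ← real_inner_self_eq_norm_sq, inner_L2]
        congr 1
        refine integral_congr_ae ?_
        filter_upwards [Lp.coeFn_sub (M t u) w, hLae t u] with x h1 h2
        rw [h1, Pi.sub_apply, hML, h2, sq]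
      simp_rw [e]
      refine Real.continuous_sqrt.measurable.comp (StronglyMeasurable.measurable ?_)
      refine StronglyMeasurable.integral_prod_left (f := fun x t =>
        (Ab (x, t) * (u : ℝ → ℝ) x - (w : ℝ → ℝ) x) ^ 2) ?_
      refine StronglyMeasurable.pow (((hAbm.comp_measurable measurable_id).mul ?_).sub ?_) 2
      · exact (Lp.stronglyMeasurable u).comp_measurable measurable_fst
      · exact (Lp.stronglyMeasurable w).comp_measurable measurable_fst
    -- Continuous in `u` and measurable in `t`, hence jointly measurable; composition with a
    -- measurable curve is then measurable.
    have hun : StronglyMeasurable (Function.uncurry fun (u : L2) (t : ℝ) => M t u) :=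
      stronglyMeasurable_uncurry_of_continuous_of_stronglyMeasurable
        (fun t => (M t).continuous) hMm
    intro y hy
    refine ⟨fun t => M t (hy.mk y t), ?_, ?_⟩
    · exact hun.comp_measurable (hy.stronglyMeasurable_mk.measurable.prodMk measurable_id)
    · filter_upwards [hy.ae_eq_mk] with t ht
      rw [ht]
  · have h1 : ∀ᵐ p ∂((leb 0 1).prod (leb 0 T)), A p = Ab p := by
      rw [Measure.prod_restrict]
      exact hae
    have h2 : ∀ᵐ t ∂(leb 0 T), ∀ᵐ x ∂(leb 0 1), A (x, t) = Ab (x, t) :=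
      Measure.ae_ae_of_ae_prod (p := fun q : ℝ × ℝ => A (q.2, q.1) = Ab (q.2, q.1))
        (Measure.measurePreserving_swap.quasiMeasurePreserving.ae h1)
    filter_upwards [h2] with t ht u z
    rw [inner_L2]
    refine integral_congr_ae ?_
    filter_upwards [ht, hLae t u] with x hx hx'
    rw [hML, hx', hx]

/-! ### Solving for the source, and the bound with a square root in the exponent -/

lemma integral_exp_mul_le {c : ℝ} (hc : 0 < c) (t : ℝ) :
    ∫ s in (0 : ℝ)..t, Real.exp (c * s) ≤ Real.exp (c * t) / c := by
  rw [intervalIntegral.integral_comp_mul_left (fun s => Real.exp s) hc.ne', integral_exp,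
    smul_eq_mul, mul_zero, Real.exp_zero, inv_mul_eq_div]
  gcongr
  linarith

/-- A Gronwall inequality of second order. -/
lemma le_exp_of_le_double_integral {n : ℝ → ℝ} {τ D κ c : ℝ} (hn : Continuous n)
    (hD : 0 ≤ D) (hκ : 0 ≤ κ) (hc : 0 < c) (hκc : 2 * κ ≤ c ^ 2)
    (h : ∀ t ∈ Icc 0 τ, n t ≤ D + κ * ∫ s in (0 : ℝ)..t, ∫ r in (0 : ℝ)..s, n r) :
    ∀ t ∈ Icc 0 τ, n t ≤ 2 * D * Real.exp (c * t) := by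
  intro t ht
  -- Let `m` be the maximum of `e^{-ct} n(t)`. In the hypothesis each time integral of `m e^{cr}`
  -- gains a factor `1 / c`, and `2κ ≤ c²` leaves `m ≤ D + m / 2`.
  obtain ⟨t₀, ht₀, hmax⟩ := isCompact_Icc.exists_isMaxOn (nonempty_of_mem ht)
    (f := fun t => Real.exp (-(c * t)) * n t) (by fun_prop)
  set m := Real.exp (-(c * t₀)) * n t₀ with hm
  have hnm : ∀ r ∈ Icc 0 τ, n r ≤ m * Real.exp (c * r) := by
    intro r hr
    have : Real.exp (-(c * r)) * n r ≤ m := hmax hr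
    calc n r = Real.exp (-(c * r)) * n r * Real.exp (c * r) := by
          rw [mul_right_comm, ← Real.exp_add]; simp
      _ ≤ m * Real.exp (c * r) := by gcongr
  rcases le_or_gt m 0 with hm0 | hm0
  · refine (hnm t ht).trans ?_
    have := mul_nonneg (mul_nonneg zero_le_two hD) (Real.exp_pos (c * t)).le
    exact (mul_nonpos_of_nonpos_of_nonneg hm0 (Real.exp_pos _).le).trans this
  have i1 : ∀ s ∈ Icc 0 τ, ∫ r in (0 : ℝ)..s, n r ≤ m * (Real.exp (c * s) / c) := by
    intro s hs
    calc ∫ r in (0 : ℝ)..s, n r ≤ ∫ r in (0 : ℝ)..s, m * Real.exp (c * r) := by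
          refine intervalIntegral.integral_mono_on hs.1 (hn.intervalIntegrable _ _)
            (Continuous.intervalIntegrable (by fun_prop) _ _) fun r hr =>
              hnm r ⟨hr.1, hr.2.trans hs.2⟩
      _ ≤ m * (Real.exp (c * s) / c) := by
          rw [intervalIntegral.integral_const_mul]
          exact mul_le_mul_of_nonneg_left (integral_exp_mul_le hc s) hm0.le
  have i2 : ∫ s in (0 : ℝ)..t₀, ∫ r in (0 : ℝ)..s, n r ≤ m / c * (Real.exp (c * t₀) / c) := by
    calc ∫ s in (0 : ℝ)..t₀, ∫ r in (0 : ℝ)..s, n r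
        ≤ ∫ s in (0 : ℝ)..t₀, m / c * Real.exp (c * s) := by
          refine intervalIntegral.integral_mono_on ht₀.1 (Continuous.intervalIntegrable
            (intervalIntegral.continuous_primitive (fun a b => hn.intervalIntegrable a b) 0) _ _)
            (Continuous.intervalIntegrable (by fun_prop) _ _) fun r hr => ?_
          refine (i1 r ⟨hr.1, hr.2.trans ht₀.2⟩).trans (le_of_eq (by ring))
      _ ≤ m / c * (Real.exp (c * t₀) / c) := by
          rw [intervalIntegral.integral_const_mul]
          exact mul_le_mul_of_nonneg_left (integral_exp_mul_le hc t₀) (by positivity)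
  have hfin : m ≤ D + m / 2 := by
    have e1 : n t₀ ≤ D + m / 2 * Real.exp (c * t₀) := by
      refine (h t₀ ht₀).trans (add_le_add_right ?_ _)
      refine (mul_le_mul_of_nonneg_left i2 hκ).trans ?_
      have : κ * (m / c * (Real.exp (c * t₀) / c)) = κ / c ^ 2 * (m * Real.exp (c * t₀)) := by
        field_simp
      rw [this, show m / 2 * Real.exp (c * t₀) = 1 / 2 * (m * Real.exp (c * t₀)) by ring]
      refine mul_le_mul_of_nonneg_right ?_ (by positivity)
      rw [div_le_iff₀ (by positivity)]
      linarith
    have hle : Real.exp (-(c * t₀)) ≤ 1 := Real.exp_le_one_iff.2 (by nlinarith [ht₀.1])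
    calc m ≤ Real.exp (-(c * t₀)) * (D + m / 2 * Real.exp (c * t₀)) := by
          rw [hm]; gcongr
      _ = Real.exp (-(c * t₀)) * D + m / 2 * (Real.exp (-(c * t₀)) * Real.exp (c * t₀)) := by ring
      _ = Real.exp (-(c * t₀)) * D + m / 2 := by rw [← Real.exp_add]; simp
      _ ≤ 1 * D + m / 2 := by gcongr
      _ = D + m / 2 := by ring
  refine (hnm t ht).trans ?_
  gcongr
  linarith

namespace LineL2

variable {N : ℕ} {h₀ : LineL2}

lemma displacement_sub (F G : ℝ → L2) (hF : Integrable F) (hG : Integrable G) (t : ℝ) :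
    displacement N h₀ F t - displacement N h₀ G t = displacement N 0 (F - G) t := by
  have e : history N h₀ F t - history N h₀ G t = history N 0 (F - G) t := by
    simp only [history, add_sub_add_left_eq_sub, zero_add]
    rw [← intervalIntegral.integral_sub (integrable_source hF).intervalIntegrable
      (integrable_source hG).intervalIntegrable]
    refine intervalIntegral.integral_congr fun s _ => ?_
    simp only [source, Pi.sub_apply, map_sub]
  simp only [displacement, ← waveL_apply]
  rw [← map_sub, ← map_sub, e]

/-- The source with potential: a fixed point of a Volterra equation. -/
lemma exists_source_fixed_point {T a : ℝ} (hT : 0 < T) (ha : 0 ≤ a) {M : ℝ → L2 →L[ℝ] L2}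
    (hM : ∀ t u, ‖M t u‖ ≤ a * ‖u‖)
    (hMm : ∀ y : ℝ → L2, AEStronglyMeasurable y (leb 0 T) →
        AEStronglyMeasurable (fun t => M t (y t)) (leb 0 T))
    {B : ℝ → L2} (hB : Integrable B (leb 0 T)) :
    ∃ F : ℝ → L2, Integrable F ∧
      ∀ s ∈ Ioo 0 T, F s = B s - M s (displacement N h₀ F s).toL2 := by
  set κ : ℝ := 2 * (N + 1) * a with hκ
  have hκ0 : 0 ≤ κ := by positivity
  -- In the norm weighted by `e^{-cs}` the Volterra map has Lipschitz constant at most `κ / c ≤ 1 /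
  -- 2`.
  set c : ℝ := 2 * κ + 1 with hc
  have hc0 : 0 < c := by positivity
  -- The unknown `f` is the candidate displacement in `L²` times `e^{-cs}`; `Y f` removes the
  -- weight.
  let Y (f : C(Icc 0 T, L2)) (s : ℝ) : L2 := Real.exp (c * s) • IccExtend hT.le f s
  have hYc (f : C(Icc 0 T, L2)) : Continuous (Y f) := by
    have : Continuous (IccExtend hT.le f) := f.continuous.Icc_extend'
    have h2 : Continuous fun s : ℝ => Real.exp (c * s) := by fun_prop
    exact h2.smul this
  let F (f : C(Icc 0 T, L2)) : ℝ → L2 := (Ioo 0 T).indicator fun s => B s - M s (Y f s)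
  have hF (f : C(Icc 0 T, L2)) : Integrable (F f) := by
    rw [integrable_indicator_iff measurableSet_Ioo]
    refine hB.sub ?_
    have hi : Integrable (fun s => a * ‖Y f s‖) (leb 0 T) :=
      integrable_of_continuousOn (by have := (hYc f).norm; fun_prop)
    exact hi.mono' (hMm _ (hYc f).aestronglyMeasurable) (Filter.Eventually.of_forall fun s => hM s _)
  let Φ (f : C(Icc 0 T, L2)) : C(Icc 0 T, L2) :=
    ⟨fun t => Real.exp (-(c * t)) • (displacement N h₀ (F f) t).toL2, by
      have h1 : Continuous fun t : ℝ => H1Zero.toL2L (displacement N h₀ (F f) t) :=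
        H1Zero.toL2L.continuous.comp (continuous_displacement (hF f))
      have h2 : Continuous fun t : ℝ => Real.exp (-(c * t)) := by fun_prop
      exact (h2.smul h1).comp continuous_subtype_val⟩
  have hΦ : ContractingWith (1 / 2) Φ := by
    refine ⟨by norm_num, LipschitzWith.of_dist_le_mul fun f g => ?_⟩
    rw [ContinuousMap.dist_le (by positivity)]
    intro t
    set d := dist f g with hd
    have hbound (s : ℝ) : ‖(F f - F g) s‖ ≤ a * d * Real.exp (c * s) := by
      by_cases hs : s ∈ Ioo 0 T
      · simp only [Pi.sub_apply, F, indicator_of_mem hs, sub_sub_sub_cancel_left]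
        rw [← map_sub]
        refine (hM s _).trans ?_
        rw [mul_assoc]
        refine mul_le_mul_of_nonneg_left ?_ ha
        simp only [Y]
        rw [← smul_sub, norm_smul, Real.norm_of_nonneg (Real.exp_pos _).le, mul_comm d]
        refine mul_le_mul_of_nonneg_left ?_ (Real.exp_pos _).le
        rw [← dist_eq_norm, dist_comm]
        exact ContinuousMap.dist_apply_le_dist _
      · simp only [Pi.sub_apply, F, indicator_of_notMem hs, sub_zero, norm_zero]
        positivity
    have hdisp : ‖displacement N h₀ (F f) t - displacement N h₀ (F g) t‖
        ≤ κ * d * (Real.exp (c * t) / c) := by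
      rw [displacement_sub _ _ (hF f) (hF g)]
      refine (norm_displacement_le _).trans
        ((norm_past_history_le ((hF f).sub (hF g)) t.2.1 _).trans ?_)
      rw [map_zero, norm_zero, zero_add]
      calc 2 * (N + 1 : ℝ) * ∫ s in (0 : ℝ)..t, ‖(F f - F g) s‖
          ≤ 2 * (N + 1 : ℝ) * ∫ s in (0 : ℝ)..t, a * d * Real.exp (c * s) := by
            refine mul_le_mul_of_nonneg_left ?_ (by positivity)
            exact intervalIntegral.integral_mono_on t.2.1
              ((hF f).sub (hF g)).norm.intervalIntegrable
              (Continuous.intervalIntegrable (by fun_prop) _ _) fun s _ => hbound s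
        _ = κ * d * ∫ s in (0 : ℝ)..t, Real.exp (c * s) := by
            rw [intervalIntegral.integral_const_mul, hκ]; ring
        _ ≤ κ * d * (Real.exp (c * t) / c) :=
            mul_le_mul_of_nonneg_left (integral_exp_mul_le hc0 _) (by positivity)
    change dist (Real.exp (-(c * t)) • (displacement N h₀ (F f) t).toL2)
      (Real.exp (-(c * t)) • (displacement N h₀ (F g) t).toL2) ≤ _
    rw [dist_eq_norm, ← smul_sub, ← map_sub, norm_smul, Real.norm_of_nonneg (Real.exp_pos _).le]
    calc Real.exp (-(c * t)) * ‖(displacement N h₀ (F f) t - displacement N h₀ (F g) t).toL2‖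
        ≤ Real.exp (-(c * t)) * (κ * d * (Real.exp (c * t) / c)) :=
          mul_le_mul_of_nonneg_left ((H1Zero.norm_toL2_le _).trans hdisp) (Real.exp_pos _).le
      _ = κ / c * d * (Real.exp (-(c * t)) * Real.exp (c * t)) := by ring
      _ = κ / c * d := by rw [← Real.exp_add]; simp
      _ ≤ 1 / 2 * d := by
          refine mul_le_mul_of_nonneg_right ?_ dist_nonneg
          rw [div_le_iff₀ hc0]
          linarith
      _ = _ := by simp
  have hfix := hΦ.fixedPoint_isFixedPt
  set f := ContractingWith.fixedPoint Φ hΦ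
  refine ⟨F f, hF f, fun s hs => ?_⟩
  simp only [F, indicator_of_mem hs]
  congr 2
  have e : f ⟨s, Ioo_subset_Icc_self hs⟩
      = Real.exp (-(c * s)) • (displacement N h₀ (F f) s).toL2 :=
    (DFunLike.congr_fun hfix ⟨s, Ioo_subset_Icc_self hs⟩).symm
  simp only [Y]
  rw [IccExtend_of_mem hT.le f (Ioo_subset_Icc_self hs), e, smul_smul, ← Real.exp_add]
  simp [F, Y]

/-- The energy estimate. -/
lemma norm_past_history_le_exp {T a : ℝ} (ha : 0 ≤ a) {M : ℝ → L2 →L[ℝ] L2}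
    (hM : ∀ t u, ‖M t u‖ ≤ a * ‖u‖) {B : ℝ → L2} (hB : Integrable B (leb 0 T)) {F : ℝ → L2}
    (hF : Integrable F) (hFB : ∀ s ∈ Ioo 0 T, F s = B s - M s (displacement N h₀ F s).toL2)
    {κ : ℝ} (hκ : κ = 2 * (N + 1)) {t D : ℝ} (ht : t ∈ Icc 0 T)
    (hD : D = ‖past (t + 1) h₀‖ + κ * ∫ s in (0 : ℝ)..t, ‖B s‖) :
    ‖past (t + 1) (history N h₀ F t)‖ ≤ D + 2 * κ * a * T * (‖wave h₀‖ + T * D)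
      * Real.exp ((√(2 * κ * a) + 1) * T) := by
  have hκ0 : 0 ≤ κ := by rw [hκ]; positivity
  have hT : 0 ≤ T := ht.1.trans ht.2
  set n : ℝ → ℝ := fun s => ‖(displacement N h₀ F s).toL2‖ with hn
  have hnc : Continuous n :=
    (H1Zero.toL2L.continuous.comp (continuous_displacement hF)).norm
  have hBi (s : ℝ) (hs : s ∈ Icc 0 t) : IntervalIntegrable (fun s => ‖B s‖) volume 0 s :=
    intervalIntegrable_of_leb hB.norm le_rfl hs.1 (hs.2.trans ht.2)
  have hD0 : 0 ≤ D := by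
    rw [hD]
    have : 0 ≤ ∫ s in (0 : ℝ)..t, ‖B s‖ :=
      intervalIntegral.integral_nonneg ht.1 fun _ _ => norm_nonneg _
    positivity
  -- The potential costs only `a` times the `L²` norm of the displacement, integrated once in time.
  have hpast : ∀ s ∈ Icc 0 t, ‖past (s + 1) (history N h₀ F s)‖
      ≤ D + κ * a * ∫ r in (0 : ℝ)..s, n r := by
    intro s hs
    have h1 : ∫ r in (0 : ℝ)..s, ‖F r‖ ≤ (∫ r in (0 : ℝ)..t, ‖B r‖) + a * ∫ r in (0 : ℝ)..s, n r := by
      calc ∫ r in (0 : ℝ)..s, ‖F r‖ ≤ ∫ r in (0 : ℝ)..s, (‖B r‖ + a * n r) := by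
            refine intervalIntegral.integral_mono_ae_restrict hs.1 hF.norm.intervalIntegrable
              ((hBi s hs).add ((hnc.const_mul a).intervalIntegrable _ _)) ?_
            rw [← restrict_Ioo_eq_restrict_Icc]
            filter_upwards [ae_restrict_mem measurableSet_Ioo] with r hr
            rw [hFB r ⟨hr.1, hr.2.trans_le (hs.2.trans ht.2)⟩]
            exact (norm_sub_le _ _).trans (add_le_add_right (hM r _) _)
        _ = (∫ r in (0 : ℝ)..s, ‖B r‖) + a * ∫ r in (0 : ℝ)..s, n r := by
            rw [intervalIntegral.integral_add (hBi s hs)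
              ((hnc.const_mul a).intervalIntegrable _ _), intervalIntegral.integral_const_mul]
        _ ≤ _ := by
            refine add_le_add_left ?_ _
            exact intervalIntegral.integral_mono_interval le_rfl hs.1 hs.2
              (Filter.Eventually.of_forall fun _ => norm_nonneg _) (hBi t ⟨ht.1, le_rfl⟩)
    refine (norm_past_history_le hF hs.1 _).trans ?_
    rw [← hκ, hD]
    have h2 := norm_past_mono (by linarith [hs.2] : s + 1 ≤ t + 1) h₀
    have h3 := mul_le_mul_of_nonneg_left h1 hκ0
    linarith
  -- The displacement is the integral of the velocity, so the previous bound is integrated a second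
  -- time. The double integral is what replaces `a` by `√a` in the exponent.
  have hnle : ∀ s ∈ Icc 0 t, n s ≤ (‖wave h₀‖ + T * D)
      + κ * a * ∫ r in (0 : ℝ)..s, ∫ r' in (0 : ℝ)..r, n r' := by
    intro s hs
    have hprim : Continuous fun r => ∫ r' in (0 : ℝ)..r, n r' :=
      intervalIntegral.continuous_primitive (fun a b => hnc.intervalIntegrable a b) 0
    simp only [hn]
    rw [toL2_displacement hF hs.1]
    refine (norm_add_le _ _).trans ?_
    rw [add_assoc]
    refine add_le_add (H1Zero.norm_toL2_le _) ?_
    refine (intervalIntegral.norm_integral_le_integral_norm hs.1).trans ?_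
    calc ∫ r in (0 : ℝ)..s, ‖velocity N h₀ F r‖
        ≤ ∫ r in (0 : ℝ)..s, (D + κ * a * ∫ r' in (0 : ℝ)..r, n r') := by
          refine intervalIntegral.integral_mono_on hs.1
            ((continuous_velocity hF).norm.intervalIntegrable _ _)
            (Continuous.intervalIntegrable (by fun_prop) _ _) fun r hr => ?_
          exact (norm_velocity_le r).trans (hpast r ⟨hr.1, hr.2.trans hs.2⟩)
      _ = s * D + κ * a * ∫ r in (0 : ℝ)..s, ∫ r' in (0 : ℝ)..r, n r' := by
          rw [intervalIntegral.integral_add (by simp)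
            (Continuous.intervalIntegrable (by fun_prop) _ _), intervalIntegral.integral_const_mul]
          simp
      _ ≤ T * D + _ := by
          refine add_le_add_left (mul_le_mul_of_nonneg_right (hs.2.trans ht.2) hD0) _
  -- The added `1` keeps the rate positive when `a = 0`.
  set c := √(2 * κ * a) + 1 with hc
  have hc2 : 2 * (κ * a) ≤ c ^ 2 := by
    have h1 := Real.sq_sqrt (by positivity : 0 ≤ 2 * κ * a)
    have h2 := Real.sqrt_nonneg (2 * κ * a)
    rw [hc]
    nlinarith
  have hc0 : 0 < c := by have := Real.sqrt_nonneg (2 * κ * a); linarith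
  have hW : 0 ≤ ‖wave h₀‖ + T * D := by positivity
  have hexp := le_exp_of_le_double_integral hnc hW (by positivity) hc0 hc2 hnle
  refine (hpast t ⟨ht.1, le_rfl⟩).trans (add_le_add_right ?_ _)
  have hintegral : ∫ r in (0 : ℝ)..t, n r ≤ T * (2 * (‖wave h₀‖ + T * D) * Real.exp (c * T)) := by
    calc ∫ r in (0 : ℝ)..t, n r ≤ ∫ r in (0 : ℝ)..t, 2 * (‖wave h₀‖ + T * D) * Real.exp (c * T) := by
          refine intervalIntegral.integral_mono_on ht.1 (hnc.intervalIntegrable _ _) (by simp)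
            fun r hr => (hexp r hr).trans ?_
          gcongr
          exact hr.2.trans ht.2
      _ ≤ _ := by
          rw [intervalIntegral.integral_const, sub_zero, smul_eq_mul]
          gcongr
          exact ht.2
  calc κ * a * ∫ r in (0 : ℝ)..t, n r
      ≤ κ * a * (T * (2 * (‖wave h₀‖ + T * D) * Real.exp (c * T))) := by gcongr
    _ = _ := by ring

end LineL2

/-! ### The energy identity behind uniqueness -/

section Energy

variable {E : Type*} [NormedAddCommGroup E] [InnerProductSpace ℝ E] [CompleteSpace E]

lemma inner_intervalIntegral_left {f : ℝ → E} {a b : ℝ} (hf : IntervalIntegrable f volume a b)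
    (z : E) : inner ℝ (∫ s in a..b, f s) z = ∫ s in a..b, inner ℝ (f s) z := by
  rw [real_inner_comm, ← innerSL_apply_apply ℝ z,
    ← ContinuousLinearMap.intervalIntegral_comp_comm _ hf]
  simp only [innerSL_apply_apply, real_inner_comm]

/-- The derivative of `‖∫₀ᵗ f‖²` is `2 ⟨f, ∫₀ᵗ f⟩`. -/
lemma norm_sq_primitive {f : ℝ → E} {t : ℝ} (ht : 0 ≤ t) (hf : IntervalIntegrable f volume 0 t) :
    ‖∫ s in (0 : ℝ)..t, f s‖ ^ 2
      = ∫ s in (0 : ℝ)..t, 2 * inner ℝ (f s) (∫ r in (0 : ℝ)..s, f r) := by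
  set P : ℝ → E := fun s => ∫ r in (0 : ℝ)..s, f r with hP
  have hPc : ContinuousOn P (Icc 0 t) := by
    have := intervalIntegral.continuousOn_primitive_interval' hf left_mem_uIcc
    rwa [uIcc_of_le ht] at this
  obtain ⟨K, hK⟩ := isCompact_Icc.exists_bound_of_continuousOn hPc
  have hsub (x : ℝ) (hx : x ∈ Icc 0 t) : IntervalIntegrable f volume 0 x :=
    hf.mono_set (by rw [uIcc_of_le hx.1, uIcc_of_le ht]; exact Icc_subset_Icc_right hx.2)
  -- Increments of `‖P‖²` are at most `2K` times increments of `∫ ‖f‖`, so absolute continuity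
  -- passes from the latter.
  have hac : AbsolutelyContinuousOnInterval (fun s => ‖P s‖ ^ 2) 0 t := by
    have h0 := hf.norm.absolutelyContinuousOnInterval_intervalIntegral (c := 0) (by simp)
    have h1 := h0.const_mul (2 * K)
    unfold AbsolutelyContinuousOnInterval at h1 ⊢
    refine squeeze_zero' (Filter.Eventually.of_forall fun _ =>
      Finset.sum_nonneg fun _ _ => dist_nonneg) ?_ h1
    rw [Filter.eventually_inf_principal]
    filter_upwards with I hI
    refine Finset.sum_le_sum fun i hi => ?_
    have hmem := hI.1 i hi
    rw [uIcc_of_le ht] at hmem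
    obtain ⟨hx, hy⟩ := hmem
    set x := (I.2 i).1
    set y := (I.2 i).2
    have e1 : ‖P x - P y‖ ≤ dist (∫ s in (0 : ℝ)..x, ‖f s‖) (∫ s in (0 : ℝ)..y, ‖f s‖) := by
      rw [Real.dist_eq, hP]
      simp only
      rw [intervalIntegral.integral_interval_sub_left (hsub x hx) (hsub y hy),
        intervalIntegral.integral_interval_sub_left (hsub x hx).norm (hsub y hy).norm]
      exact intervalIntegral.norm_integral_le_abs_integral_norm
    have e2 : dist (‖P x‖ ^ 2) (‖P y‖ ^ 2) ≤ 2 * K * ‖P x - P y‖ := by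
      rw [Real.dist_eq, sq_sub_sq, abs_mul]
      refine mul_le_mul ?_ (abs_norm_sub_norm_le _ _) (abs_nonneg _) ?_
      · rw [abs_of_nonneg (by positivity)]
        linarith [hK x hx, hK y hy]
      · linarith [hK x hx, norm_nonneg (P x)]
    have hK0 : 0 ≤ K := (norm_nonneg _).trans (hK x hx)
    refine e2.trans ?_
    rw [Real.dist_eq, ← mul_sub, abs_mul, abs_of_nonneg (by positivity : 0 ≤ 2 * K), ← Real.dist_eq]
    exact mul_le_mul_of_nonneg_left e1 (by positivity)
  have h := hac.integral_deriv_eq_sub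
  have h0 : ‖P 0‖ ^ 2 = 0 := by simp [hP]
  rw [h0, sub_zero] at h
  rw [← h]
  refine intervalIntegral.integral_congr_ae ?_
  filter_upwards [hf.ae_hasDerivAt_integral] with s hs hs'
  have hd : HasDerivAt P (f s) s := hs (uIoc_subset_uIcc hs') 0 (by simp)
  rw [hd.norm_sq.deriv, real_inner_comm]

end Energy

/-- The energy argument for uniqueness. -/
lemma ae_eq_zero_of_integrated_equation {T a : ℝ} (hT : 0 < T) (ha : 0 ≤ a) {M : ℝ → L2 →L[ℝ] L2}
    (hM : ∀ t u, ‖M t u‖ ≤ a * ‖u‖)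
    (hMm : ∀ y : ℝ → L2, AEStronglyMeasurable y (leb 0 T) →
        AEStronglyMeasurable (fun t => M t (y t)) (leb 0 T))
    {d : ℝ → H1Zero} {δ : ℝ → L2} (hd : Integrable d (leb 0 T)) (hδ : Integrable δ (leb 0 T))
    (h1 : ∀ᵐ t ∂(leb 0 T), (d t).toL2 = ∫ s in (0 : ℝ)..t, δ s)
    (h2 : ∀ᵐ t ∂(leb 0 T), ∀ z : H1Zero, inner ℝ (δ t) z.toL2
      + inner ℝ (∫ s in (0 : ℝ)..t, d s) z
      + inner ℝ (∫ s in (0 : ℝ)..t, M s (d s).toL2) z.toL2 = 0) :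
    d =ᵐ[leb 0 T] 0 := by
  set D : ℝ → L2 := fun t => ∫ s in (0 : ℝ)..t, δ s with hD
  set V : ℝ → H1Zero := fun t => ∫ s in (0 : ℝ)..t, d s with hV
  set G : ℝ → L2 := fun t => ∫ s in (0 : ℝ)..t, M s (d s).toL2 with hG
  have hDc : ContinuousOn D (Icc 0 T) := continuousOn_primitive hT.le hδ
  have hVc : ContinuousOn V (Icc 0 T) := continuousOn_primitive hT.le hd
  have hdL : Integrable (fun t => (d t).toL2) (leb 0 T) := H1Zero.toL2L.integrable_comp hd
  have hMd : Integrable (fun t => M t (d t).toL2) (leb 0 T) :=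
    (hdL.norm.const_mul a).mono' (hMm _ hdL.1) (Filter.Eventually.of_forall fun s => hM s _)
  have hGc : ContinuousOn G (Icc 0 T) := continuousOn_primitive hT.le hMd
  have hsub {f : ℝ → ℝ} (hf : Integrable f (leb 0 T)) (t : ℝ) (ht : t ∈ Icc 0 T) :
      IntervalIntegrable f volume 0 t := intervalIntegrable_of_leb hf le_rfl ht.1 ht.2
  have hGD : ContinuousOn (fun s => inner ℝ (G s) (D s)) (Icc 0 T) := hGc.inner hDc
  have bdd {X : Type} [NormedAddCommGroup X] [InnerProductSpace ℝ X] {f g : ℝ → X}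
      (hf : Integrable f (leb 0 T)) (hg : ContinuousOn g (Icc 0 T)) :
      Integrable (fun s => inner ℝ (f s) (g s)) (leb 0 T) := by
    obtain ⟨K, hK⟩ := isCompact_Icc.exists_bound_of_continuousOn hg
    refine (hf.norm.const_mul K).mono' (hf.1.inner
      ((hg.mono Ioo_subset_Icc_self).aestronglyMeasurable measurableSet_Ioo)) ?_
    filter_upwards [ae_restrict_mem measurableSet_Ioo] with s hs
    refine (norm_inner_le_norm _ _).trans ?_
    rw [mul_comm]
    exact mul_le_mul_of_nonneg_right (hK s (Ioo_subset_Icc_self hs)) (norm_nonneg _)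
  -- The integrated equation at time `s` is tested with `z = d s`. Since `D' = δ`, `V' = d` and `D`
  -- is `d` seen in `L²(Ω)`, the first two terms are half the derivative of `‖D‖² + ‖V‖²`.
  have energy : ∀ t ∈ Icc 0 T, ‖D t‖ ^ 2 + ‖V t‖ ^ 2
      = -(2 * ∫ s in (0 : ℝ)..t, inner ℝ (G s) (D s)) := by
    intro t ht
    have e1 := norm_sq_primitive ht.1 (intervalIntegrable_of_leb hδ le_rfl ht.1 ht.2)
    have e2 := norm_sq_primitive ht.1 (intervalIntegrable_of_leb hd le_rfl ht.1 ht.2)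
    simp only [hD, hV]
    rw [e1, e2, ← intervalIntegral.integral_add ((hsub (bdd hδ hDc) t ht).const_mul 2)
      ((hsub (bdd hd hVc) t ht).const_mul 2), ← intervalIntegral.integral_const_mul,
      ← intervalIntegral.integral_neg, intervalIntegral.integral_of_le ht.1,
      intervalIntegral.integral_of_le ht.1, integral_Ioc_eq_integral_Ioo,
      integral_Ioc_eq_integral_Ioo]
    refine integral_congr_ae ?_
    have hle : leb 0 t ≤ leb 0 T := Measure.restrict_mono (Ioo_subset_Ioo_right ht.2) le_rfl
    filter_upwards [ae_mono hle h1, ae_mono hle h2] with s hs1 hs2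
    have := hs2 (d s)
    rw [hs1, real_inner_comm (d s)] at this
    linarith
  -- With the weight `e^{-ct}`, the energy identity at the maximum gives `m² ≤ (a / c²) m²`; this
  -- choice makes `a < c²`, hence `m = 0`.
  set c : ℝ := a + 1 with hc
  have hc0 : 0 < c := by linarith
  obtain ⟨t₀, ht₀, hmax⟩ := isCompact_Icc.exists_isMaxOn (nonempty_Icc.2 hT.le)
    (f := fun t => Real.exp (-(c * t)) * ‖D t‖)
    (ContinuousOn.mul (by fun_prop) hDc.norm)
  set m := Real.exp (-(c * t₀)) * ‖D t₀‖ with hm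
  have hm0 : 0 ≤ m := by positivity
  have hDm : ∀ r ∈ Icc 0 T, ‖D r‖ ≤ m * Real.exp (c * r) := by
    intro r hr
    have : Real.exp (-(c * r)) * ‖D r‖ ≤ m := hmax hr
    calc ‖D r‖ = Real.exp (-(c * r)) * ‖D r‖ * Real.exp (c * r) := by
          rw [mul_right_comm, ← Real.exp_add]; simp
      _ ≤ m * Real.exp (c * r) := by gcongr
  have hGm : ∀ s ∈ Icc 0 T, ‖G s‖ ≤ a * m / c * Real.exp (c * s) := by
    intro s hs
    refine (intervalIntegral.norm_integral_le_integral_norm hs.1).trans ?_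
    calc ∫ r in (0 : ℝ)..s, ‖M r (d r).toL2‖ ≤ ∫ r in (0 : ℝ)..s, a * m * Real.exp (c * r) := by
          refine intervalIntegral.integral_mono_ae_restrict hs.1 (hsub hMd.norm s hs)
            (Continuous.intervalIntegrable (by fun_prop) _ _) ?_
          rw [← restrict_Ioo_eq_restrict_Icc]
          have hle : leb 0 s ≤ leb 0 T := Measure.restrict_mono (Ioo_subset_Ioo_right hs.2) le_rfl
          filter_upwards [ae_mono hle h1, ae_restrict_mem measurableSet_Ioo] with r hr hr'
          refine (hM r _).trans ?_
          rw [hr, mul_assoc]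
          exact mul_le_mul_of_nonneg_left (hDm r ⟨hr'.1.le, hr'.2.le.trans hs.2⟩) ha
      _ ≤ a * m * (Real.exp (c * s) / c) := by
          rw [intervalIntegral.integral_const_mul]
          exact mul_le_mul_of_nonneg_left (integral_exp_mul_le hc0 s) (by positivity)
      _ = _ := by ring
  have hintegral : ∀ t ∈ Icc 0 T, -(2 * ∫ s in (0 : ℝ)..t, inner ℝ (G s) (D s))
      ≤ a * m ^ 2 / c ^ 2 * Real.exp (2 * c * t) := by
    intro t ht
    have e : -∫ s in (0 : ℝ)..t, inner ℝ (G s) (D s)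
        ≤ ∫ s in (0 : ℝ)..t, a * m ^ 2 / c * Real.exp (2 * c * s) := by
      rw [← intervalIntegral.integral_neg]
      refine intervalIntegral.integral_mono_on ht.1
        (hsub (integrable_of_continuousOn hGD) t ht).neg
        (Continuous.intervalIntegrable (by fun_prop) _ _) fun s hs => ?_
      have hs' : s ∈ Icc 0 T := ⟨hs.1, hs.2.trans ht.2⟩
      calc -inner ℝ (G s) (D s) ≤ ‖G s‖ * ‖D s‖ :=
            (neg_le_abs _).trans (abs_real_inner_le_norm _ _)
        _ ≤ (a * m / c * Real.exp (c * s)) * (m * Real.exp (c * s)) :=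
            mul_le_mul (hGm s hs') (hDm s hs') (norm_nonneg _) (by positivity)
        _ = a * m ^ 2 / c * (Real.exp (c * s) * Real.exp (c * s)) := by ring
        _ = _ := by rw [← Real.exp_add]; ring_nf
    have e' : ∫ s in (0 : ℝ)..t, a * m ^ 2 / c * Real.exp (2 * c * s)
        ≤ a * m ^ 2 / c * (Real.exp (2 * c * t) / (2 * c)) := by
      rw [intervalIntegral.integral_const_mul]
      exact mul_le_mul_of_nonneg_left (integral_exp_mul_le (by positivity) t) (by positivity)
    have e'' : 2 * (a * m ^ 2 / c * (Real.exp (2 * c * t) / (2 * c)))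
        = a * m ^ 2 / c ^ 2 * Real.exp (2 * c * t) := by field_simp
    linarith
  have hmz : m ^ 2 = 0 := by
    have e := (energy t₀ ht₀).le.trans (hintegral t₀ ht₀)
    have e1 : m ^ 2 * Real.exp (2 * c * t₀) = ‖D t₀‖ ^ 2 := by
      rw [hm, mul_pow, mul_right_comm, sq (Real.exp _), ← Real.exp_add, ← Real.exp_add]
      ring_nf
      simp
    have e2 : m ^ 2 * Real.exp (2 * c * t₀) ≤ a * m ^ 2 / c ^ 2 * Real.exp (2 * c * t₀) := by
      rw [e1]
      linarith [sq_nonneg ‖V t₀‖]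
    have e3 := le_of_mul_le_mul_right e2 (Real.exp_pos _)
    rw [le_div_iff₀ (by positivity)] at e3
    have e4 : m ^ 2 * (c ^ 2 - a) ≤ 0 := by linarith
    have e5 : 0 < c ^ 2 - a := by rw [hc]; nlinarith
    exact le_antisymm (by nlinarith [sq_nonneg m]) (sq_nonneg m)
  have hVz : ∀ t ∈ Icc 0 T, V t = 0 := by
    intro t ht
    have e := (energy t ht).le.trans (hintegral t ht)
    rw [hmz, mul_zero, zero_div, zero_mul] at e
    have : ‖V t‖ ^ 2 = 0 := le_antisymm (by linarith [sq_nonneg ‖D t‖]) (sq_nonneg _)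
    exact norm_eq_zero.1 (pow_eq_zero_iff two_ne_zero |>.1 this)
  -- `V` vanishes identically, so its derivative `d` vanishes almost everywhere.
  have hii := intervalIntegrable_of_leb hd le_rfl hT.le le_rfl
  rw [Filter.EventuallyEq, ae_restrict_iff' measurableSet_Ioo]
  filter_upwards [hii.ae_hasDerivAt_integral] with t ht ht'
  have hmem : t ∈ uIcc 0 T := by rw [uIcc_of_le hT.le]; exact Ioo_subset_Icc_self ht'
  have hder : HasDerivAt V (d t) t := ht hmem 0 (by simp)
  have hz : HasDerivAt V 0 t := by
    refine (hasDerivAt_const t (0 : H1Zero)).congr_of_eventuallyEq ?_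
    filter_upwards [Ioo_mem_nhds ht'.1 ht'.2] with s hs
    exact hVz s (Ioo_subset_Icc_self hs)
  exact hder.unique hz

/-! ### Functions with values in the dual space, and uniqueness of weak solutions -/

section Dual

variable {X Y : Type*} [NormedAddCommGroup X] [InnerProductSpace ℝ X] [NormedAddCommGroup Y]
  [InnerProductSpace ℝ Y] {a b : ℝ}

lemma integrable_dual_apply {g : ℝ → StrongDual ℝ X} (hg : MemLp g 1 (leb a b)) (z : X) :
    Integrable (fun s => g s z) (leb a b) :=
  (ContinuousLinearMap.apply ℝ ℝ z).integrable_comp (memLp_one_iff_integrable.1 hg)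

/-- The identity holds in the dual space, so one null set serves for all `z`. -/
lemma dual_apply_ae_eq_primitive (hab : a < b) {f g : ℝ → StrongDual ℝ X} {e : StrongDual ℝ X}
    (hf : MemLp f 1 (leb a b)) (hg : MemLp g 1 (leb a b)) (hfg : IsWeakDeriv a b f g)
    (he : HasValueAt a b f a e) :
    ∀ᵐ t ∂(leb a b), ∀ z, f t z = e z + ∫ s in a..t, g s z := by
  have hg' := memLp_one_iff_integrable.1 hg
  filter_upwards [hfg.ae_eq_primitive hab (memLp_one_iff_integrable.1 hf) hg' he,
    ae_restrict_mem measurableSet_Ioo] with t h ht z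
  rw [h, add_apply, ContinuousLinearMap.intervalIntegral_apply
    (intervalIntegrable_of_leb hg' le_rfl ht.1.le ht.2.le)]

lemma isWeakDeriv_of_dual_apply_eq (hab : a ≤ b) {f g : ℝ → StrongDual ℝ X} {e : StrongDual ℝ X}
    (hg : MemLp g 1 (leb a b))
    (h : ∀ t ∈ Ioo a b, ∀ z, f t z = e z + ∫ s in a..t, g s z) : IsWeakDeriv a b f g := by
  have hg' := memLp_one_iff_integrable.1 hg
  refine (isWeakDeriv_primitive hab hg' e).congr ?_ (Filter.EventuallyEq.refl _ _)
  filter_upwards [ae_restrict_mem measurableSet_Ioo] with t ht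
  ext z
  rw [h t ht, add_apply, ContinuousLinearMap.intervalIntegral_apply
    (intervalIntegrable_of_leb hg' le_rfl ht.1.le ht.2.le)]

lemma memLp_inner_dual (j : X →L[ℝ] Y) {p : ℝ≥0∞} {w : ℝ → Y} (hw : MemLp w p (leb a b)) :
    MemLp (fun t => (innerSL ℝ (w t)).comp j) p (leb a b) :=
  (((ContinuousLinearMap.compL ℝ X Y ℝ).flip j).comp (innerSL ℝ)).comp_memLp' hw

lemma continuousOn_inner_dual (j : X →L[ℝ] Y) {s : Set ℝ} {w : ℝ → Y} (hw : ContinuousOn w s) :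
    ContinuousOn (fun t => (innerSL ℝ (w t)).comp j) s :=
  (((ContinuousLinearMap.compL ℝ X Y ℝ).flip j).comp (innerSL ℝ)).continuous.comp_continuousOn hw

/-- This is the form `∂ₜₜ y` takes: boundary datum times evaluation at `1`, minus the elastic term,
plus the force. -/
lemma memLp_force_dual (ℓ : StrongDual ℝ X) (j : X →L[ℝ] Y) {p : ℝ≥0∞} {v : ℝ → ℝ} {y : ℝ → X}
    {F : ℝ → Y} (hv : MemLp v p (leb a b)) (hy : MemLp y p (leb a b)) (hF : MemLp F p (leb a b)) :
    MemLp (fun t => v t • ℓ - innerSL ℝ (y t) + (innerSL ℝ (F t)).comp j) p (leb a b) :=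
  ((((1 : ℝ →L[ℝ] ℝ).smulRight ℓ).comp_memLp' hv).sub ((innerSL ℝ).comp_memLp' hy)).add
    (memLp_inner_dual j hF)

end Dual

lemma memLp_toHm1 {a b : ℝ} {p : ℝ≥0∞} {w : ℝ → L2} (hw : MemLp w p (leb a b)) :
    MemLp (fun t => toHm1 (w t)) p (leb a b) := memLp_inner_dual H1Zero.toL2L hw

lemma continuousOn_toHm1 {s : Set ℝ} {w : ℝ → L2} (hw : ContinuousOn w s) :
    ContinuousOn (fun t => toHm1 (w t)) s := continuousOn_inner_dual H1Zero.toL2L hw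

/-- Weak solutions are unique. -/
lemma IsWeakSolution.ae_eq {T : ℝ} (hT : 0 < T) {A : ℝ × ℝ → ℝ} {B : ℝ → L2} {v : ℝ → ℝ}
    {u₀ : H1Zero} {u₁ : L2} (hA : MemLp A ⊤ (volume.restrict (cylinder T)))
    {w y : ℝ → H1Zero} (hw : IsWeakSolution 1 T A B v u₀ u₁ w)
    (hy : IsWeakSolution 1 T A B v u₀ u₁ y) : w =ᵐ[leb 0 T] y := by
  obtain ⟨M, hM, hMm, hMA⟩ := exists_potential_operator hA
  obtain ⟨wt, wtt, hw1, hw2, hw3, hw4, hw5, hw6, hw7, hw8⟩ := hw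
  obtain ⟨yt, ytt, hy1, hy2, hy3, hy4, hy5, hy6, hy7, hy8⟩ := hy
  have iw := hw1.integrable (by norm_num)
  have iy := hy1.integrable (by norm_num)
  have iwt := hw2.integrable (by norm_num)
  have iyt := hy2.integrable (by norm_num)
  have pw := hw4.ae_eq_primitive hT (H1Zero.toL2L.integrable_comp iw) iwt hw7
  have py := hy4.ae_eq_primitive hT (H1Zero.toL2L.integrable_comp iy) iyt hy7
  have iwtt := fun z => integrable_dual_apply hw3 z
  have iytt := fun z => integrable_dual_apply hy3 z
  have pwt := dual_apply_ae_eq_primitive hT (memLp_toHm1 (memLp_one_iff_integrable.2 iwt)) hw3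
    hw5 hw8
  have pyt := dual_apply_ae_eq_primitive hT (memLp_toHm1 (memLp_one_iff_integrable.2 iyt)) hy3
    hy5 hy8
  -- Both solutions start from the same data, so the initial terms cancel in the difference of the
  -- equations integrated from `0`.
  have hz := ae_eq_zero_of_integrated_equation hT ENNReal.toReal_nonneg hM hMm (iw.sub iy)
    (iwt.sub iyt) ?_ ?_
  · filter_upwards [hz] with t ht
    exact sub_eq_zero.1 ht
  · filter_upwards [pw, py, ae_restrict_mem measurableSet_Ioo] with t h1 h2 ht
    simp only [Pi.sub_apply, map_sub]
    rw [H1Zero.toL2L_apply] at h1 h2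
    rw [h1, h2, add_sub_add_left_eq_sub, intervalIntegral.integral_sub
      (intervalIntegrable_of_leb iwt le_rfl ht.1.le ht.2.le)
      (intervalIntegrable_of_leb iyt le_rfl ht.1.le ht.2.le)]
  · filter_upwards [pwt, pyt, ae_restrict_mem measurableSet_Ioo] with t h1 h2 ht z
    have hi {X : Type} [NormedAddCommGroup X] {f : ℝ → X} (hf : Integrable f (leb 0 T)) :
        IntervalIntegrable f volume 0 t := intervalIntegrable_of_leb hf le_rfl ht.1.le ht.2.le
    have id := iw.sub iy
    have idL : Integrable (fun s => ((w - y) s).toL2) (leb 0 T) := H1Zero.toL2L.integrable_comp id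
    have iMd : Integrable (fun s => M s ((w - y) s).toL2) (leb 0 T) :=
      (idL.norm.const_mul _).mono' (hMm _ idL.1) (Filter.Eventually.of_forall fun s => hM s _)
    have e1 : inner ℝ ((wt - yt) t) z.toL2 = ∫ s in (0 : ℝ)..t, (wtt s z - ytt s z) := by
      rw [intervalIntegral.integral_sub (hi (iwtt z)) (hi (iytt z)), Pi.sub_apply, inner_sub_left,
        ← toHm1_apply, ← toHm1_apply, h1 z, h2 z]
      ring
    rw [e1, inner_intervalIntegral_left (hi id), inner_intervalIntegral_left (hi iMd),
      ← intervalIntegral.integral_add, ← intervalIntegral.integral_add]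
    · refine intervalIntegral.integral_zero_ae ?_
      filter_upwards [(ae_restrict_iff' measurableSet_Ioo).1 hw6,
        (ae_restrict_iff' measurableSet_Ioo).1 hy6,
        (ae_restrict_iff' measurableSet_Ioo).1 hMA] with s k1 k2 k3 hs
      rw [uIoc_of_le ht.1.le] at hs
      have hs' : s ∈ Ioo 0 T := ⟨hs.1, hs.2.trans_lt ht.2⟩
      have l1 := k1 hs' z
      have l2 := k2 hs' z
      rw [k3 hs'] at l1 l2
      simp only [Pi.sub_apply, map_sub, inner_sub_left, H1Zero.inner_eq]
      linarith
    · exact ((hi (iwtt z)).sub (hi (iytt z))).add (hi (id.inner_const z))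
    · exact hi (iMd.inner_const z.toL2)
    · exact (hi (iwtt z)).sub (hi (iytt z))
    · exact hi (id.inner_const z)

open LineL2

/-! ### The boundary datum as a profile, and the norms of the data -/

section Control

variable {T : ℝ} {v : ℝ → ℝ}

/-- The boundary datum, extended by zero to the line. -/
def control (hv : MemLp v 2 (leb 0 T)) : LineL2 := zeroExtend 0 T (hv.toLp v)

lemma control_ae (hv : MemLp v 2 (leb 0 T)) :
    control hv =ᵐ[volume] (Ioo 0 T).indicator v := by
  filter_upwards [zeroExtend_ae (hv.toLp v),
    (ae_restrict_iff' measurableSet_Ioo).1 hv.coeFn_toLp] with r h1 h2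
  rw [control, h1]
  by_cases hr : r ∈ Ioo 0 T
  · rw [indicator_of_mem hr, indicator_of_mem hr, h2 hr]
  · rw [indicator_of_notMem hr, indicator_of_notMem hr]

lemma past_control (hv : MemLp v 2 (leb 0 T)) : past 0 (control hv) = 0 := by
  rw [past_eq_zero_iff]
  filter_upwards [control_ae hv] with r hr h
  rw [hr, indicator_of_notMem fun h' => h.not_gt h'.1]

lemma norm_past_control (hv : MemLp v 2 (leb 0 T)) {t : ℝ} (ht : t ≤ T) :
    ‖past t (control hv)‖ = lpNorm 2 0 t v := by
  have e : control hv =ᵐ[volume.restrict (Iio t)] (Ioo 0 t).indicator v := by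
    filter_upwards [ae_restrict_of_ae (control_ae hv), ae_restrict_mem measurableSet_Iio]
      with r h1 h2
    rw [h1]
    by_cases h0 : 0 < r
    · rw [indicator_of_mem (show r ∈ Ioo 0 T from ⟨h0, (mem_Iio.1 h2).trans_le ht⟩),
        indicator_of_mem (show r ∈ Ioo 0 t from ⟨h0, h2⟩)]
    · rw [indicator_of_notMem fun h => h0 h.1, indicator_of_notMem fun h => h0 h.1]
  rw [norm_past, eLpNorm_congr_ae e, eLpNorm_indicator_eq_eLpNorm_restrict measurableSet_Ioo,
    Measure.restrict_restrict_of_subset Ioo_subset_Iio_self, lpNorm]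

lemma integral_norm_eq_lpNorm {T t : ℝ} {B : ℝ → L2} (hB : Integrable B (leb 0 T))
    (ht : t ∈ Icc 0 T) : ∫ s in (0 : ℝ)..t, ‖B s‖ = lpNorm 1 0 t B := by
  have hm := hB.1.mono_measure (Measure.restrict_mono (Ioo_subset_Ioo_right ht.2) le_rfl :
    leb 0 t ≤ leb 0 T)
  rw [integral_interval_eq_leb ht.1, integral_norm_eq_lintegral_enorm hm, lpNorm,
    eLpNorm_one_eq_lintegral_enorm]

end Control

/-- The square root growth of the exponent. -/
lemma add_mul_exp_le {κ T a w D d : ℝ} (hκ : 0 ≤ κ) (hT : 0 ≤ T) (ha : 0 ≤ a) (hd : 0 ≤ d)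
    (hw : w ≤ d) (hD : D ≤ 2 * κ * d) :
    D + 2 * κ * a * T * (w + T * D) * Real.exp ((√(2 * κ * a) + 1) * T)
      ≤ (2 * κ + 4 * κ * T * (1 + 2 * κ * T) * Real.exp T)
        * Real.exp ((1 + √(2 * κ) * T) * √a) * d := by
  -- The polynomial factor `a` in front of the exponential is absorbed using `x² / 2 ≤ e^x` at `x =
  -- √a`.
  have h1 : a ≤ 2 * Real.exp √a := by
    have := Real.quadratic_le_exp_of_nonneg (Real.sqrt_nonneg a)
    rw [Real.sq_sqrt ha] at this
    linarith [Real.sqrt_nonneg a]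
  have h2 : Real.exp ((√(2 * κ * a) + 1) * T)
      = Real.exp T * Real.exp (√(2 * κ) * T * √a) := by
    rw [Real.sqrt_mul (by positivity), ← Real.exp_add]
    ring_nf
  have h3 : Real.exp ((1 + √(2 * κ) * T) * √a)
      = Real.exp √a * Real.exp (√(2 * κ) * T * √a) := by
    rw [← Real.exp_add]
    ring_nf
  have h4 : 1 ≤ Real.exp ((1 + √(2 * κ) * T) * √a) := Real.one_le_exp (by positivity)
  have h5 : D ≤ 2 * κ * Real.exp ((1 + √(2 * κ) * T) * √a) * d := by
    refine hD.trans ?_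
    have : 2 * κ * d * 1 ≤ 2 * κ * d * Real.exp ((1 + √(2 * κ) * T) * √a) := by gcongr
    linarith
  have h6 : w + T * D ≤ (1 + 2 * κ * T) * d := by nlinarith
  calc D + 2 * κ * a * T * (w + T * D) * Real.exp ((√(2 * κ * a) + 1) * T)
      ≤ 2 * κ * Real.exp ((1 + √(2 * κ) * T) * √a) * d
        + 2 * κ * (2 * Real.exp √a) * T * ((1 + 2 * κ * T) * d)
          * Real.exp ((√(2 * κ * a) + 1) * T) := by
        refine add_le_add h5 (mul_le_mul_of_nonneg_right ?_ (Real.exp_pos _).le)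
        calc 2 * κ * a * T * (w + T * D) ≤ 2 * κ * a * T * ((1 + 2 * κ * T) * d) := by gcongr
          _ ≤ _ := by gcongr
    _ = _ := by rw [h2, h3]; ring

/-! ### The constructed wave is a weak solution and satisfies the bounds -/

section Solution

variable {T a : ℝ} {N : ℕ} {M : ℝ → L2 →L[ℝ] L2} {A : ℝ × ℝ → ℝ} {B F : ℝ → L2} {v : ℝ → ℝ}
  {u₀ : H1Zero} {u₁ : L2}

lemma memLp_of_continuous {E : Type*} [NormedAddCommGroup E] {f : ℝ → E} (hf : Continuous f)
    (p : ℝ≥0∞) (a b : ℝ) : MemLp f p (leb a b) := by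
  obtain ⟨K, hK⟩ := isCompact_Icc.exists_bound_of_continuousOn (hf.continuousOn (s := Icc a b))
  refine MemLp.of_bound ((hf.continuousOn (s := Ioo a b)).aestronglyMeasurable measurableSet_Ioo) K ?_
  filter_upwards [ae_restrict_mem measurableSet_Ioo] with t ht
  exact hK t (Ioo_subset_Icc_self ht)

lemma intervalIntegral_control (hv : MemLp v 2 (leb 0 T)) {t : ℝ} (ht : t ∈ Icc 0 T)
    (f : ℝ → ℝ) :
    ∫ r in (0 : ℝ)..t, ((control hv : ℝ → ℝ) r - f r) = ∫ r in (0 : ℝ)..t, (v r - f r) := by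
  rw [integral_interval_eq_leb ht.1, integral_interval_eq_leb ht.1]
  refine integral_congr_ae ?_
  filter_upwards [ae_restrict_of_ae (control_ae hv), ae_restrict_mem measurableSet_Ioo] with r h1 h2
  rw [h1, indicator_of_mem (Ioo_subset_Ioo_right ht.2 h2)]

lemma toHm1_velocity_apply (hF : Integrable F) (hTN : T ≤ 2 * N) (hv : MemLp v 2 (leb 0 T))
    {t : ℝ} (ht : t ∈ Icc 0 T) (z : H1Zero) :
    toHm1 (velocity N (profile N u₀ u₁ (control hv)) F t) z = toHm1 u₁ z
      + ∫ s in (0 : ℝ)..t, (v s * z.rep 1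
        - inner ℝ (displacement N (profile N u₀ u₁ (control hv)) F s) z
        + inner ℝ (F s) z.toL2) := by
  have hvi : IntervalIntegrable v volume 0 t :=
    intervalIntegrable_of_leb (hv.integrable (by norm_num)) le_rfl ht.1 ht.2
  have hyi : IntervalIntegrable
      (fun s => inner ℝ (displacement N (profile N u₀ u₁ (control hv)) F s) z) volume 0 t :=
    ((continuous_displacement hF).inner continuous_const).intervalIntegrable _ _
  have hFi : IntervalIntegrable (fun s => inner ℝ (F s) z.toL2) volume 0 t :=
    (hF.inner_const _).intervalIntegrable
  have e := intervalIntegral_control hv ht fun _ => 0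
  simp only [sub_zero] at e
  rw [toHm1_apply, toHm1_apply, inner_velocity hF z ht.1 (ht.2.trans hTN)
    (profile_boundary_ae (past_control hv)), oddPart_profile (past_control hv), e,
    intervalIntegral.integral_add ((hvi.mul_const _).sub hyi) hFi,
    intervalIntegral.integral_sub (hvi.mul_const _) hyi, intervalIntegral.integral_mul_const]
  simp only [H1Zero.inner_eq]
  ring

/-- The potential term is bounded in time, so the source, and with it `∂ₜₜ y`, has the integrability
of `B` up to exponent `2`. The cases `q = 1` and `q = 2` give existence and the improved regularity
for the same function. -/
lemma isWeakSolution_displacement {q : ℝ≥0∞} (hq : 1 ≤ q) (hq2 : q ≤ 2) (hT : 0 < T)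
    (hTN : T ≤ 2 * N) (hM : ∀ t u, ‖M t u‖ ≤ a * ‖u‖)
    (hMm : ∀ y : ℝ → L2, AEStronglyMeasurable y (leb 0 T) →
        AEStronglyMeasurable (fun t => M t (y t)) (leb 0 T))
    (hMA : ∀ᵐ t ∂(leb 0 T), ∀ u z : L2,
      ∫ x in Ioo (0 : ℝ) 1, A (x, t) * u x * z x = inner ℝ (M t u) z)
    (hB : MemLp B q (leb 0 T)) (hv : MemLp v 2 (leb 0 T)) (hF : Integrable F)
    (hFB : ∀ s ∈ Ioo 0 T,
      F s = B s - M s (displacement N (profile N u₀ u₁ (control hv)) F s).toL2) :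
    IsWeakSolution q T A B v u₀ u₁ (displacement N (profile N u₀ u₁ (control hv)) F) := by
  set h₀ := profile N u₀ u₁ (control hv) with hh₀
  set y := displacement N h₀ F with hy
  have hyc : Continuous y := continuous_displacement hF
  have hyLc : Continuous fun t => (y t).toL2 := H1Zero.toL2L.continuous.comp hyc
  have hytc : Continuous (velocity N h₀ F) := continuous_velocity hF
  have hFq : MemLp F q (leb 0 T) := by
    have h1 : MemLp (fun s => M s (y s).toL2) q (leb 0 T) :=
      (memLp_of_continuous hyLc q 0 T).of_le_mul (hMm _ hyLc.aestronglyMeasurable)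
        (Filter.Eventually.of_forall fun s => hM s _)
    refine (hB.sub h1).ae_eq ?_
    filter_upwards [ae_restrict_mem measurableSet_Ioo] with s hs
    exact (hFB s hs).symm
  have hytt := memLp_force_dual H1Zero.evalOne H1Zero.toL2L (hv.mono_exponent hq2)
    (memLp_of_continuous hyc q 0 T) hFq
  refine ⟨velocity N h₀ F, _, memLp_of_continuous hyc 2 0 T, memLp_of_continuous hytc 2 0 T, hytt,
    ?_, ?_, ?_, ⟨_, hyLc.continuousOn, Filter.EventuallyEq.refl _ _, ?_⟩,
    ⟨_, continuousOn_toHm1 hytc.continuousOn, Filter.EventuallyEq.refl _ _, ?_⟩⟩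
  · refine (isWeakDeriv_primitive hT.le (memLp_one_iff_integrable.1
      (memLp_of_continuous hytc 1 0 T)) u₀.toL2).congr ?_ (Filter.EventuallyEq.refl _ _)
    filter_upwards [ae_restrict_mem measurableSet_Ioo] with t ht
    rw [hy, toL2_displacement hF ht.1.le, wave_profile (past_control hv)]
  · refine isWeakDeriv_of_dual_apply_eq hT.le (e := toHm1 u₁) (hytt.mono_exponent hq) ?_
    intro t ht z
    exact toHm1_velocity_apply hF hTN hv (Ioo_subset_Icc_self ht) z
  · filter_upwards [hMA, ae_restrict_mem measurableSet_Ioo] with t h1 ht z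
    rw [h1]
    change v t * z.rep 1 - inner ℝ (y t) z + inner ℝ (F t) z.toL2 - v t * z.rep 1
      + inner ℝ (y t).dx z.dx + inner ℝ (M t (y t).toL2) z.toL2 = inner ℝ (B t) z.toL2
    rw [hFB t ht, inner_sub_left, H1Zero.inner_eq]
    ring
  · simp [hy, displacement, hh₀, wave_profile (past_control hv)]
  · simp [velocity, hh₀, oddPart_profile (past_control hv)]

lemma hasDerivWithinAt_displacement {h₀ : LineL2} (hF : Integrable F) {t : ℝ} (ht : t ∈ Icc 0 T) :
    HasDerivWithinAt (fun s => (displacement N h₀ F s).toL2) (velocity N h₀ F t) (Icc 0 T) t := by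
  have hc := continuous_velocity (N := N) (h₀ := h₀) hF
  refine (((hc.integral_hasStrictDerivAt 0 t).hasDerivAt.const_add
    (wave h₀).toL2).hasDerivWithinAt (s := Icc 0 T)).congr ?_ ?_
  · exact fun s hs => toL2_displacement hF hs.1
  · exact toL2_displacement hF ht.1

lemma norm_past_history_le_data (ha : 0 ≤ a) (hM : ∀ t u, ‖M t u‖ ≤ a * ‖u‖)
    (hB : Integrable B (leb 0 T)) (hv : MemLp v 2 (leb 0 T)) (hF : Integrable F)
    (hFB : ∀ s ∈ Ioo 0 T,
      F s = B s - M s (displacement N (profile N u₀ u₁ (control hv)) F s).toL2)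
    {κ : ℝ} (hκ : κ = 2 * (N + 1)) {t : ℝ} (ht : t ∈ Icc 0 T) :
    ‖past (t + 1) (history N (profile N u₀ u₁ (control hv)) F t)‖
      ≤ (2 * κ + 4 * κ * T * (1 + 2 * κ * T) * Real.exp T)
        * Real.exp ((1 + √(2 * κ) * T) * √a)
        * (√(‖u₀‖ ^ 2 + ‖u₁‖ ^ 2) + lpNorm 1 0 t B + lpNorm 2 0 t v) := by
  have hκ0 : 0 ≤ κ := by rw [hκ]; positivity
  have h0 : ‖u₀‖ ≤ √(‖u₀‖ ^ 2 + ‖u₁‖ ^ 2) := Real.le_sqrt_of_sq_le (by linarith [sq_nonneg ‖u₁‖])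
  have h1 : ‖u₁‖ ≤ √(‖u₀‖ ^ 2 + ‖u₁‖ ^ 2) := Real.le_sqrt_of_sq_le (by linarith [sq_nonneg ‖u₀‖])
  have hB0 : 0 ≤ lpNorm 1 0 t B := ENNReal.toReal_nonneg
  have hv0 : 0 ≤ lpNorm 2 0 t v := ENNReal.toReal_nonneg
  refine (norm_past_history_le_exp ha hM hB hF hFB hκ ht rfl).trans
    (add_mul_exp_le hκ0 (ht.1.trans ht.2) ha (by positivity) ?_ ?_)
  · rw [wave_profile (past_control hv)]
    linarith
  · have h2 := norm_past_profile_le (N := N) (u₀ := u₀) (u₁ := u₁) (V := control hv) t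
    rw [norm_past_control hv ht.2, ← hκ] at h2
    rw [integral_norm_eq_lpNorm hB ht]
    nlinarith [mul_le_mul_of_nonneg_left h0 hκ0, mul_le_mul_of_nonneg_left h1 hκ0,
      mul_nonneg hκ0 hB0, mul_nonneg hκ0 hv0]

/-- The derivative of the trace at `x = 1` is the difference of the boundary datum and the outgoing
profile. -/
lemma isWeakDeriv_rep_one_displacement (hT : 0 ≤ T) (hTN : T ≤ 2 * N) (hF : Integrable F)
    (hv : MemLp v 2 (leb 0 T)) :
    IsWeakDeriv 0 T (fun t => (displacement N (profile N u₀ u₁ (control hv)) F t).rep 1)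
      (fun r => v r
        - (shift (-1) (history N (profile N u₀ u₁ (control hv)) F T) : ℝ → ℝ) r) := by
  set H := history N (profile N u₀ u₁ (control hv)) F T with hH
  have hg : MemLp (fun r => v r - (shift (-1) H : ℝ → ℝ) r) 2 (leb 0 T) :=
    hv.sub ((Lp.memLp (shift (-1) H)).restrict _)
  refine (isWeakDeriv_primitive hT (hg.integrable (by norm_num)) (u₀.rep 1)).congr ?_
    (Filter.EventuallyEq.refl _ _)
  filter_upwards [ae_restrict_mem measurableSet_Ioo] with t ht
  rw [rep_one_displacement hF ht.1.le ht.2.le (ht.2.le.trans hTN)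
    (profile_boundary_ae (past_control hv)), intervalIntegral_control hv (Ioo_subset_Icc_self ht),
    wave_profile (past_control hv)]
  congr 1
  refine intervalIntegral.integral_congr_ae ?_
  filter_upwards [shift_ae (-1) H] with r hr _
  rw [hr, sub_eq_add_neg r 1]

/-- On `(0, t)` the delayed history reads only values before `t - 1`, where the histories at `T` and
at `t` coincide; the bound therefore uses data before `t` only. -/
lemma lpNorm_sub_shift_history_le {h₀ : LineL2} (hF : Integrable F) (hv : MemLp v 2 (leb 0 T))
    {t : ℝ} (ht : t ≤ T) :
    lpNorm 2 0 t (fun r => v r - (shift (-1) (history N h₀ F T) : ℝ → ℝ) r)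
      ≤ lpNorm 2 0 t v + ‖past (t + 1) (history N h₀ F t)‖ := by
  set H := history N h₀ F T with hH
  have hv' : MemLp v 2 (leb 0 t) :=
    hv.mono_measure (Measure.restrict_mono (Ioo_subset_Ioo_right ht) le_rfl)
  have hs : MemLp (shift (-1) H : ℝ → ℝ) 2 (leb 0 t) := (Lp.memLp (shift (-1) H)).restrict _
  have h1 : lpNorm 2 0 t (fun r => v r - (shift (-1) H : ℝ → ℝ) r)
      ≤ lpNorm 2 0 t v + lpNorm 2 0 t (shift (-1) H : ℝ → ℝ) := by
    rw [lpNorm, lpNorm, lpNorm, ← ENNReal.toReal_add hv'.2.ne hs.2.ne]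
    exact ENNReal.toReal_mono (ENNReal.add_ne_top.2 ⟨hv'.2.ne, hs.2.ne⟩)
      (eLpNorm_sub_le hv'.1 hs.1 (by norm_num))
  have h2 : lpNorm 2 0 t (shift (-1) H : ℝ → ℝ) ≤ ‖past t (shift (-1) H)‖ := by
    rw [lpNorm, norm_past]
    exact ENNReal.toReal_mono (eLpNorm_restrict_ne_top _ _)
      (eLpNorm_mono_measure _ (Measure.restrict_mono Ioo_subset_Iio_self le_rfl))
  have h3 : past (t - 1) H = past (t - 1) (history N h₀ F t) := by
    have := past_history_sub (N := N) (h₀ := h₀) hF ht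
    rwa [map_sub, sub_eq_zero] at this
  rw [norm_past_shift, ← sub_eq_add_neg, h3] at h2
  linarith [norm_past_mono (by linarith : t - 1 ≤ t + 1) (history N h₀ F t)]

end Solution

end Wave1D

end

open Wave1D in
theorem theorem4 (T : ℝ) (hT : 0 < T) :
    ∃ C : ℝ, 0 < C ∧
      ∀ (A : ℝ × ℝ → ℝ) (B : ℝ → L2) (v : ℝ → ℝ) (u₀ : H1Zero) (u₁ : L2),
        MemLp A ∞ (volume.restrict (cylinder T)) →
        MemLp B 1 (leb 0 T) →
        MemLp v 2 (leb 0 T) →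
        ∃ y : ℝ → H1Zero,
          IsWeakSolution 1 T A B v u₀ u₁ y ∧
          (MemLp B 2 (leb 0 T) → IsWeakSolution 2 T A B v u₀ u₁ y) ∧
          (∀ w : ℝ → H1Zero, IsWeakSolution 1 T A B v u₀ u₁ w → w =ᵐ[leb 0 T] y) ∧
          ContinuousOn y (Icc 0 T) ∧
          (∃ yt : ℝ → L2, ContinuousOn yt (Icc 0 T) ∧
            (∀ t ∈ Icc 0 T, HasDerivWithinAt (fun s => (y s).toL2) (yt t) (Icc 0 T) t) ∧
            ∀ t ∈ Icc 0 T, ‖y t‖ + ‖yt t‖ ≤ dataBound C T A B v u₀ u₁ t) ∧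
          MemLp (fun t => (y t).rep 1) 2 (leb 0 T) ∧
          ∃ g : ℝ → ℝ, MemLp g 2 (leb 0 T) ∧
            IsWeakDeriv 0 T (fun t => (y t).rep 1) g ∧
            ∀ t ∈ Icc 0 T, lpNorm 2 0 t g ≤ dataBound C T A B v u₀ u₁ t := by
  -- The number of reflections is fixed by `T` alone, so all constants built from it depend only on
  -- `T`.
  obtain ⟨N, hN⟩ : ∃ N : ℕ, T ≤ 2 * N := by
    obtain ⟨N, hN⟩ := exists_nat_ge T
    exact ⟨N, by linarith⟩
  set κ : ℝ := 2 * (N + 1) with hκ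
  have hκ0 : 0 < κ := by positivity
  set K : ℝ := 2 * κ + 4 * κ * T * (1 + 2 * κ * T) * Real.exp T with hK
  have hK0 : 0 < K := by positivity
  set c : ℝ := 1 + √(2 * κ) * T with hc
  have hc0 : 0 < c := by positivity
  set C : ℝ := 2 * K + 1 + c with hC
  refine ⟨C, by positivity, fun A B v u₀ u₁ hA hB hv => ?_⟩
  obtain ⟨M, hM, hMm, hMA⟩ := exists_potential_operator hA
  have ha : 0 ≤ supNorm T A := ENNReal.toReal_nonneg
  have hB' := memLp_one_iff_integrable.1 hB
  set h₀ := LineL2.profile N u₀ u₁ (control hv) with hh₀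
  obtain ⟨F, hF, hFB⟩ := LineL2.exists_source_fixed_point (N := N) (h₀ := h₀) hT ha hM hMm hB'
  have hsol := isWeakSolution_displacement le_rfl (by norm_num) hT hN hM hMm hMA hB hv hF hFB
  have hyc : Continuous (LineL2.displacement N h₀ F) := LineL2.continuous_displacement hF
  -- One inequality for both estimates, with `P` the norm of the history before `t + 1`: slope plus
  -- velocity is at most `2P`, the trace derivative at most `‖v‖ + P`. This explains the `2K + 1` in
  -- `C`; the summand `c` is for the exponent.
  have bound : ∀ x P t : ℝ,
      P ≤ K * Real.exp (c * √(supNorm T A))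
        * (√(‖u₀‖ ^ 2 + ‖u₁‖ ^ 2) + lpNorm 1 0 t B + lpNorm 2 0 t v) →
      x ≤ lpNorm 2 0 t v + 2 * P → x ≤ dataBound C T A B v u₀ u₁ t := by
    intro x P t hP hx
    have hB0 : 0 ≤ lpNorm 1 0 t B := ENNReal.toReal_nonneg
    have hv0 : 0 ≤ lpNorm 2 0 t v := ENNReal.toReal_nonneg
    have hu0 := Real.sqrt_nonneg (‖u₀‖ ^ 2 + ‖u₁‖ ^ 2)
    rw [dataBound]
    set d := √(‖u₀‖ ^ 2 + ‖u₁‖ ^ 2) + lpNorm 1 0 t B + lpNorm 2 0 t v with hd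
    have hd0 : 0 ≤ d := by positivity
    set E := Real.exp (c * √(supNorm T A)) with hE
    have hE1 : 1 ≤ E := Real.one_le_exp (by positivity)
    have hEC : E ≤ Real.exp (C * √(supNorm T A)) :=
      Real.exp_le_exp.2 (mul_le_mul_of_nonneg_right (by rw [hC]; linarith) (Real.sqrt_nonneg _))
    have h1 : lpNorm 2 0 t v ≤ E * d := by nlinarith
    calc x ≤ (2 * K + 1) * E * d := by linarith
      _ ≤ C * Real.exp (C * √(supNorm T A)) * d := by
        have : 2 * K + 1 ≤ C := by rw [hC]; linarith
        gcongr
  have hP := fun t ht => norm_past_history_le_data ha hM hB' hv hF hFB hκ (t := t) ht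
  refine ⟨LineL2.displacement N h₀ F, hsol, fun hB2 =>
    isWeakSolution_displacement (by norm_num) le_rfl hT hN hM hMm hMA hB2 hv hF hFB, fun w hw => hw.ae_eq hT hA hsol, hyc.continuousOn,
    ⟨LineL2.velocity N h₀ F, (LineL2.continuous_velocity hF).continuousOn,
      fun t ht => hasDerivWithinAt_displacement hF ht, fun t ht => bound _ _ t (hP t ht) ?_⟩,
    memLp_of_continuous (H1Zero.evalOne.continuous.comp hyc) 2 0 T, _,
    hv.sub ((Lp.memLp (LineL2.shift (-1) (LineL2.history N h₀ F T))).restrict _),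
    isWeakDeriv_rep_one_displacement hT.le hN hF hv, fun t ht => bound _ _ t (hP t ht) ?_⟩
  · have hv0 : 0 ≤ lpNorm 2 0 t v := ENNReal.toReal_nonneg
    linarith [LineL2.norm_displacement_le (N := N) (h₀ := h₀) (F := F) t,
      LineL2.norm_velocity_le (N := N) (h₀ := h₀) (F := F) t]
  · refine (lpNorm_sub_shift_history_le hF hv ht.2).trans ?_
    linarith [norm_nonneg (LineL2.past (t + 1) (LineL2.history N h₀ F t))]
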